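/- **Setting.** For $V \ge 3$, the *augmented dynamic tree problem* is to maintain a forest $F$ on the fixed vertex set $\{0,\dots,V-1\}$, initially without edges, in which every vertex $v$ carries a value $x_v$ from a domain $D$ with a commutative and associative aggregate function $g : D^2 \to D$, under the following operations. * $\mathsf{Root}(v)$ returns the address of the root of the tree containing $v$. As long as no link or cut intervenes, two calls $\mathsf{Root}(a)$, $\mathsf{Root}(b)$ return the same address if and only if $a$ and $b$ lie in the same tree of $F$. When $\mathsf{Root}(v)$ returns, the augmented value stored at the returned address is the aggregate under $g$ of the values of all vertices of the tree containing $v$. * $\mathsf{Update}(v,f)$ replaces $x_v$ by $f(x_v)$. Here $f : D \to D$ is an update that can be carried out on aggregates, that is, $f(g(x_v,r)) = g(f(x_v),r)$ for all $r \in D$ (for example $f = g(\cdot,d)$ with $d\in D$). * $\mathsf{Link}(a,b)$ inserts the edge $ab$, where $a,b$ lie in different trees of $F$. * $\mathsf{Cut}(a,b)$ deletes the edge $ab$ of $F$. **Model.** Randomized word RAM with words of $O(\log V)$ bits, all of whose word instructions, tests and draws of a uniformly random element of $\{0,\dots,m-1\}$ (for a word $m$) take unit time, and with a memory of augmented values.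 Applying $f$ in place to one stored augmented value takes time $w \ge 1$; computing $g$ once, or copying an augmented value, takes time $y \ge 1$. **Lemma.** There is an augmented dynamic tree data structure (a fixed set-up program and one fixed program per operation, independent of $V$, $D$, $g$, $w$, $y$) such that, with probability $1$, all operations of every valid sequence halt and satisfy the specification above, and such that with high probability * $\mathsf{Root}$ takes $O(\log V/\log\log V)$ time, * $\mathsf{Update}$ takes $O(w\cdot \log V/\log\log V)$ time, * $\mathsf{Link}$ and $\mathsf{Cut}$ take $O(y\cdot\log^2 V)$ time. Here "$O(B)$ time with high probability" means: for every $c \in \mathbb N$ there is a constant $C>0$, depending only on $c$, such that for all $V\ge 3$, $D$, $g$, initial values, $w,y\ge 1$ and every valid sequence of operations (of any length, fixed independently of the random choices), the last operation of the sequence takes time at most $C\cdot B$ with probability at least $1-V^{-c}$. -/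

import Mathlib

open MeasureTheory

namespace AugTree

universe u

/-! ### The machine: a randomized word RAM with a separate memory of augmented values

A program is a fixed finite text.  It works with registers and a memory of words (natural numbers
below a modulus `N`) and with a second memory whose cells hold augmented values, elements of an
opaque domain `D`.  Augmented values can only be aggregated, copied, or updated in place. -/

/-- The elementary instructions; `d a b : ℕ` are names of registers. -/
inductive Instr : Type
  /-- `d := n` -/
  | const (d n : ℕ)
  /-- `d := a + b` -/
  | add (d a b : ℕ)
  /-- `d := a - b`, truncated at zero -/
  | sub (d a b : ℕ)
  /-- `d := a * b` -/
  | mul (d a b : ℕ)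
  /-- `d := a / b`, rounded down -/
  | div (d a b : ℕ)
  /-- `d := mem[a]` -/
  | load (d a : ℕ)
  /-- `mem[a] := b` -/
  | store (a b : ℕ)
  /-- `d :=` a fresh uniformly random element of `{0, …, a - 1}` -/
  | rand (d a : ℕ)
  /-- `val[d] := val[a] * val[b]`, one computation of the aggregate function -/
  | aggregate (d a b : ℕ)
  /-- `val[d] := val[a]`, charged like one computation of the aggregate function -/
  | copy (d a : ℕ)
  /-- `val[a] := f (val[a])`, where `f` is the value update being carried out -/
  | modify (a : ℕ)

/-- Structured programs; the tests ask whether register `r` is nonzero. -/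
inductive Cmd : Type
  | skip
  | instr (i : Instr)
  | seq (c₁ c₂ : Cmd)
  | ite (r : ℕ) (c₁ c₂ : Cmd)
  | loop (r : ℕ) (c : Cmd)

/-- A machine state: registers, word memory, memory of augmented values, the number of random
samples drawn so far, and the cost counters of the running operation. -/
structure State (D : Type u) : Type u where
  reg : ℕ → ℕ
  mem : ℕ → ℕ
  val : ℕ → D
  drawn : ℕ
  steps : ℕ
  modifications : ℕ
  aggregations : ℕ

namespace State

variable {D : Type u}

/-- Charge one unit of time. -/
def tick (s : State D) : State D := { s with steps := s.steps + 1 }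

/-- Put a number, reduced to a word, into a register, at unit cost. -/
def put (N : ℕ) (s : State D) (d n : ℕ) : State D :=
  { s with reg := Function.update s.reg d (n % N) }.tick

/-- Running time recorded by the counters, if one in-place update of an augmented value takes time
`w`, one aggregation (or copy) takes time `y`, and everything else takes unit time. -/
def time (w y : ℝ) (s : State D) : ℝ :=
  s.steps + w * s.modifications + y * s.aggregations

end State

/-- The source of randomness: a sequence of independent uniform samples from `[0, 1]`. -/
abbrev Tape : Type := ℕ → unitInterval

noncomputable section

/-- The law of the random tape. -/
def tapeLaw : Measure Tape := Measure.infinitePi fun _ => (volume : Measure unitInterval)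

/-- The element of `{0, …, m - 1}` selected by the `k`-th sample of the tape (zero if `m = 0`);
the reduction modulo `m` matters only on the null event that the sample equals `1`. -/
def Tape.sample (ω : Tape) (k m : ℕ) : ℕ := ⌊(m : ℝ) * (ω k : ℝ)⌋₊ % m

variable {D : Type u} [CommSemigroup D]

/-- Effect of an instruction, for word modulus `N`, random tape `ω` and current value update `f`. -/
def Instr.run (N : ℕ) (ω : Tape) (f : D → D) : Instr → State D → State D
  | .const d n, s => s.put N d n
  | .add d a b, s => s.put N d (s.reg a + s.reg b)
  | .sub d a b, s => s.put N d (s.reg a - s.reg b)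
  | .mul d a b, s => s.put N d (s.reg a * s.reg b)
  | .div d a b, s => s.put N d (s.reg a / s.reg b)
  | .load d a, s => s.put N d (s.mem (s.reg a))
  | .store a b, s => { s with mem := Function.update s.mem (s.reg a) (s.reg b) }.tick
  | .rand d a, s => { s.put N d (ω.sample s.drawn (s.reg a)) with drawn := s.drawn + 1 }
  | .aggregate d a b, s =>
      { s with
        val := Function.update s.val (s.reg d) (s.val (s.reg a) * s.val (s.reg b))
        aggregations := s.aggregations + 1 }
  | .copy d a, s =>
      { s with
        val := Function.update s.val (s.reg d) (s.val (s.reg a))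
        aggregations := s.aggregations + 1 }
  | .modify a, s =>
      { s with
        val := Function.update s.val (s.reg a) (f (s.val (s.reg a)))
        modifications := s.modifications + 1 }

/-- `Exec N ω f c s s'`: the program `c`, started in `s`, halts in `s'`. Each test costs one unit
of time. -/
inductive Exec (N : ℕ) (ω : Tape) (f : D → D) : Cmd → State D → State D → Prop
  | skip (s : State D) : Exec N ω f .skip s s
  | instr (i : Instr) (s : State D) : Exec N ω f (.instr i) s (i.run N ω f s)
  | seq {c₁ c₂ : Cmd} {s s' s'' : State D} :
      Exec N ω f c₁ s s' → Exec N ω f c₂ s' s'' → Exec N ω f (.seq c₁ c₂) s s''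
  | ite_true {r : ℕ} {c₁ c₂ : Cmd} {s s' : State D} :
      s.reg r ≠ 0 → Exec N ω f c₁ s.tick s' → Exec N ω f (.ite r c₁ c₂) s s'
  | ite_false {r : ℕ} {c₁ c₂ : Cmd} {s s' : State D} :
      s.reg r = 0 → Exec N ω f c₂ s.tick s' → Exec N ω f (.ite r c₁ c₂) s s'
  | loop_done {r : ℕ} {c : Cmd} {s : State D} :
      s.reg r = 0 → Exec N ω f (.loop r c) s s.tick
  | loop_step {r : ℕ} {c : Cmd} {s s' s'' : State D} :
      s.reg r ≠ 0 → Exec N ω f c s.tick s' → Exec N ω f (.loop r c) s' s'' →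
        Exec N ω f (.loop r c) s s''

/-! ### The augmented dynamic tree problem -/

/-- The maintained object: a forest on the fixed vertex set `Fin V`, with a value at each vertex. -/
structure Forest (V : ℕ) (D : Type u) : Type u where
  graph : SimpleGraph (Fin V)
  value : Fin V → D

/-- The operations: root finding, update of the value of a vertex, link and cut. -/
inductive Op (V : ℕ) (D : Type u) : Type u
  | root (v : Fin V)
  | update (v : Fin V) (f : D → D)
  | link (a b : Fin V)
  | cut (a b : Fin V)

/-- Preconditions. A link joins two different trees and a cut removes an existing edge. A value
update `f` at `v` has to make sense on the aggregates that `v` contributes to: applied to an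
aggregate of the value of `v` with anything else, it replaces the contribution of `v`. -/
def Op.Valid {V : ℕ} (F : Forest V D) : Op V D → Prop
  | .root _ => True
  | .update v f => ∀ r : D, f (F.value v * r) = f (F.value v) * r
  | .link a b => ¬ F.graph.Reachable a b
  | .cut a b => F.graph.Adj a b

/-- Effect of an operation on the forest. -/
def Op.apply {V : ℕ} (F : Forest V D) : Op V D → Forest V D
  | .root _ => F
  | .update v f => { F with value := Function.update F.value v (f (F.value v)) }
  | .link a b => { F with graph := F.graph ⊔ SimpleGraph.edge a b }
  | .cut a b => { F with graph := F.graph.deleteEdges {s(a, b)} }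

/-- Root finding and value updates leave the set of edges alone. -/
def Op.KeepsEdges {V : ℕ} : Op V D → Prop
  | .root _ => True
  | .update _ _ => True
  | .link _ _ => False
  | .cut _ _ => False

/-- The edgeless forest, with given values. -/
def Forest.edgeless (V : ℕ) (x : ℕ → D) : Forest V D where
  graph := ⊥
  value v := x v

/-- The forest after a sequence of operations. -/
def Forest.after {V : ℕ} (F : Forest V D) (ops : List (Op V D)) : Forest V D :=
  ops.foldl Op.apply F

/-- Every operation of the sequence meets its precondition when its turn comes. -/
def Forest.ValidSeq {V : ℕ} : Forest V D → List (Op V D) → Prop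
  | _, [] => True
  | F, o :: ops => o.Valid F ∧ Forest.ValidSeq (o.apply F) ops

open Classical in
/-- The aggregate of the values of the tree that contains `v`. It is a product over a nonempty set,
so it belongs to `D`; it is written in `WithOne D` because `D` need not have a unit. -/
def Forest.aggregate {V : ℕ} (F : Forest V D) (v : Fin V) : WithOne D :=
  ∏ x ∈ Finset.univ.filter (fun x => F.graph.Reachable v x), (F.value x : WithOne D)

/-! ### Data structures -/

/-- A data structure: a word size (words are natural numbers below `V ^ wordExp`, so they have
`wordExp * log V` bits), a program that sets up the edgeless forest, and a program for each
operation. None of these depends on `V`. -/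
structure DataStructure : Type where
  wordExp : ℕ
  setup : Cmd
  root : Cmd
  update : Cmd
  link : Cmd
  cut : Cmd

/-- The machine before set-up: register `0` holds `V`, value cell `v < V` holds the initial value of
the vertex `v`, the remaining value cells have arbitrary contents, and everything else is zero. -/
def blank (V : ℕ) (x : ℕ → D) : State D where
  reg := Function.update (fun _ => 0) 0 V
  mem := fun _ => 0
  val := x
  drawn := 0
  steps := 0
  modifications := 0
  aggregations := 0

/-- The state in which the program of an operation is started: the vertices it is applied to are put
into registers `0` and `1`, and the cost counters are reset. -/
def Op.start {V : ℕ} (o : Op V D) (s : State D) : State D :=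
  { s with
    reg :=
      match o with
      | .root v => Function.update s.reg 0 (v : ℕ)
      | .update v _ => Function.update s.reg 0 (v : ℕ)
      | .link a b => Function.update (Function.update s.reg 0 (a : ℕ)) 1 (b : ℕ)
      | .cut a b => Function.update (Function.update s.reg 0 (a : ℕ)) 1 (b : ℕ)
    steps := 0
    modifications := 0
    aggregations := 0 }

/-- The value update that the instruction `modify` performs during an operation. -/
def Op.modifier {V : ℕ} : Op V D → D → D
  | .update _ f => f
  | _ => id

namespace DataStructure

/-- The program for an operation. -/
def code {V : ℕ} (P : DataStructure) : Op V D → Cmd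
  | .root _ => P.root
  | .update _ _ => P.update
  | .link _ _ => P.link
  | .cut _ _ => P.cut

/-- The operations of the list, executed one after the other from `s`, all halt, ending in `s'`. -/
def Runs {V : ℕ} (P : DataStructure) (ω : Tape) : State D → List (Op V D) → State D → Prop
  | s, [], s' => s = s'
  | s, o :: ops, s' =>
      ∃ t, Exec (V ^ P.wordExp) ω o.modifier (P.code o) (o.start s) t ∧ P.Runs ω t ops s'

/-- Set-up and then the operations of the list all halt, ending in `s`. If the list is nonempty, the
cost counters of `s` describe its last operation. -/
def Reaches {V : ℕ} (P : DataStructure) (ω : Tape) (x : ℕ → D) (ops : List (Op V D))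
    (s : State D) : Prop :=
  ∃ s₀, Exec (V ^ P.wordExp) ω id P.setup (blank V x) s₀ ∧ P.Runs ω s₀ ops s

/-- With the random tape `ω`, the data structure solves the augmented dynamic tree problem on `V`
vertices with initial values `x`. Root finding leaves the address of the root in register `0`. -/
structure Solves (P : DataStructure) (V : ℕ) (x : ℕ → D) (ω : Tape) : Prop where
  /-- All operations halt. -/
  halts : ∀ ops : List (Op V D), (Forest.edgeless V x).ValidSeq ops →
    ∃ s, P.Reaches ω x ops s
  /-- As long as no link or cut intervenes, two calls of root finding return the same root if and
  only if their arguments lie in the same tree. -/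
  root_eq_iff : ∀ (pre mid : List (Op V D)) (a b : Fin V) (s t : State D),
    (Forest.edgeless V x).ValidSeq (pre ++ .root a :: (mid ++ [.root b])) →
    (∀ o ∈ mid, o.KeepsEdges) →
    P.Reaches ω x (pre ++ [.root a]) s →
    P.Reaches ω x (pre ++ .root a :: (mid ++ [.root b])) t →
    (s.reg 0 = t.reg 0 ↔ ((Forest.edgeless V x).after pre).graph.Reachable a b)
  /-- The value stored at the root is the aggregate of the values of the tree. -/
  root_value : ∀ (pre : List (Op V D)) (a : Fin V) (s : State D),
    (Forest.edgeless V x).ValidSeq (pre ++ [.root a]) →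
    P.Reaches ω x (pre ++ [.root a]) s →
    (s.val (s.reg 0) : WithOne D) = ((Forest.edgeless V x).after pre).aggregate a

end DataStructure

/-- The running time claimed for an operation, up to a constant factor. -/
def Op.bound {V : ℕ} (w y : ℝ) : Op V D → ℝ
  | .root _ => Real.log V / Real.log (Real.log V)
  | .update _ _ => w * (Real.log V / Real.log (Real.log V))
  | .link _ _ => y * Real.log V ^ 2
  | .cut _ _ => y * Real.log V ^ 2

end

end AugTree

/-!
# Augmented dynamic trees by random chunking of Euler tours

The edges of the forest `F` are encoded by one permutation of the `V * V` pairs of vertices.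
Composing the involution that exchanges the two darts `(a, b)`, `(b, a)` of every edge with the
rotation that turns `(a, b)` into the next pair with the same tail `a` gives `tour F.graph`. Since
`F` has no cycles, the orbits of this permutation are the trees (`orb_of_acyclic`): a tour that passes
an edge comes back over it. Inserting and deleting the edge `ab` have the same effect on the tour,
namely that the successors of the darts `(a, b)` and `(b, a)` are exchanged (`tour_link`), so links
and cuts share one program.

Every pair draws, once and for all, a random height between `0` and `L = depth V`, at least `i` with
probability `B ^ (-i)`, where `B = base V` is of order `log V`. The pairs of height at least `i + 1`
cut the cycles of level `i` into chunks, and the first elements of these chunks form level `i + 1`,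
on which the successor of a head is the next head (`Hier`). Every element stores its successor, its
head, and the aggregate of the vertices below it. A cycle on which no higher element is left has a
single, arbitrarily chosen head, which becomes the root of the tree. Two vertices have the same root
exactly when they lie in the same cycle (`Hier.isRoot_iff_orb`), and the root has the aggregate of
the tree (`Hier.agg_root`). As `B ^ L` is about `V ^ 2`, the number of levels is
`O(log V / log log V)`; finding a root and changing a value means climbing them.

An exchange of two successors is repaired from the bottom to the top (`splice_spec`): on each level
at most two nodes have changed, and rebuilding the chunks that start at these nodes and at their old
heads repairs the level, after which at most the two heads have changed on the next level
(`Rebuild.levelOK`). All these chunks lie near one of the two darts (`Mid.near`): they consist of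
elements `w` of level `i` such that no element of level `i + 1` separates `w` from the dart on the old
tour. On the way from the dart along the tour, forwards or backwards, such a `w` is a weak record of
the heights, with two exceptions per level (the dart itself, and the nearest higher element behind
it). The time is thus governed by the numbers of records of four sequences of independent heights
(`sum_near_le`). For at most `B ^ L` heights, the expectation of `(1 + 1 / (2 * B)) ^ records` is at
most a constant times `2 ^ L` (`sum_pow_records_le`), hence there are `O(B * (L + k))` records up to a
probability of order `2 ^ (-k)` (`tapeLaw_records_le`). With `k = c * B`, where `V ≤ 2 ^ B`, this is
`O(log V ^ 2)` with probability `1 - V ^ (-c)`. The heights are fixed at the outset and the sequence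
of operations does not depend on them, so the bound holds at every time.

Correctness holds for every random tape. The programs are verified with a total-correctness calculus
(`Halts`) for the machine, and the invariant that relates the memory to the forest is `Repr`.
-/

namespace AugTree

universe u

/-! ### Segments of a cyclic order and one level of the hierarchy -/

/-- `Seg H s x u`: following the successor function `s` from `x` one arrives at `u` without entering
`H` on the way (the starting point `x` itself may lie in `H`). -/
def Seg (H : Finset ℕ) (s : ℕ → ℕ) : ℕ → ℕ → Prop :=
  Relation.ReflTransGen fun a b => b = s a ∧ b ∉ H

/-- `s` restricts to a permutation of the finite set `G`. -/
structure PermOn (G : Finset ℕ) (s : ℕ → ℕ) : Prop where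
  maps : ∀ u ∈ G, s u ∈ G
  inj : ∀ u ∈ G, ∀ v ∈ G, s u = s v → u = v

namespace Seg

variable {G H H' : Finset ℕ} {s s' : ℕ → ℕ} {p q x y u v w z : ℕ}

theorem refl (x : ℕ) : Seg H s x x := Relation.ReflTransGen.refl

theorem trans (h : Seg H s x y) (h' : Seg H s y z) : Seg H s x z := Relation.ReflTransGen.trans h h'

theorem step (h : Seg H s x u) (hu : s u ∉ H) : Seg H s x (s u) :=
  Relation.ReflTransGen.tail h ⟨rfl, hu⟩

theorem mono (hH : H ⊆ H') (h : Seg H' s x u) : Seg H s x u :=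
  Relation.ReflTransGen.mono (r := fun a b => b = s a ∧ b ∉ H')
    (p := fun a b => b = s a ∧ b ∉ H) (fun _ _ hab => ⟨hab.1, fun hb => hab.2 (hH hb)⟩) _ _ h

theorem mem (hs : PermOn G s) (hx : x ∈ G) (h : Seg H s x u) : u ∈ G := by
  induction h with
  | refl => exact hx
  | tail _ hab ih => rw [hab.1]; exact hs.maps _ ih

theorem eq_of_mem (h : Seg H s x u) (hu : u ∈ H) : u = x := by
  rcases Relation.ReflTransGen.cases_tail h with h | ⟨_, _, hab⟩
  · exact h
  · exact absurd hu hab.2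

theorem pred (hs : PermOn G s) (hx : x ∈ G) (hu : u ∈ G) (h : Seg H s x (s u)) :
    s u = x ∨ Seg H s x u := by
  rcases Relation.ReflTransGen.cases_tail h with h | ⟨a, ha, hab⟩
  · exact Or.inl h
  · right
    have := hs.inj u hu a (mem hs hx ha) hab.1
    rwa [this]

theorem total (h : Seg H s x u) (h' : Seg H s x v) : Seg H s u v ∨ Seg H s v u :=
  Relation.ReflTransGen.total_of_right_unique
    (fun _ _ _ hab hac => hab.1.trans hac.1.symm) h h'

theorem eq_of_exit (h : Seg H s u v) (hu : s u ∈ H) : v = u := by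
  rcases Relation.ReflTransGen.cases_head h with h | ⟨a, hab, _⟩
  · exact h.symm
  · exact absurd (hab.1 ▸ hu) hab.2

theorem exit_unique (h : Seg H s x u) (h' : Seg H s x v) (hu : s u ∈ H) (hv : s v ∈ H) : u = v := by
  rcases total h h' with h | h
  · exact (eq_of_exit h hu).symm
  · exact eq_of_exit h hv

theorem iterate (k : ℕ) (h : ∀ j, 0 < j → j ≤ k → s^[j] x ∉ H) : Seg H s x (s^[k] x) := by
  induction k with
  | zero => exact refl x
  | succ k ih =>
    rw [Function.iterate_succ_apply']
    apply step (ih fun j h0 hj => h j h0 (by omega))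
    rw [← Function.iterate_succ_apply' s]
    exact h (k + 1) (by omega) le_rfl

theorem exists_iterate (h : Seg H s x u) :
    ∃ k, s^[k] x = u ∧ ∀ j, 0 < j → j ≤ k → s^[j] x ∉ H := by
  induction h with
  | refl => exact ⟨0, rfl, fun j h0 hj => by omega⟩
  | @tail a b _ hab ih =>
    obtain ⟨k, hk, hn⟩ := ih
    have hk' : s^[k + 1] x = b := by rw [Function.iterate_succ_apply', hk, hab.1]
    refine ⟨k + 1, hk', fun j h0 hj => ?_⟩
    rcases Nat.lt_or_ge j (k + 1) with hlt | hge
    · exact hn j h0 (by omega)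
    · rw [show j = k + 1 by omega, hk']; exact hab.2

theorem congr (hs : PermOn G s) (hx : x ∈ G) (he : ∀ u ∈ G, s u = s' u) :
    Seg H s x u ↔ Seg H s' x u := by
  constructor
  · intro h
    induction h with
    | refl => exact refl x
    | @tail a b h hab ih =>
      refine Relation.ReflTransGen.tail ih ⟨?_, hab.2⟩
      rw [hab.1, he a (mem hs hx h)]
  · intro h
    have : Seg H s x u ∧ u ∈ G := by
      induction h with
      | refl => exact ⟨refl x, hx⟩
      | @tail a b h hab ih =>
        have hb : b = s a := by rw [hab.1, he a ih.2]
        exact ⟨Relation.ReflTransGen.tail ih.1 ⟨hb, hab.2⟩, hb ▸ hs.maps _ ih.2⟩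
    exact this.1

end Seg

namespace PermOn

variable {G H : Finset ℕ} {s s' : ℕ → ℕ} {p q x y u v : ℕ}

theorem iterate_mem (hs : PermOn G s) (hx : x ∈ G) (k : ℕ) : s^[k] x ∈ G := by
  induction k with
  | zero => exact hx
  | succ k ih => rw [Function.iterate_succ_apply']; exact hs.maps _ ih

theorem iterate_cancel (hs : PermOn G s) (hx : x ∈ G) (hy : y ∈ G) (k : ℕ)
    (h : s^[k] x = s^[k] y) : x = y := by
  induction k with
  | zero => exact h
  | succ k ih =>
    rw [Function.iterate_succ_apply', Function.iterate_succ_apply'] at h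
    exact ih (hs.inj _ (hs.iterate_mem hx k) _ (hs.iterate_mem hy k) h)

theorem exists_period (hs : PermOn G s) (hx : x ∈ G) : ∃ n, 0 < n ∧ s^[n] x = x := by
  have hni : ¬ Function.Injective fun k : ℕ => (⟨s^[k] x, hs.iterate_mem hx k⟩ : G) :=
    not_injective_infinite_finite _
  simp only [Function.Injective, not_forall] at hni
  obtain ⟨a, b, hab, hne⟩ := hni
  replace hab : s^[a] x = s^[b] x := congrArg Subtype.val hab
  wlog hlt : a < b generalizing a b
  · exact this b a (fun h => hne h.symm) hab.symm
      (lt_of_le_of_ne (not_lt.1 hlt) fun h => hne (by subst h; rfl))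
  refine ⟨b - a, by omega, ?_⟩
  apply hs.iterate_cancel (hs.iterate_mem hx _) hx a
  rw [← Function.iterate_add_apply, Nat.add_sub_cancel' hlt.le, hab]

/-- Walking backwards from `v` one either meets `H`, or `v` lies on a cycle that avoids `H`. -/
theorem head_or_cap (hs : PermOn G s) (hv : v ∈ G) :
    (∃ e ∈ H, e ∈ G ∧ Seg H s e v) ∨
      ((∀ u ∈ G, s u = v → Seg H s v u) ∧ ∀ u, Seg H s v u → s u ∉ H) := by
  obtain ⟨n, hn, hnv⟩ := hs.exists_period hv
  by_cases hall : ∀ j, 0 < j → j ≤ n → s^[j] v ∉ H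
  · right
    have hall' : ∀ j, s^[j + 1] v ∉ H := by
      intro j
      have hp : Function.IsPeriodicPt s n v := hnv
      have h1 : s^[j + 1] v = s (s^[j % n] v) := by
        rw [Function.iterate_succ_apply', hp.iterate_mod_apply]
      rw [h1, ← Function.iterate_succ_apply' s]
      exact hall _ (by omega) (Nat.mod_lt _ hn)
    have hseg : ∀ k, Seg H s v (s^[k] v) := fun k => Seg.iterate k fun j h0 _ => by
      obtain ⟨j, rfl⟩ : ∃ i, j = i + 1 := ⟨j - 1, by omega⟩
      exact hall' j
    refine ⟨fun u hu huv => ?_, fun u hu => ?_⟩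
    · obtain ⟨m, rfl⟩ : ∃ m, n = m + 1 := ⟨n - 1, by omega⟩
      rw [Function.iterate_succ_apply'] at hnv
      have : u = s^[m] v := hs.inj u hu _ (hs.iterate_mem hv m) (huv.trans hnv.symm)
      rw [this]; exact hseg m
    · obtain ⟨k, hk, -⟩ := hu.exists_iterate
      rw [← hk, ← Function.iterate_succ_apply' s]
      exact hall' k
  · left
    push Not at hall
    classical
    obtain ⟨j0, h0, hj0, hmem⟩ := hall
    have hP : ∃ d, d < n ∧ s^[n - d] v ∈ H := ⟨n - j0, by omega, by
      rwa [show n - (n - j0) = j0 by omega]⟩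
    let d := Nat.find hP
    obtain ⟨hd, hdH⟩ := Nat.find_spec hP
    refine ⟨s^[n - d] v, hdH, hs.iterate_mem hv _, ?_⟩
    have hend : s^[d] (s^[n - d] v) = v := by
      rw [← Function.iterate_add_apply, show d + (n - d) = n by omega, hnv]
    have := Seg.iterate (H := H) (s := s) (x := s^[n - d] v) d fun j h0 hj => by
      rw [← Function.iterate_add_apply]
      have := Nat.find_min hP (m := d - j) (by omega)
      rw [show n - (d - j) = j + (n - d) by omega] at this
      exact fun h => this ⟨by omega, h⟩
    rwa [hend] at this

/-- Walking forwards from a point of `H` one eventually re-enters `H`. -/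
theorem exists_exit (hs : PermOn G s) (hx : x ∈ G) (hxH : x ∈ H) :
    ∃ u ∈ G, Seg H s x u ∧ s u ∈ H := by
  classical
  obtain ⟨n, hn, hnx⟩ := hs.exists_period hx
  have hP : ∃ d, s^[d + 1] x ∈ H := ⟨n - 1, by rw [show n - 1 + 1 = n by omega, hnx]; exact hxH⟩
  refine ⟨s^[Nat.find hP] x, hs.iterate_mem hx _, Seg.iterate _ fun j h0 hj => ?_, ?_⟩
  · have := Nat.find_min hP (m := j - 1) (by omega)
    rwa [show j - 1 + 1 = j by omega] at this
  · rw [← Function.iterate_succ_apply' s]; exact Nat.find_spec hP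

/-- If `s` and `s'` agree off `{p, q}`, then `s` sends `p` and `q` to values of `s'` at `p, q`. -/
theorem swap_values (hs : PermOn G s) (hs' : PermOn G s')
    (hp : p ∈ G) (hq : q ∈ G) (he : ∀ u ∈ G, u ≠ p → u ≠ q → s u = s' u)
    (hv : v = p ∨ v = q) : s v = s' p ∨ s v = s' q := by
  have hvG : v ∈ G := by rcases hv with rfl | rfl <;> assumption
  obtain ⟨n, hn, hnx⟩ := hs'.exists_period (hs.maps v hvG)
  obtain ⟨m, rfl⟩ : ∃ m, n = m + 1 := ⟨n - 1, by omega⟩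
  rw [Function.iterate_succ_apply'] at hnx
  set t := s'^[m] (s v) with ht
  have htG : t ∈ G := hs'.iterate_mem (hs.maps v hvG) m
  by_cases h1 : t = p
  · left; rw [← hnx, h1]
  by_cases h2 : t = q
  · right; rw [← hnx, h2]
  have : t = v := hs.inj t htG v hvG (by rw [he t htG h1 h2, hnx])
  rcases hv with rfl | rfl
  · exact absurd this h1
  · exact absurd this h2

/-- A segment of `s` is a segment of `s'`, unless it runs into the part reached from `p` or `q`. -/
theorem seg_transfer (hs : PermOn G s) (hs' : PermOn G s')
    (hp : p ∈ G) (hq : q ∈ G) (he : ∀ u ∈ G, u ≠ p → u ≠ q → s u = s' u)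
    (hx : x ∈ G) (h : Seg H s x u) : Seg H s' x u ∨ Seg H s' p u ∨ Seg H s' q u := by
  induction h with
  | refl => exact Or.inl (Seg.refl x)
  | @tail a b h hab ih =>
    have ha : a ∈ G := Seg.mem hs hx h
    by_cases hpq : a = p ∨ a = q
    · rcases swap_values hs hs' hp hq he hpq with h' | h'
      · exact Or.inr (Or.inl (Relation.ReflTransGen.single ⟨hab.1.trans h', hab.2⟩))
      · exact Or.inr (Or.inr (Relation.ReflTransGen.single ⟨hab.1.trans h', hab.2⟩))
    · push Not at hpq
      have hb : b = s' a ∧ b ∉ H := ⟨by rw [hab.1, he a ha hpq.1 hpq.2], hab.2⟩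
      rcases ih with ih | ih | ih
      · exact Or.inl (ih.tail hb)
      · exact Or.inr (Or.inl (ih.tail hb))
      · exact Or.inr (Or.inr (ih.tail hb))

/-- A segment of `s'` is a segment of `s`, up to the place where it first meets `p` or `q`. -/
theorem seg_first (hs' : PermOn G s')
    (he : ∀ u ∈ G, u ≠ p → u ≠ q → s u = s' u)
    (hx : x ∈ G) (h : Seg H s' x u) : Seg H s x u ∨ Seg H s x p ∨ Seg H s x q := by
  induction h with
  | refl => exact Or.inl (Seg.refl x)
  | @tail a b h hab ih =>
    have ha : a ∈ G := Seg.mem hs' hx h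
    rcases ih with ih | ih
    · by_cases h1 : a = p
      · exact Or.inr (Or.inl (h1 ▸ ih))
      by_cases h2 : a = q
      · exact Or.inr (Or.inr (h2 ▸ ih))
      exact Or.inl (ih.tail ⟨by rw [hab.1, he a ha h1 h2], hab.2⟩)
    · exact Or.inr ih

end PermOn

/-- One level of the hierarchy. The elements of `G`, cyclically ordered by `s`, are cut into chunks
in front of every element of `H`. The head `hd u` of the chunk of `u` is its first element, which
lies in `H`, or, if the cycle of `u` avoids `H`, an element of the cycle elected arbitrarily. On the
next level, where the chunks are represented by their heads, the successor function is `n`. -/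
structure LevelOK (G H : Finset ℕ) (s hd n : ℕ → ℕ) : Prop where
  mem : ∀ u ∈ G, hd u ∈ G
  seg : ∀ u ∈ G, Seg H s (hd u) u
  same : ∀ u ∈ G, s u ∉ H → hd (s u) = hd u
  next : ∀ u ∈ G, s u ∈ H → hd u ∈ H ∧ n (hd u) = s u

namespace LevelOK

variable {G H : Finset ℕ} {s s' hd hd' n n' : ℕ → ℕ} {p q x y u v w y₁ y₂ : ℕ}

theorem hd_of_mem (h : LevelOK G H s hd n) (hu : u ∈ G) (huH : u ∈ H) : hd u = u :=
  (Seg.eq_of_mem (h.seg u hu) huH).symm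

theorem hd_seg (h : LevelOK G H s hd n) (hs : PermOn G s) (hx : x ∈ G) (hxu : Seg H s x u) :
    hd u = hd x := by
  induction hxu with
  | refl => rfl
  | @tail a b hxa hab ih =>
    rw [← ih, hab.1]
    exact h.same a (Seg.mem hs hx hxa) (hab.1 ▸ hab.2)

theorem hd_eq (h : LevelOK G H s hd n) (hs : PermOn G s) (hx : x ∈ G) (hxH : x ∈ H)
    (hxu : Seg H s x u) : hd u = x := by
  rw [h.hd_seg hs hx hxu, h.hd_of_mem hx hxH]

theorem permOn (h : LevelOK G H s hd n) (hs : PermOn G s) (hHG : H ⊆ G) : PermOn H n := by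
  have key : ∀ x ∈ H, ∃ u ∈ G, hd u = x ∧ n x = s u ∧ s u ∈ H := fun x hx => by
    obtain ⟨u, hu, hxu, hsu⟩ := hs.exists_exit (hHG hx) hx
    have := h.hd_eq hs (hHG hx) hx hxu
    exact ⟨u, hu, this, this ▸ (h.next u hu hsu).2, hsu⟩
  constructor
  · intro x hx
    obtain ⟨u, -, -, hn, hsu⟩ := key x hx
    rwa [hn]
  · intro x hx y hy hxy
    obtain ⟨u, hu, hux, hn, -⟩ := key x hx
    obtain ⟨v, hv, hvy, hn', -⟩ := key y hy
    rw [hn, hn'] at hxy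
    rw [← hux, ← hvy, hs.inj u hu v hv hxy]

end LevelOK

open Classical in
/-- The heads after the chunks of `p`, `q`, `y₁`, `y₂` have been rebuilt in this order. -/
noncomputable def rehead (H : Finset ℕ) (s hd : ℕ → ℕ) (p q y₁ y₂ u : ℕ) : ℕ :=
  if Seg H s y₂ u then y₂ else if Seg H s y₁ u then y₁ else if Seg H s q u then q
    else if Seg H s p u then p else hd u

/-- The data of a local change of one level: the old level is correct, the successor function
changes at most at `p` and `q`, and the chunks of `p`, `q`, `y₁`, `y₂` are rebuilt in this order, where
`y₁`, `y₂` include the old heads of `p` and `q` as far as these lie in `H`. -/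
structure Rebuild (G H : Finset ℕ) (s s' hd n n' : ℕ → ℕ) (p q y₁ y₂ : ℕ) : Prop where
  ok : LevelOK G H s hd n
  perm : PermOn G s
  perm' : PermOn G s'
  sub : H ⊆ G
  hp : p ∈ G
  hq : q ∈ G
  agree : ∀ u ∈ G, u ≠ p → u ≠ q → s u = s' u
  heads : ∀ v, v = p ∨ v = q → hd v ∈ H → hd v = y₁ ∨ hd v = y₂
  kind : (y₁ ∈ H ∧ y₂ ∈ H) ∨ (y₁ = p ∧ y₂ = q ∧ hd p ∉ H ∧ hd q ∉ H)
  exit : ∀ x, x = p ∨ x = q ∨ x = y₁ ∨ x = y₂ →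
    ∃ w, Seg H s' x w ∧ n' x = s' w ∧ (s' w ∈ H ∨ s' w = x)
  keep : ∀ x ∈ H, x ≠ p → x ≠ q → x ≠ y₁ → x ≠ y₂ → n' x = n x

namespace Rebuild

variable {G H : Finset ℕ} {s s' hd n n' : ℕ → ℕ} {p q x y u v w y₁ y₂ : ℕ}

theorem y₁_mem (h : Rebuild G H s s' hd n n' p q y₁ y₂) : y₁ ∈ G := by
  rcases h.kind with h' | h'
  · exact h.sub h'.1
  · rw [h'.1]; exact h.hp

theorem y₂_mem (h : Rebuild G H s s' hd n n' p q y₁ y₂) : y₂ ∈ G := by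
  rcases h.kind with h' | h'
  · exact h.sub h'.2
  · rw [h'.2.1]; exact h.hq

/-- The elements from which chunks are rebuilt. -/
def Start (p q y₁ y₂ x : ℕ) : Prop := x = p ∨ x = q ∨ x = y₁ ∨ x = y₂

theorem start_mem (h : Rebuild G H s s' hd n n' p q y₁ y₂) (hx : Start p q y₁ y₂ x) : x ∈ G := by
  rcases hx with rfl | rfl | rfl | rfl
  exacts [h.hp, h.hq, h.y₁_mem, h.y₂_mem]

theorem rehead_cases (H : Finset ℕ) (s' hd : ℕ → ℕ) (p q y₁ y₂ u : ℕ) :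
    (∃ x, Start p q y₁ y₂ x ∧ Seg H s' x u ∧ rehead H s' hd p q y₁ y₂ u = x) ∨
      ((∀ x, Start p q y₁ y₂ x → ¬ Seg H s' x u) ∧ rehead H s' hd p q y₁ y₂ u = hd u) := by
  unfold rehead Start
  split_ifs with h1 h2 h3 h4
  · exact Or.inl ⟨y₂, by simp, h1, rfl⟩
  · exact Or.inl ⟨y₁, by simp, h2, rfl⟩
  · exact Or.inl ⟨q, by simp, h3, rfl⟩
  · exact Or.inl ⟨p, by simp, h4, rfl⟩
  · refine Or.inr ⟨?_, rfl⟩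
    rintro x (rfl | rfl | rfl | rfl) <;> assumption

theorem rehead_of_untouched (hu : ∀ x, Start p q y₁ y₂ x → ¬ Seg H s' x u) :
    rehead H s' hd p q y₁ y₂ u = hd u := by
  rcases rehead_cases H s' hd p q y₁ y₂ u with ⟨x, hx, hxu, -⟩ | h'
  · exact absurd hxu (hu x hx)
  · exact h'.2

/-- After the change, `p` and `q` lie in the chunk of `y₁` or `y₂`, or on a cycle that avoids `H`. -/
theorem covered (h : Rebuild G H s s' hd n n' p q y₁ y₂) (hv : v = p ∨ v = q) :
    (∃ e ∈ H, (e = y₁ ∨ e = y₂) ∧ Seg H s' e v) ∨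
      ((∀ u ∈ G, s' u = v → Seg H s' v u) ∧ ∀ u, Seg H s' v u → s' u ∉ H) := by
  have hvG : v ∈ G := by rcases hv with rfl | rfl; exacts [h.hp, h.hq]
  rcases h.perm'.head_or_cap (H := H) hvG with ⟨e, he, heG, hev⟩ | hc
  · left
    refine ⟨e, he, ?_, hev⟩
    have : Seg H s e p ∨ Seg H s e q := by
      rcases h.perm'.seg_first h.agree heG hev with h' | h'
      · rcases hv with rfl | rfl
        exacts [Or.inl h', Or.inr h']
      · exact h'
    rcases this with h' | h'
    · have := h.ok.hd_eq h.perm heG he h'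
      exact this ▸ h.heads p (Or.inl rfl) (this ▸ he)
    · have := h.ok.hd_eq h.perm heG he h'
      exact this ▸ h.heads q (Or.inr rfl) (this ▸ he)
  · exact Or.inr hc

theorem rehead_congr₂ (h₁ : Seg H s' y₁ v ↔ Seg H s' y₁ u) (h₂ : Seg H s' y₂ v ↔ Seg H s' y₂ u)
    (hor : Seg H s' y₁ u ∨ Seg H s' y₂ u) :
    rehead H s' hd p q y₁ y₂ v = rehead H s' hd p q y₁ y₂ u := by
  unfold rehead
  by_cases c₂ : Seg H s' y₂ u
  · rw [if_pos c₂, if_pos (h₂.2 c₂)]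
  · have c₁ := hor.resolve_right c₂
    rw [if_neg c₂, if_neg fun h => c₂ (h₂.1 h), if_pos c₁, if_pos (h₁.2 c₁)]

theorem rehead_congr (h' : ∀ x, Start p q y₁ y₂ x → (Seg H s' x v ↔ Seg H s' x u))
    (hx : Start p q y₁ y₂ x) (hxu : Seg H s' x u) :
    rehead H s' hd p q y₁ y₂ v = rehead H s' hd p q y₁ y₂ u := by
  have hp := h' p (by simp [Start])
  have hq := h' q (by simp [Start])
  have h₁ := h' y₁ (by simp [Start])
  have h₂ := h' y₂ (by simp [Start])
  by_cases c : Seg H s' y₁ u ∨ Seg H s' y₂ u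
  · exact rehead_congr₂ h₁ h₂ c
  push Not at c
  unfold rehead
  rw [if_neg c.2, if_neg c.1, if_neg fun h => c.2 (h₂.1 h), if_neg fun h => c.1 (h₁.1 h)]
  by_cases cq : Seg H s' q u
  · rw [if_pos cq, if_pos (hq.2 cq)]
  · have cp : Seg H s' p u := by
      rcases hx with rfl | rfl | rfl | rfl
      exacts [hxu, absurd hxu cq, absurd hxu c.1, absurd hxu c.2]
    rw [if_neg cq, if_neg fun h => cq (hq.1 h), if_pos cp, if_pos (hp.2 cp)]

theorem rehead_same (h : Rebuild G H s s' hd n n' p q y₁ y₂) (hu : u ∈ G) (hsu : s' u ∉ H) :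
    rehead H s' hd p q y₁ y₂ (s' u) = rehead H s' hd p q y₁ y₂ u := by
  -- A start other than `s' u` itself reaches `s' u` exactly if it reaches `u`.
  have iff : ∀ x, Start p q y₁ y₂ x → s' u ≠ x → (Seg H s' x (s' u) ↔ Seg H s' x u) :=
    fun x hx hne => ⟨fun h' => (Seg.pred h.perm' (h.start_mem hx) hu h').resolve_left hne,
      fun h' => h'.step hsu⟩
  by_cases hcap : (s' u = p ∨ s' u = q) ∧ ¬ Seg H s' (s' u) u
  · obtain ⟨hv, hns⟩ := hcap
    rcases h.covered hv with ⟨e, heH, he, hev⟩ | hc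
    · have hne : s' u ≠ e := fun h' => hsu (h' ▸ heH)
      rcases h.kind with hk | hk
      · have n1 : s' u ≠ y₁ := fun h' => hsu (h' ▸ hk.1)
        have n2 : s' u ≠ y₂ := fun h' => hsu (h' ▸ hk.2)
        have i1 := iff y₁ (by simp [Start]) n1
        have i2 := iff y₂ (by simp [Start]) n2
        refine rehead_congr₂ i1 i2 ?_
        rcases he with rfl | rfl
        · exact Or.inl (i1.1 hev)
        · exact Or.inr (i2.1 hev)
      · exfalso
        rcases he with rfl | rfl
        · rw [hk.1] at heH
          exact hk.2.2.1 (by rw [h.ok.hd_of_mem h.hp heH]; exact heH)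
        · rw [hk.2.1] at heH
          exact hk.2.2.2 (by rw [h.ok.hd_of_mem h.hq heH]; exact heH)
    · exact absurd (hc.1 u hu rfl) hns
  · have iff' : ∀ x, Start p q y₁ y₂ x → (Seg H s' x (s' u) ↔ Seg H s' x u) := by
      intro x hx
      by_cases hne : s' u = x
      · have hxpq : x = p ∨ x = q := by
          rcases h.kind with hk | hk
          · rcases hx with h' | h' | h' | h'
            · exact Or.inl h'
            · exact Or.inr h'
            · exact absurd (hne.trans h' ▸ hk.1) hsu
            · exact absurd (hne.trans h' ▸ hk.2) hsu
          · rcases hx with h' | h' | h' | h'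
            · exact Or.inl h'
            · exact Or.inr h'
            · exact Or.inl (h'.trans hk.1)
            · exact Or.inr (h'.trans hk.2.1)
        have : Seg H s' (s' u) u := by
          by_contra hns
          exact hcap ⟨hne ▸ hxpq, hns⟩
        exact ⟨fun _ => hne ▸ this, fun _ => hne ▸ Seg.refl _⟩
      · exact iff x hx hne
    rcases rehead_cases H s' hd p q y₁ y₂ u with ⟨x, hx, hxu, -⟩ | ⟨hun, hval⟩
    · exact rehead_congr iff' hx hxu
    · rw [rehead_of_untouched fun x hx h' => hun x hx ((iff' x hx).1 h'), hval]
      have hnp : u ≠ p := fun h' => hun p (by simp [Start]) (h' ▸ Seg.refl _)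
      have hnq : u ≠ q := fun h' => hun q (by simp [Start]) (h' ▸ Seg.refl _)
      rw [← h.agree u hu hnp hnq] at hsu ⊢
      exact h.ok.same u hu hsu

theorem untouched_seg (h : Rebuild G H s s' hd n n' p q y₁ y₂) (hx : x ∈ G)
    (hun : ∀ x, Start p q y₁ y₂ x → ¬ Seg H s' x u) (hxu : Seg H s x u) : Seg H s' x u := by
  rcases h.perm.seg_transfer h.perm' h.hp h.hq h.agree hx hxu with h' | h' | h'
  · exact h'
  · exact absurd h' (hun p (by simp [Start]))
  · exact absurd h' (hun q (by simp [Start]))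

/-- Rebuilding the chunks of `p`, `q` and of their old heads repairs the level. -/
theorem levelOK (h : Rebuild G H s s' hd n n' p q y₁ y₂) :
    LevelOK G H s' (rehead H s' hd p q y₁ y₂) n' := by
  have hseg : ∀ u ∈ G, Seg H s' (rehead H s' hd p q y₁ y₂ u) u := by
    intro u hu
    rcases rehead_cases H s' hd p q y₁ y₂ u with ⟨x, -, hxu, hval⟩ | ⟨hun, hval⟩
    · rwa [hval]
    · rw [hval]
      exact h.untouched_seg (h.ok.mem u hu) hun (h.ok.seg u hu)
  refine ⟨fun u hu => ?_, hseg, fun u hu hsu => h.rehead_same hu hsu, fun u hu hsu => ?_⟩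
  · rcases rehead_cases H s' hd p q y₁ y₂ u with ⟨x, hx, -, hval⟩ | ⟨-, hval⟩
    · rw [hval]; exact h.start_mem hx
    · rw [hval]; exact h.ok.mem u hu
  · rcases rehead_cases H s' hd p q y₁ y₂ u with ⟨x, hx, hxu, hval⟩ | ⟨hun, hval⟩
    · have hxH : x ∈ H := by
        by_contra hxH
        have hxpq : (x = p ∨ x = q) := by
          rcases h.kind with hk | hk
          · rcases hx with h' | h' | h' | h'
            · exact Or.inl h'
            · exact Or.inr h'
            · exact absurd (h' ▸ hk.1) hxH
            · exact absurd (h' ▸ hk.2) hxH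
          · rcases hx with h' | h' | h' | h'
            · exact Or.inl h'
            · exact Or.inr h'
            · exact Or.inl (h'.trans hk.1)
            · exact Or.inr (h'.trans hk.2.1)
        rcases h.covered hxpq with ⟨e, heH, he, hex⟩ | hc
        · have heu := hex.trans hxu
          rcases h.kind with hk | hk
          · have : rehead H s' hd p q y₁ y₂ u = y₁ ∨ rehead H s' hd p q y₁ y₂ u = y₂ := by
              unfold rehead
              rcases he with rfl | rfl
              · split_ifs <;> simp
              · simp [heu]
            rcases this with h' | h'
            · exact hxH (by rw [← hval, h']; exact hk.1)
            · exact hxH (by rw [← hval, h']; exact hk.2)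
          · rcases he with rfl | rfl
            · rw [hk.1] at heH
              exact hk.2.2.1 (by rw [h.ok.hd_of_mem h.hp heH]; exact heH)
            · rw [hk.2.1] at heH
              exact hk.2.2.2 (by rw [h.ok.hd_of_mem h.hq heH]; exact heH)
        · exact hc.2 u hxu hsu
      rw [hval]
      refine ⟨hxH, ?_⟩
      obtain ⟨w, hw, hn, hor⟩ := h.exit x hx
      have hsw : s' w ∈ H := by
        rcases hor with h' | h'
        · exact h'
        · rw [h']; exact hxH
      rw [hn, Seg.exit_unique hxu hw hsu hsw]
    · rw [hval]
      have hnp : u ≠ p := fun h' => hun p (by simp [Start]) (h' ▸ Seg.refl _)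
      have hnq : u ≠ q := fun h' => hun q (by simp [Start]) (h' ▸ Seg.refl _)
      have hs := h.agree u hu hnp hnq
      obtain ⟨h1, h2⟩ := h.ok.next u hu (hs ▸ hsu)
      refine ⟨h1, ?_⟩
      have hsg := h.untouched_seg (h.ok.mem u hu) hun (h.ok.seg u hu)
      rw [h.keep _ h1, h2, hs] <;> rintro rfl
      · exact hun _ (Or.inl rfl) hsg
      · exact hun _ (Or.inr (Or.inl rfl)) hsg
      · exact hun _ (Or.inr (Or.inr (Or.inl rfl))) hsg
      · exact hun _ (Or.inr (Or.inr (Or.inr rfl))) hsg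

/-- The new chunk of a rebuilt head consists of all elements reached from it. -/
theorem chunk_of_start (h : Rebuild G H s s' hd n n' p q y₁ y₂) (hx : Start p q y₁ y₂ x)
    (hu : u ∈ G) (hux : rehead H s' hd p q y₁ y₂ u = x) (hv : v ∈ G) :
    rehead H s' hd p q y₁ y₂ v = x ↔ Seg H s' x v := by
  have hok := h.levelOK
  constructor
  · rintro rfl; exact hok.seg v hv
  · intro hxv
    have hxu : Seg H s' x u := hux ▸ hok.seg u hu
    rw [hok.hd_seg h.perm' (h.start_mem hx) hxv, ← hok.hd_seg h.perm' (h.start_mem hx) hxu, hux]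

/-- The chunks of the heads that have not been rebuilt are unchanged. -/
theorem chunk_of_not_start (h : Rebuild G H s s' hd n n' p q y₁ y₂) (hx : ¬ Start p q y₁ y₂ x)
    (hu : u ∈ G) (hux : rehead H s' hd p q y₁ y₂ u = x) (hv : v ∈ G) :
    rehead H s' hd p q y₁ y₂ v = x ↔ hd v = x := by
  have hok := h.levelOK
  have key : ∀ w, rehead H s' hd p q y₁ y₂ w = x →
      (∀ y, Start p q y₁ y₂ y → ¬ Seg H s' y w) ∧ hd w = x := by
    intro w hw
    rcases rehead_cases H s' hd p q y₁ y₂ w with ⟨y, hy, -, hval⟩ | ⟨hun, hval⟩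
    · exact absurd (hw ▸ hval ▸ hy) hx
    · exact ⟨hun, hval ▸ hw⟩
  refine ⟨fun h' => (key v h').2, fun hvx => ?_⟩
  have hxG : x ∈ G := hvx ▸ h.ok.mem v hv
  have hxu : Seg H s' x u := hux ▸ hok.seg u hu
  have hxx : rehead H s' hd p q y₁ y₂ x = x := by
    rw [← hok.hd_seg h.perm' hxG hxu, hux]
  have hxv : Seg H s x v := hvx ▸ h.ok.seg v hv
  induction hxv with
  | refl => exact hxx
  | @tail a b hxa hab ih =>
    have ha : a ∈ G := Seg.mem h.perm hxG hxa
    have iha := ih ha ((h.ok.hd_seg h.perm hxG hxa).trans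
      ((h.ok.hd_seg h.perm hxG (Relation.ReflTransGen.tail hxa hab)).symm.trans hvx))
    have hun := (key a iha).1
    have hnp : a ≠ p := fun h' => hun p (by simp [Start]) (h' ▸ Seg.refl _)
    have hnq : a ≠ q := fun h' => hun q (by simp [Start]) (h' ▸ Seg.refl _)
    rw [hab.1, h.agree a ha hnp hnq, h.rehead_same ha, iha]
    rw [← h.agree a ha hnp hnq, ← hab.1]
    exact hab.2

end Rebuild

/-! ### The hierarchy of levels -/

section Orbit

/-- Lying on the same cycle of the permutation `σ` of `G`. -/
def Orb (G : Finset ℕ) (σ : ℕ → ℕ) : ℕ → ℕ → Prop :=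
  Relation.EqvGen fun a b => a ∈ G ∧ b = σ a

variable {G : Finset ℕ} {σ σ' : ℕ → ℕ} {x y z : ℕ}

theorem Orb.refl (x : ℕ) : Orb G σ x x := Relation.EqvGen.refl x

theorem Orb.symm (h : Orb G σ x y) : Orb G σ y x := Relation.EqvGen.symm _ _ h

theorem Orb.trans (h : Orb G σ x y) (h' : Orb G σ y z) : Orb G σ x z :=
  Relation.EqvGen.trans _ _ _ h h'

theorem Orb.step (hx : x ∈ G) : Orb G σ x (σ x) := Relation.EqvGen.rel _ _ ⟨hx, rfl⟩

theorem Orb.mem_iff (hσ : PermOn G σ) (h : Orb G σ x y) : x ∈ G ↔ y ∈ G := by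
  induction h with
  | rel a b hab => rw [hab.2]; exact ⟨hσ.maps a, fun _ => hab.1⟩
  | refl => rfl
  | symm _ _ _ ih => exact ih.symm
  | trans _ _ _ _ _ ih ih' => exact ih.trans ih'

theorem Orb.congr (he : ∀ u ∈ G, σ u = σ' u) (h : Orb G σ x y) : Orb G σ' x y := by
  induction h with
  | rel a b hab => rw [hab.2, he a hab.1]; exact Orb.step hab.1
  | refl => exact Orb.refl _
  | symm _ _ _ ih => exact ih.symm
  | trans _ _ _ _ _ ih ih' => exact ih.trans ih'

theorem Orb.of_seg {H : Finset ℕ} (hσ : PermOn G σ) (hx : x ∈ G) (h : Seg H σ x y) :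
    Orb G σ x y := by
  induction h with
  | refl => exact Orb.refl x
  | @tail a b h hab ih => rw [hab.1]; exact ih.trans (Orb.step (Seg.mem hσ hx h))

end Orbit

/-- The hierarchy: on level `i` the elements of `H i` are cyclically ordered by `s i`, the node of
`u ∈ H i` has the node of `hd i u` on level `i + 1` as its parent, and the aggregate `A (i + 1) r`
stored at a parent is the product of the aggregates of its children. -/
structure Hier {M : Type u} [CommMonoid M] (H : ℕ → Finset ℕ) (s hd : ℕ → ℕ → ℕ)
    (A : ℕ → ℕ → M) : Prop where
  anti : ∀ i, H (i + 1) ⊆ H i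
  perm0 : PermOn (H 0) (s 0)
  level : ∀ i, LevelOK (H i) (H (i + 1)) (s i) (hd i) (s (i + 1))
  agg : ∀ i r, (∃ u ∈ H i, hd i u = r) → A (i + 1) r = ∏ u ∈ H i with hd i u = r, A i u

/-- One step from a node `(level, element)` to its parent. -/
def Up (H : ℕ → Finset ℕ) (hd : ℕ → ℕ → ℕ) (a b : ℕ × ℕ) : Prop :=
  a.2 ∈ H a.1 ∧ b = (a.1 + 1, hd a.1 a.2)

/-- The node `b` is an ancestor of the node `a` (or `a` itself). -/
abbrev Climb (H : ℕ → Finset ℕ) (hd : ℕ → ℕ → ℕ) : ℕ × ℕ → ℕ × ℕ → Prop :=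
  Relation.ReflTransGen (Up H hd)

/-- The node `r` is the last ancestor of `a`. -/
def IsRoot (H : ℕ → Finset ℕ) (hd : ℕ → ℕ → ℕ) (a r : ℕ × ℕ) : Prop :=
  Climb H hd a r ∧ r.2 ∉ H r.1

section Climb

variable {H : ℕ → Finset ℕ} {hd : ℕ → ℕ → ℕ} {a b r r' : ℕ × ℕ} {i x y : ℕ}

theorem Climb.level_le (h : Climb H hd a b) : a.1 ≤ b.1 := by
  induction h with
  | refl => rfl
  | tail _ hab ih => rw [hab.2]; exact ih.trans (Nat.le_succ _)

theorem Climb.total (h : Climb H hd a b) (h' : Climb H hd a r) :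
    Climb H hd b r ∨ Climb H hd r b :=
  Relation.ReflTransGen.total_of_right_unique (fun _ _ _ h h' => h.2.trans h'.2.symm) h h'

theorem Climb.eq_of_level (h : Climb H hd a b) (hl : a.1 = b.1) : a = b := by
  rcases Relation.ReflTransGen.cases_head h with h | ⟨c, hac, hcb⟩
  · exact h
  · have := Climb.level_le hcb
    rw [hac.2] at this
    simp only at this
    omega

theorem Climb.unique (h : Climb H hd a (i, x)) (h' : Climb H hd a (i, y)) : x = y := by
  rcases Climb.total h h' with h | h
  · exact (Prod.ext_iff.1 (Climb.eq_of_level h rfl)).2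
  · exact (Prod.ext_iff.1 (Climb.eq_of_level h rfl)).2.symm

theorem IsRoot.unique (h : IsRoot H hd a r) (h' : IsRoot H hd a r') : r = r' := by
  rcases Climb.total h.1 h'.1 with h1 | h1
  · rcases Relation.ReflTransGen.cases_head h1 with h2 | ⟨c, hac, -⟩
    · exact h2
    · exact absurd hac.1 h.2
  · rcases Relation.ReflTransGen.cases_head h1 with h2 | ⟨c, hac, -⟩
    · exact h2.symm
    · exact absurd hac.1 h'.2

theorem isRoot_iff (hx : x ∈ H i) : IsRoot H hd (i, x) r ↔ IsRoot H hd (i + 1, hd i x) r := by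
  constructor
  · rintro ⟨h, hr⟩
    rcases Relation.ReflTransGen.cases_head h with h | ⟨c, hac, hcb⟩
    · subst h; exact absurd hx hr
    · have : c = (i + 1, hd i x) := hac.2
      exact ⟨this ▸ hcb, hr⟩
  · rintro ⟨h, hr⟩
    exact ⟨Relation.ReflTransGen.head ⟨hx, rfl⟩ h, hr⟩

theorem climb_succ (h : Climb H hd a (i + 1, x)) (ha : a.1 ≤ i) :
    ∃ u ∈ H i, hd i u = x ∧ Climb H hd a (i, u) := by
  rcases Relation.ReflTransGen.cases_tail h with h | ⟨c, hac, hcb⟩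
  · rw [← h] at ha; simp at ha
  · obtain ⟨c1, c2⟩ := c
    obtain ⟨h1, h2⟩ := hcb
    simp only [Prod.mk.injEq, Nat.add_right_cancel_iff] at h2
    obtain ⟨rfl, rfl⟩ := h2
    exact ⟨c2, h1, rfl, hac⟩

end Climb

namespace Hier

variable {M : Type u} [CommMonoid M] {H : ℕ → Finset ℕ} {s hd : ℕ → ℕ → ℕ} {A : ℕ → ℕ → M}
  {i j u v w x e e' p c L : ℕ} {r : ℕ × ℕ}

theorem anti_le (h : Hier H s hd A) (hij : i ≤ j) : H j ⊆ H i := by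
  induction hij with
  | refl => exact Finset.Subset.refl _
  | step _ ih => exact (h.anti _).trans ih

theorem perm (h : Hier H s hd A) (i : ℕ) : PermOn (H i) (s i) := by
  induction i with
  | zero => exact h.perm0
  | succ i ih => exact (h.level i).permOn ih (h.anti i)

theorem succ_eq (h : Hier H s hd A) (hx : x ∈ H (i + 1)) :
    ∃ u ∈ H i, Seg (H (i + 1)) (s i) x u ∧ s (i + 1) x = s i u := by
  obtain ⟨u, hu, hxu, hsu⟩ := (h.perm i).exists_exit (h.anti i hx) hx
  have := (h.level i).hd_eq (h.perm i) (h.anti i hx) hx hxu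
  exact ⟨u, hu, hxu, this ▸ ((h.level i).next u hu hsu).2⟩

/-- A step on level `i` follows the base cycle without entering `H i` in between. -/
theorem step_base (h : Hier H s hd A) (hu : u ∈ H i) :
    ∃ c, Seg (H i) (s 0) u c ∧ s 0 c = s i u := by
  induction i generalizing u with
  | zero => exact ⟨u, Seg.refl u, rfl⟩
  | succ i ih =>
    obtain ⟨v, hv, huv, hsv⟩ := h.succ_eq hu
    obtain ⟨c, hvc, hc⟩ := ih hv
    refine ⟨c, Seg.trans ?_ (hvc.mono (h.anti i)), hc.trans hsv.symm⟩
    clear hsv hvc hc hv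
    induction huv with
    | refl => exact Seg.refl u
    | @tail a b hua hab ih' =>
      have ha : a ∈ H i := Seg.mem (h.perm i) (h.anti i hu) hua
      obtain ⟨d, had, hd⟩ := ih ha
      refine (ih'.trans (had.mono (h.anti i))).tail ⟨?_, hab.2⟩
      rw [hd]; exact hab.1

/-- A segment on level `i` that avoids `H (i + 1)` is such a segment of the base cycle. -/
theorem seg_base (h : Hier H s hd A) (hx : x ∈ H i) (hxu : Seg (H (i + 1)) (s i) x u) :
    Seg (H (i + 1)) (s 0) x u := by
  induction hxu with
  | refl => exact Seg.refl x
  | @tail a b hxa hab ih =>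
    obtain ⟨d, had, hd⟩ := h.step_base (Seg.mem (h.perm i) hx hxa)
    refine (ih.trans (had.mono (h.anti i))).tail ⟨?_, hab.2⟩
    rw [hd]; exact hab.1

theorem orb_of_climb (h : Hier H s hd A) {a b : ℕ × ℕ} (hab : Climb H hd a b) :
    Orb (H 0) (s 0) a.2 b.2 := by
  induction hab with
  | refl => exact Orb.refl _
  | @tail b c _ hbc ih =>
    rw [hbc.2]
    have hm := (h.level b.1).mem _ hbc.1
    exact ih.trans (Orb.of_seg h.perm0 (h.anti_le (Nat.zero_le _) hm)
      (h.seg_base hm ((h.level b.1).seg _ hbc.1))).symm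

theorem isRoot_step (h : Hier H s hd A) (hL : ∀ i, L < i → H i = ∅) (hu : u ∈ H i) :
    IsRoot H hd (i, u) r ↔ IsRoot H hd (i, s i u) r := by
  obtain ⟨k, hk⟩ : ∃ k, L + 1 - i = k := ⟨_, rfl⟩
  induction k generalizing i u with
  | zero => rw [hL i (by omega)] at hu; simp at hu
  | succ k ih =>
    have hsu := (h.perm i).maps u hu
    rw [isRoot_iff hu, isRoot_iff hsu]
    by_cases hH : s i u ∈ H (i + 1)
    · obtain ⟨h1, h2⟩ := (h.level i).next u hu hH
      rw [(h.level i).hd_of_mem hsu hH, ← h2]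
      exact ih h1 (by omega)
    · rw [(h.level i).same u hu hH]

/-- Elements have the same root if and only if they lie on the same cycle. -/
theorem isRoot_iff_orb (h : Hier H s hd A) (hL : ∀ i, L < i → H i = ∅)
    (he : e ∈ H 0) (hr : IsRoot H hd (0, e) r) :
    IsRoot H hd (0, e') r ↔ Orb (H 0) (s 0) e e' := by
  constructor
  · exact fun hr' => (h.orb_of_climb hr.1).trans (h.orb_of_climb hr'.1).symm
  · intro ho
    have key : ∀ a b, Orb (H 0) (s 0) a b → a ∈ H 0 →
        (IsRoot H hd (0, a) r ↔ IsRoot H hd (0, b) r) := by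
      intro a b hab
      induction hab with
      | rel a b hab => intro ha; rw [hab.2]; exact h.isRoot_step hL ha
      | refl => intro _; rfl
      | symm a b hab ih =>
        intro hb; exact (ih ((Orb.mem_iff h.perm0 hab).2 hb)).symm
      | trans a b c hab _ ih ih' =>
        intro ha; exact (ih ha).trans (ih' ((Orb.mem_iff h.perm0 hab).1 ha))
    exact (key e e' ho he).1 hr

open Classical in
/-- The aggregate stored at a node is the product over the base elements below it. -/
theorem agg_eq (h : Hier H s hd A) (hx : ∃ e ∈ H 0, Climb H hd (0, e) (i, x)) :
    A i x = ∏ e ∈ H 0 with Climb H hd (0, e) (i, x), A 0 e := by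
  induction i generalizing x with
  | zero =>
    have hz : ∀ e, Climb H hd (0, e) (0, x) ↔ e = x := fun e =>
      ⟨fun hc => Climb.unique Relation.ReflTransGen.refl hc |>.symm ▸ rfl,
        fun hc => hc ▸ Relation.ReflTransGen.refl⟩
    obtain ⟨e, he, hc⟩ := hx
    rw [hz] at hc; subst hc
    simp only [hz, Finset.filter_eq', if_pos he, Finset.prod_singleton]
  | succ i ih =>
    obtain ⟨e, he, hc⟩ := hx
    obtain ⟨u, hu, hux, hcu⟩ := climb_succ hc (Nat.zero_le _)
    rw [h.agg i x ⟨u, hu, hux⟩]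
    have hself : ∀ j v, v ∈ H j → Climb H hd (0, v) (j, v) := by
      intro j
      induction j with
      | zero => exact fun v _ => Relation.ReflTransGen.refl
      | succ j ihj =>
        intro v hv
        refine (ihj v (h.anti j hv)).tail ⟨h.anti j hv, ?_⟩
        rw [(h.level j).hd_of_mem (h.anti j hv) hv]
    have h1 : ∀ v ∈ (H i).filter (fun v => hd i v = x),
        A i v = ∏ e ∈ H 0 with Climb H hd (0, e) (i, v), A 0 e := fun v hv => by
      have hv := (Finset.mem_filter.1 hv).1
      exact ih ⟨v, h.anti_le (Nat.zero_le i) hv, hself i v hv⟩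
    rw [Finset.prod_congr rfl h1, ← Finset.prod_biUnion]
    · refine Finset.prod_congr ?_ fun _ _ => rfl
      ext e'
      simp only [Finset.mem_biUnion, Finset.mem_filter]
      constructor
      · rintro ⟨v, ⟨hv, hvx⟩, he', hc'⟩
        exact ⟨he', hc'.tail ⟨hv, by rw [hvx]⟩⟩
      · rintro ⟨he', hc'⟩
        obtain ⟨v, hv, hvx, hcv⟩ := climb_succ hc' (Nat.zero_le _)
        exact ⟨v, ⟨hv, hvx⟩, he', hcv⟩
    · intro v _ v' _ hne
      refine Finset.disjoint_left.2 fun e' he' he'' => hne ?_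
      exact Climb.unique (Finset.mem_filter.1 he').2 (Finset.mem_filter.1 he'').2

open Classical in
theorem agg_root (h : Hier H s hd A) (hL : ∀ i, L < i → H i = ∅)
    (he : e ∈ H 0) (hr : IsRoot H hd (0, e) r) :
    A r.1 r.2 = ∏ e' ∈ H 0 with Orb (H 0) (s 0) e e', A 0 e' := by
  rw [h.agg_eq ⟨e, he, hr.1⟩]
  refine Finset.prod_congr (Finset.filter_congr fun e' _ => ?_) fun _ _ => rfl
  rw [← h.isRoot_iff_orb hL he hr]
  exact ⟨fun hc => ⟨hc, hr.2⟩, fun hc => hc.1⟩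

open Classical in
/-- Replacing the factor `A 0 e` by `g (A 0 e)` in all aggregates that contain it keeps the
hierarchy correct. -/
theorem update (h : Hier H s hd A) (he : e ∈ H 0) (g : M → M)
    (hg : ∀ R, g (A 0 e * R) = g (A 0 e) * R) :
    Hier H s hd fun i u => if Climb H hd (0, e) (i, u) then g (A i u) else A i u := by
  refine ⟨h.anti, h.perm0, h.level, fun i r hr => ?_⟩
  by_cases hc : Climb H hd (0, e) (i + 1, r)
  · obtain ⟨u, hu, hur, hcu⟩ := climb_succ hc (Nat.zero_le _)
    have hmem : u ∈ (H i).filter fun v => hd i v = r := Finset.mem_filter.2 ⟨hu, hur⟩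
    have hR : ∃ R, A i u = A 0 e * R := by
      rw [h.agg_eq ⟨e, he, hcu⟩]
      exact ⟨_, (Finset.mul_prod_erase _ _ (Finset.mem_filter.2 ⟨he, hcu⟩)).symm⟩
    obtain ⟨R, hR⟩ := hR
    simp only [if_pos hc]
    rw [h.agg i r hr, ← Finset.mul_prod_erase _ _ hmem, ← Finset.mul_prod_erase _ _ hmem,
      if_pos hcu, hR, mul_assoc, hg, hg, mul_assoc]
    congr 2
    refine Finset.prod_congr rfl fun v hv => ?_
    rw [if_neg fun hv' => (Finset.mem_erase.1 hv).1 (Climb.unique hv' hcu)]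
  · simp only [if_neg hc]
    rw [h.agg i r hr]
    refine Finset.prod_congr rfl fun v hv => ?_
    obtain ⟨hv, hvr⟩ := Finset.mem_filter.1 hv
    rw [if_neg]
    exact fun hcv => hc (hcv.tail ⟨hv, by rw [hvr]⟩)

end Hier

/-! ### Repairing the hierarchy level by level -/

/-- The elements of `H i` whose level-`i` chunk can be that of an ancestor of `c`. -/
def Near (H : ℕ → Finset ℕ) (σ : ℕ → ℕ) (i c w : ℕ) : Prop :=
  w ∈ H i ∧ (Seg (H (i + 1)) σ c w ∨ Seg (H (i + 1)) σ w c)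

/-- The hierarchy `s, hd, A` has been repaired below level `i`. On and above level `i` it agrees
with the correct hierarchy `s₀, hd₀, A₀` from before the change, except at `p` and `q` on level `i`,
which are ancestors of the places `a`, `b` of the change. -/
structure Mid {M : Type u} [CommMonoid M] (H : ℕ → Finset ℕ) (s₀ hd₀ : ℕ → ℕ → ℕ) (A₀ : ℕ → ℕ → M)
    (a b : ℕ) (σ : ℕ → ℕ) (X : ℕ → M)
    (s hd : ℕ → ℕ → ℕ) (A : ℕ → ℕ → M) (i p q : ℕ) : Prop where
  old : Hier H s₀ hd₀ A₀
  hp : p ∈ H i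
  hq : q ∈ H i
  base : ∀ u ∈ H 0, s 0 u = σ u
  baseA : ∀ u ∈ H 0, A 0 u = X u
  low : ∀ j < i, LevelOK (H j) (H (j + 1)) (s j) (hd j) (s (j + 1))
  lowA : ∀ j < i, ∀ r, (∃ u ∈ H j, hd j u = r) → A (j + 1) r = ∏ u ∈ H j with hd j u = r, A j u
  perm : PermOn (H i) (s i)
  perm0 : PermOn (H 0) (s 0)
  agree : ∀ u ∈ H i, u ≠ p → u ≠ q → s i u = s₀ i u
  agreeA : ∀ u ∈ H i, u ≠ p → u ≠ q → A i u = A₀ i u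
  high : ∀ j, i < j → ∀ u ∈ H j, s j u = s₀ j u
  highA : ∀ j, i < j → ∀ u ∈ H 0, A j u = A₀ j u
  heads : ∀ j, i ≤ j → ∀ u ∈ H j, hd j u = hd₀ j u
  coverp : Seg (H i) (s₀ 0) p a ∨ Seg (H i) (s₀ 0) p b
  coverq : Seg (H i) (s₀ 0) q a ∨ Seg (H i) (s₀ 0) q b

open Classical in
/-- The hierarchy `s', hd', A'` arises from `s, hd, A` by rebuilding the chunks of `p`, `q`, `y₁`,
`y₂` on level `i`. -/
structure Rewalk {M : Type u} [CommMonoid M] (H : ℕ → Finset ℕ)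
    (s hd : ℕ → ℕ → ℕ) (A : ℕ → ℕ → M) (s' hd' : ℕ → ℕ → ℕ) (A' : ℕ → ℕ → M)
    (i p q y₁ y₂ : ℕ) : Prop where
  s_other : ∀ j, j ≠ i + 1 → s' j = s j
  hd_other : ∀ j, j ≠ i → hd' j = hd j
  A_other : ∀ j, j ≠ i + 1 → A' j = A j
  hd_eq : ∀ u ∈ H i, hd' i u = rehead (H (i + 1)) (s i) (hd i) p q y₁ y₂ u
  exit : ∀ x, Rebuild.Start p q y₁ y₂ x →
    ∃ w, Seg (H (i + 1)) (s i) x w ∧ s' (i + 1) x = s i w ∧ (s i w ∈ H (i + 1) ∨ s i w = x)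
  s_keep : ∀ x, ¬ Rebuild.Start p q y₁ y₂ x → s' (i + 1) x = s (i + 1) x
  A_start : ∀ x, Rebuild.Start p q y₁ y₂ x →
    A' (i + 1) x = ∏ u ∈ H i with Seg (H (i + 1)) (s i) x u, A i u
  A_keep : ∀ x, ¬ Rebuild.Start p q y₁ y₂ x → A' (i + 1) x = A (i + 1) x

theorem LevelOK.congr {G H : Finset ℕ} {s s' hd hd' n n' : ℕ → ℕ} (h : LevelOK G H s hd n)
    (hs : PermOn G s) (hss : ∀ u ∈ G, s u = s' u) (hhd : ∀ u ∈ G, hd u = hd' u)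
    (hn : ∀ u ∈ H, n u = n' u) : LevelOK G H s' hd' n' := by
  refine ⟨fun u hu => hhd u hu ▸ h.mem u hu, fun u hu => ?_, fun u hu hsu => ?_, fun u hu hsu => ?_⟩
  · rw [← hhd u hu, ← Seg.congr hs (h.mem u hu) hss]
    exact h.seg u hu
  · rw [← hss u hu] at hsu ⊢
    rw [← hhd u hu, ← hhd _ (hs.maps u hu)]
    exact h.same u hu hsu
  · rw [← hss u hu] at hsu ⊢
    rw [← hhd u hu]
    obtain ⟨h1, h2⟩ := h.next u hu hsu
    exact ⟨h1, hn _ h1 ▸ h2⟩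

theorem LevelOK.hd_congr {G H : Finset ℕ} {s hd hd' n : ℕ → ℕ} (h : LevelOK G H s hd n)
    (hs : PermOn G s) (hhd : ∀ u ∈ G, hd u = hd' u) : LevelOK G H s hd' n :=
  h.congr hs (fun _ _ => rfl) hhd fun _ _ => rfl

namespace Mid

variable {M : Type u} [CommMonoid M] {H : ℕ → Finset ℕ} {s₀ hd₀ : ℕ → ℕ → ℕ} {A₀ : ℕ → ℕ → M}
  {a b : ℕ} {σ : ℕ → ℕ} {X : ℕ → M}
  {s hd s' hd' : ℕ → ℕ → ℕ} {A A' : ℕ → ℕ → M} {i p q y₁ y₂ x u : ℕ}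

theorem rebuild (h : Mid H s₀ hd₀ A₀ a b σ X s hd A i p q)
    (w : Rewalk H s hd A s' hd' A' i p q y₁ y₂)
    (heads : ∀ v, v = p ∨ v = q → hd i v ∈ H (i + 1) → hd i v = y₁ ∨ hd i v = y₂)
    (kind : (y₁ ∈ H (i + 1) ∧ y₂ ∈ H (i + 1)) ∨
      (y₁ = p ∧ y₂ = q ∧ hd i p ∉ H (i + 1) ∧ hd i q ∉ H (i + 1))) :
    Rebuild (H i) (H (i + 1)) (s₀ i) (s i) (hd i) (s₀ (i + 1)) (s' (i + 1)) p q y₁ y₂ where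
  ok := (h.old.level i).hd_congr (h.old.perm i) fun u hu => (h.heads i le_rfl u hu).symm
  perm := h.old.perm i
  perm' := h.perm
  sub := h.old.anti i
  hp := h.hp
  hq := h.hq
  agree := fun u hu h1 h2 => (h.agree u hu h1 h2).symm
  heads := heads
  kind := kind
  exit := w.exit
  keep := fun x hx h1 h2 h3 h4 => by
    rw [w.s_keep x (by simp [Rebuild.Start, h1, h2, h3, h4]), h.high (i + 1) (by omega) x hx]

open Classical in
theorem level_agg (h : Mid H s₀ hd₀ A₀ a b σ X s hd A i p q)
    (w : Rewalk H s hd A s' hd' A' i p q y₁ y₂)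
    (heads : ∀ v, v = p ∨ v = q → hd i v ∈ H (i + 1) → hd i v = y₁ ∨ hd i v = y₂)
    (kind : (y₁ ∈ H (i + 1) ∧ y₂ ∈ H (i + 1)) ∨
      (y₁ = p ∧ y₂ = q ∧ hd i p ∉ H (i + 1) ∧ hd i q ∉ H (i + 1)))
    (r : ℕ) (hr : ∃ u ∈ H i, hd' i u = r) :
    A' (i + 1) r = ∏ u ∈ H i with hd' i u = r, A' i u := by
  have hb := h.rebuild w heads kind
  obtain ⟨u, hu, hur⟩ := hr
  rw [w.hd_eq u hu] at hur
  rw [w.A_other i (by omega)]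
  by_cases hs : Rebuild.Start p q y₁ y₂ r
  · rw [w.A_start r hs]
    refine Finset.prod_congr (Finset.filter_congr fun v hv => ?_) fun _ _ => rfl
    rw [w.hd_eq v hv, hb.chunk_of_start hs hu hur hv]
  · have hrH : r ∈ H 0 := by
      have := hb.levelOK.mem u hu
      rw [hur] at this
      exact h.old.anti_le (Nat.zero_le i) this
    have hur' := (hb.chunk_of_not_start hs hu hur hu).1 hur
    rw [h.heads i le_rfl u hu] at hur'
    rw [w.A_keep r hs, h.highA (i + 1) (by omega) r hrH, h.old.agg i r ⟨u, hu, hur'⟩]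
    refine Finset.prod_congr (Finset.filter_congr fun v hv => ?_) fun v hv => ?_
    · rw [w.hd_eq v hv, hb.chunk_of_not_start hs hu hur hv, h.heads i le_rfl v hv]
    · obtain ⟨hv, hvr⟩ := Finset.mem_filter.1 hv
      have hok := hb.levelOK
      have hvr' : rehead (H (i + 1)) (s i) (hd i) p q y₁ y₂ v = r := by rwa [← w.hd_eq v hv]
      symm
      refine h.agreeA v hv ?_ ?_ <;> rintro rfl
      · rcases Rebuild.rehead_cases (H (i + 1)) (s i) (hd i) v q y₁ y₂ v with ⟨x, hx, -, hval⟩ | ⟨hun, -⟩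
        · exact hs (hvr' ▸ hval ▸ hx)
        · exact hun v (Or.inl rfl) (Seg.refl v)
      · rcases Rebuild.rehead_cases (H (i + 1)) (s i) (hd i) p v y₁ y₂ v with ⟨x, hx, -, hval⟩ | ⟨hun, -⟩
        · exact hs (hvr' ▸ hval ▸ hx)
        · exact hun v (Or.inr (Or.inl rfl)) (Seg.refl v)

theorem low' (h : Mid H s₀ hd₀ A₀ a b σ X s hd A i p q)
    (w : Rewalk H s hd A s' hd' A' i p q y₁ y₂)
    (heads : ∀ v, v = p ∨ v = q → hd i v ∈ H (i + 1) → hd i v = y₁ ∨ hd i v = y₂)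
    (kind : (y₁ ∈ H (i + 1) ∧ y₂ ∈ H (i + 1)) ∨
      (y₁ = p ∧ y₂ = q ∧ hd i p ∉ H (i + 1) ∧ hd i q ∉ H (i + 1)))
    (j : ℕ) (hj : j < i + 1) : LevelOK (H j) (H (j + 1)) (s' j) (hd' j) (s' (j + 1)) := by
  rcases Nat.lt_succ_iff_lt_or_eq.1 hj with hj | rfl
  · rw [w.s_other j (by omega), w.hd_other j (by omega), w.s_other (j + 1) (by omega)]
    exact h.low j hj
  · rw [w.s_other j (by omega)]
    exact (h.rebuild w heads kind).levelOK.hd_congr h.perm fun u hu => (w.hd_eq u hu).symm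

theorem lowA' (h : Mid H s₀ hd₀ A₀ a b σ X s hd A i p q)
    (w : Rewalk H s hd A s' hd' A' i p q y₁ y₂)
    (heads : ∀ v, v = p ∨ v = q → hd i v ∈ H (i + 1) → hd i v = y₁ ∨ hd i v = y₂)
    (kind : (y₁ ∈ H (i + 1) ∧ y₂ ∈ H (i + 1)) ∨
      (y₁ = p ∧ y₂ = q ∧ hd i p ∉ H (i + 1) ∧ hd i q ∉ H (i + 1)))
    (j : ℕ) (hj : j < i + 1) (r : ℕ) (hr : ∃ u ∈ H j, hd' j u = r) :
    A' (j + 1) r = ∏ u ∈ H j with hd' j u = r, A' j u := by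
  rcases Nat.lt_succ_iff_lt_or_eq.1 hj with hj | rfl
  · rw [w.hd_other j (by omega)] at hr ⊢
    rw [w.A_other j (by omega), w.A_other (j + 1) (by omega)]
    exact h.lowA j hj r hr
  · exact h.level_agg w heads kind r hr

/-- If `p` or `q` has a head on the next level, the repair continues there. -/
theorem step (h : Mid H s₀ hd₀ A₀ a b σ X s hd A i p q)
    (w : Rewalk H s hd A s' hd' A' i p q y₁ y₂)
    (heads : ∀ v, v = p ∨ v = q → hd i v ∈ H (i + 1) → hd i v = y₁ ∨ hd i v = y₂)
    (hy₁ : y₁ ∈ H (i + 1)) (hy₂ : y₂ ∈ H (i + 1))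
    (h₁ : y₁ = hd i p ∨ y₁ = hd i q) (h₂ : y₂ = hd i p ∨ y₂ = hd i q) :
    Mid H s₀ hd₀ A₀ a b σ X s' hd' A' (i + 1) y₁ y₂ := by
  have kind : (y₁ ∈ H (i + 1) ∧ y₂ ∈ H (i + 1)) ∨
      (y₁ = p ∧ y₂ = q ∧ hd i p ∉ H (i + 1) ∧ hd i q ∉ H (i + 1)) := Or.inl ⟨hy₁, hy₂⟩
  have hb := h.rebuild w heads kind
  have nostart : ∀ u ∈ H (i + 1), u ≠ y₁ → u ≠ y₂ → ¬ Rebuild.Start p q y₁ y₂ u := by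
    intro u hu hn1 hn2 hst
    have hpq : u = p ∨ u = q := by
      rcases hst with h | h | h | h
      exacts [Or.inl h, Or.inr h, absurd h hn1, absurd h hn2]
    have huu := hb.ok.hd_of_mem (h.old.anti i hu) hu
    rcases heads u hpq (huu.symm ▸ hu) with h' | h'
    · exact hn1 (huu ▸ h')
    · exact hn2 (huu ▸ h')
  have cover : ∀ y, y = hd i p ∨ y = hd i q →
      Seg (H (i + 1)) (s₀ 0) y a ∨ Seg (H (i + 1)) (s₀ 0) y b := by
    have key : ∀ v ∈ H i, (Seg (H i) (s₀ 0) v a ∨ Seg (H i) (s₀ 0) v b) →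
        Seg (H (i + 1)) (s₀ 0) (hd i v) a ∨ Seg (H (i + 1)) (s₀ 0) (hd i v) b := by
      intro v hv hor
      have := h.old.seg_base (hb.ok.mem v hv) (hb.ok.seg v hv)
      rcases hor with h' | h'
      · exact Or.inl (this.trans (h'.mono (h.old.anti i)))
      · exact Or.inr (this.trans (h'.mono (h.old.anti i)))
    rintro y (rfl | rfl)
    · exact key p h.hp h.coverp
    · exact key q h.hq h.coverq
  have hlow := h.low' w heads kind
  refine ⟨h.old, hy₁, hy₂, ?_, ?_, hlow, h.lowA' w heads kind, ?_, ?_, ?_, ?_, ?_, ?_, ?_,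
    cover y₁ h₁, cover y₂ h₂⟩
  · rw [w.s_other 0 (by omega)]; exact h.base
  · rw [w.A_other 0 (by omega)]; exact h.baseA
  · refine (hlow i (by omega)).permOn ?_ (h.old.anti i)
    rw [w.s_other i (by omega)]; exact h.perm
  · rw [w.s_other 0 (by omega)]; exact h.perm0
  · intro u hu hn1 hn2
    rw [w.s_keep u (nostart u hu hn1 hn2), h.high (i + 1) (by omega) u hu]
  · intro u hu hn1 hn2
    rw [w.A_keep u (nostart u hu hn1 hn2),
      h.highA (i + 1) (by omega) u (h.old.anti_le (Nat.zero_le _) hu)]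
  · intro j hj u hu
    rw [w.s_other j (by omega), h.high j (by omega) u hu]
  · intro j hj u hu
    rw [w.A_other j (by omega), h.highA j (by omega) u hu]
  · intro j hj u hu
    rw [w.hd_other j (by omega), h.heads j (by omega) u hu]

/-- If neither `p` nor `q` has a head on the next level, the hierarchy is repaired. -/
theorem finish (h : Mid H s₀ hd₀ A₀ a b σ X s hd A i p q)
    (w : Rewalk H s hd A s' hd' A' i p q p q)
    (hp : hd i p ∉ H (i + 1)) (hq : hd i q ∉ H (i + 1)) :
    Hier H s' hd' A' ∧ (∀ u ∈ H 0, s' 0 u = σ u) ∧ ∀ u ∈ H 0, A' 0 u = X u := by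
  have heads : ∀ v, v = p ∨ v = q → hd i v ∈ H (i + 1) → hd i v = p ∨ hd i v = q := by
    rintro v (rfl | rfl) hv
    · exact absurd hv hp
    · exact absurd hv hq
  have kind : (p ∈ H (i + 1) ∧ q ∈ H (i + 1)) ∨
      (p = p ∧ q = q ∧ hd i p ∉ H (i + 1) ∧ hd i q ∉ H (i + 1)) := Or.inr ⟨rfl, rfl, hp, hq⟩
  have hb := h.rebuild w heads kind
  have nostart : ∀ u ∈ H (i + 1), ¬ Rebuild.Start p q p q u := by
    intro u hu hst
    have huu := hb.ok.hd_of_mem (h.old.anti i hu) hu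
    rcases hst with rfl | rfl | rfl | rfl
    exacts [hp (huu.symm ▸ hu), hq (huu.symm ▸ hu), hp (huu.symm ▸ hu), hq (huu.symm ▸ hu)]
  have hs' : ∀ j, i < j → ∀ u ∈ H j, s' j u = s₀ j u := by
    intro j hj u hu
    by_cases hji : j = i + 1
    · subst hji; rw [w.s_keep u (nostart u hu), h.high _ hj u hu]
    · rw [w.s_other j hji, h.high j hj u hu]
  have hhd' : ∀ j, i < j → ∀ u ∈ H j, hd' j u = hd₀ j u := by
    intro j hj u hu
    rw [w.hd_other j (by omega), h.heads j (by omega) u hu]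
  refine ⟨⟨h.old.anti, ?_, fun j => ?_, fun j r hr => ?_⟩, ?_, ?_⟩
  · rw [w.s_other 0 (by omega)]; exact h.perm0
  · rcases Nat.lt_or_ge j (i + 1) with hj | hj
    · exact h.low' w heads kind j hj
    · exact (h.old.level j).congr (h.old.perm j) (fun u hu => (hs' j hj u hu).symm)
        (fun u hu => (hhd' j hj u hu).symm) fun u hu => (hs' (j + 1) (by omega) u hu).symm
  · rcases Nat.lt_or_ge j (i + 1) with hj | hj
    · exact h.lowA' w heads kind j hj r hr
    · obtain ⟨u, hu, hur⟩ := hr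
      have hr0 : r ∈ H 0 := by
        rw [← hur, hhd' j hj u hu]
        exact h.old.anti_le (Nat.zero_le j) ((h.old.level j).mem u hu)
      rw [w.A_other (j + 1) (by omega), h.highA (j + 1) (by omega) r hr0,
        h.old.agg j r ⟨u, hu, by rw [← hhd' j hj u hu, hur]⟩]
      refine Finset.prod_congr (Finset.filter_congr fun v hv => by rw [hhd' j hj v hv])
        fun v hv => ?_
      have hv := (Finset.mem_filter.1 hv).1
      by_cases hji : j = i + 1
      · subst hji
        rw [w.A_keep v (nostart v hv), h.highA _ hj v (h.old.anti_le (Nat.zero_le _) hv)]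
      · rw [w.A_other j hji, h.highA j hj v (h.old.anti_le (Nat.zero_le _) hv)]
  · rw [w.s_other 0 (by omega)]; exact h.base
  · rw [w.A_other 0 (by omega)]; exact h.baseA

/-- The elements visited while a chunk is rebuilt lie near the places of the change, in the order
from before the change. -/
theorem near (h : Mid H s₀ hd₀ A₀ a b σ X s hd A i p q)
    (hx : x = p ∨ x = q ∨ (x ∈ H (i + 1) ∧ (x = hd i p ∨ x = hd i q)))
    (hu : Seg (H (i + 1)) (s i) x u) : Near H (s₀ 0) i a u ∨ Near H (s₀ 0) i b u := by
  have ok : LevelOK (H i) (H (i + 1)) (s₀ i) (hd i) (s₀ (i + 1)) :=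
    (h.old.level i).hd_congr (h.old.perm i) fun u hu => (h.heads i le_rfl u hu).symm
  have hxi : x ∈ H i := by
    rcases hx with rfl | rfl | hx
    exacts [h.hp, h.hq, h.old.anti i hx.1]
  have hui : u ∈ H i := Seg.mem h.perm hxi hu
  have hhd : hd i u = hd i p ∨ hd i u = hd i q := by
    rcases h.perm.seg_transfer (h.old.perm i) h.hp h.hq h.agree hxi hu with h' | h' | h'
    · rw [ok.hd_seg (h.old.perm i) hxi h']
      rcases hx with rfl | rfl | hx
      · exact Or.inl rfl
      · exact Or.inr rfl
      · rw [ok.hd_of_mem hxi hx.1]; exact hx.2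
    · exact Or.inl (ok.hd_seg (h.old.perm i) h.hp h')
    · exact Or.inr (ok.hd_seg (h.old.perm i) h.hq h')
  have key : ∀ v ∈ H i, hd i u = hd i v → ∀ c, Seg (H i) (s₀ 0) v c → Near H (s₀ 0) i c u := by
    intro v hv huv c hvc
    have h1 := h.old.seg_base (ok.mem v hv) (ok.seg v hv)
    have h2 := h.old.seg_base (ok.mem u hui) (ok.seg u hui)
    rw [huv] at h2
    exact ⟨hui, Seg.total (h1.trans (hvc.mono (h.old.anti i))) h2⟩
  rcases hhd with h' | h'
  · exact h.coverp.imp (key p h.hp h' a) (key p h.hp h' b)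
  · exact h.coverq.imp (key q h.hq h' a) (key q h.hq h' b)

end Mid

/-! ### Tours of a forest -/

/-- The permutation obtained from `σ` by exchanging its values at `p` and `q`. -/
def exchange (σ : ℕ → ℕ) (p q e : ℕ) : ℕ := if e = p then σ q else if e = q then σ p else σ e

theorem exchange_permOn {G : Finset ℕ} {σ : ℕ → ℕ} {p q : ℕ} (h : PermOn G σ) (hp : p ∈ G)
    (hq : q ∈ G) : PermOn G (exchange σ p q) := by
  constructor
  · intro u hu
    unfold exchange
    split_ifs
    exacts [h.maps _ hq, h.maps _ hp, h.maps _ hu]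
  · intro u hu v hv huv
    unfold exchange at huv
    split_ifs at huv with h1 h2 h3 h4 h5 h6 h7 h8
    all_goals
      first
      | (have := h.inj _ hq _ hq huv; omega)
      | (have := h.inj _ hq _ hp huv; omega)
      | (have := h.inj _ hq _ hv huv; omega)
      | (have := h.inj _ hp _ hq huv; omega)
      | (have := h.inj _ hp _ hp huv; omega)
      | (have := h.inj _ hp _ hv huv; omega)
      | (have := h.inj _ hu _ hq huv; omega)
      | (have := h.inj _ hu _ hp huv; omega)
      | exact h.inj _ hu _ hv huv

/-- Exchanging the successors of two points on different cycles merges these cycles. -/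
theorem orb_exchange {G : Finset ℕ} {σ : ℕ → ℕ} {p q : ℕ} (h : PermOn G σ)
    (hp : p ∈ G) (hq : q ∈ G) (hpq : ¬ Orb G σ p q) :
    Orb G (exchange σ p q) p q ∧ ∀ x y, Orb G σ x y → Orb G (exchange σ p q) x y := by
  have hne : q ≠ p := fun h' => hpq (h' ▸ Orb.refl q)
  have e1 : exchange σ p q p = σ q := by simp [exchange]
  have e2 : exchange σ p q q = σ p := by simp [exchange, hne]
  have hmain : Orb G (exchange σ p q) p q := by
    obtain ⟨n, hn, hnq⟩ := h.exists_period hq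
    -- Starting with `σ q`, the successor of `p`, one follows the old cycle of `q`, as it avoids `p`.
    have key : ∀ j, Orb G (exchange σ p q) p (σ^[j + 1] q) ∨ Orb G (exchange σ p q) p q := by
      intro j
      induction j with
      | zero => left; have := Orb.step (σ := exchange σ p q) hp; rwa [e1] at this
      | succ j ih =>
        rcases ih with ih | ih
        · by_cases hjq : σ^[j + 1] q = q
          · right; rwa [hjq] at ih
          · left
            have hjp : σ^[j + 1] q ≠ p := by
              intro hjp
              apply hpq
              rw [← hjp]
              have : ∀ k, Orb G σ q (σ^[k] q) := by
                intro k
                induction k with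
                | zero => exact Orb.refl q
                | succ k ih =>
                  rw [Function.iterate_succ_apply']
                  exact ih.trans (Orb.step (h.iterate_mem hq k))
              exact (this _).symm
            have := Orb.step (σ := exchange σ p q) (h.iterate_mem hq (j + 1))
            rw [exchange, if_neg hjp, if_neg hjq, ← Function.iterate_succ_apply' σ] at this
            exact ih.trans this
        · exact Or.inr ih
    rcases key (n - 1) with h' | h'
    · rwa [show n - 1 + 1 = n by omega, hnq] at h'
    · exact h'
  refine ⟨hmain, fun x y hxy => ?_⟩
  induction hxy with
  | rel x y hxy =>
    rw [hxy.2]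
    by_cases hxp : x = p
    · subst hxp
      have := Orb.step (σ := exchange σ x q) hq
      rw [e2] at this
      exact hmain.trans this
    by_cases hxq : x = q
    · subst hxq
      have := Orb.step (σ := exchange σ p x) hp
      rw [e1] at this
      exact hmain.symm.trans this
    have := Orb.step (σ := exchange σ p q) hxy.1
    rwa [exchange, if_neg hxp, if_neg hxq] at this
  | refl x => exact Orb.refl x
  | symm _ _ _ ih => exact ih.symm
  | trans _ _ _ _ _ ih ih' => exact ih.trans ih'

section Tour

variable {V : ℕ}

/-- The dart `(a, b)`, a possible step from `a` to `b`, has number `b * V + a`. -/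
def dart (V a b : ℕ) : ℕ := b * V + a

/-- The cyclic order of the `V` darts at each vertex. -/
def rot (V e : ℕ) : ℕ := (e + V) % (V * V)

open Classical in
/-- The reversal of the darts that belong to edges; the other darts are loops and stay. -/
noncomputable def flip (G : SimpleGraph (Fin V)) (e : ℕ) : ℕ :=
  if ∃ a b : Fin V, G.Adj a b ∧ e = dart V a b then dart V (e / V) (e % V) else e

/-- The tour permutation of a graph: reverse the dart, then turn to the next dart at its vertex. On
a forest, its cycles are the tours around the trees. -/
noncomputable def tour (G : SimpleGraph (Fin V)) (e : ℕ) : ℕ := rot V (flip G e)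

theorem dart_mod (a : Fin V) (b : ℕ) : dart V a b % V = a := by
  rw [dart, Nat.mul_add_mod', Nat.mod_eq_of_lt a.2]

theorem dart_div (a : Fin V) (b : ℕ) : dart V a b / V = b := by
  rw [dart, mul_comm, Nat.mul_add_div (a.pos), Nat.div_eq_of_lt a.2, add_zero]

theorem dart_inj {a b a' b' : Fin V} (h : dart V a b = dart V a' b') : a = a' ∧ b = b' := by
  constructor
  · have := congrArg (· % V) h
    simp only [dart_mod] at this
    exact Fin.ext this
  · have := congrArg (· / V) h
    simp only [dart_div] at this
    exact Fin.ext this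

theorem dart_lt (a b : Fin V) : dart V a b < V * V := by
  have h1 := a.2
  have h2 : ((b : ℕ) + 1) * V ≤ V * V := Nat.mul_le_mul_right V b.2
  unfold dart
  nlinarith

theorem exists_dart {e : ℕ} (he : e < V * V) : ∃ a b : Fin V, e = dart V a b := by
  have hV : 0 < V := by
    rcases Nat.eq_zero_or_pos V with h | h
    · simp [h] at he
    · exact h
  refine ⟨⟨e % V, Nat.mod_lt _ hV⟩, ⟨e / V, Nat.div_lt_of_lt_mul he⟩, ?_⟩
  simp only [dart]
  rw [mul_comm, Nat.div_add_mod]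

theorem flip_dart_of_adj {G : SimpleGraph (Fin V)} {a b : Fin V} (h : G.Adj a b) :
    flip G (dart V a b) = dart V b a := by
  rw [flip, if_pos ⟨a, b, h, rfl⟩, dart_mod, dart_div]

theorem flip_dart_of_not_adj {G : SimpleGraph (Fin V)} {a b : Fin V} (h : ¬ G.Adj a b) :
    flip G (dart V a b) = dart V a b := by
  rw [flip, if_neg]
  rintro ⟨a', b', h', he⟩
  obtain ⟨rfl, rfl⟩ := dart_inj he
  exact h h'

theorem rot_dart (a b : Fin V) :
    rot V (dart V a b) = dart V a (((b : ℕ) + 1) % V) := by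
  have h1 := a.2
  rcases Nat.lt_or_ge (b + 1) V with h | h
  · rw [Nat.mod_eq_of_lt h, rot, Nat.mod_eq_of_lt]
    · unfold dart; ring
    · have : ((b : ℕ) + 1 + 1) * V ≤ V * V := Nat.mul_le_mul_right V h
      unfold dart; nlinarith
  · have hb : (b : ℕ) + 1 = V := le_antisymm b.2 h
    rw [hb, Nat.mod_self, rot]
    have : dart V a b + V = V * V + a := by
      unfold dart
      have : (b : ℕ) * V + V = V * V := by rw [← Nat.succ_mul, Nat.succ_eq_add_one, hb]
      omega
    rw [this, Nat.add_mod_left, Nat.mod_eq_of_lt (by nlinarith), dart, zero_mul, zero_add]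

theorem rot_dart_mod (a b : Fin V) : rot V (dart V a b) % V = a := by
  rw [rot_dart, dart_mod]

theorem tour_permOn (G : SimpleGraph (Fin V)) : PermOn (Finset.range (V * V)) (tour G) := by
  have hf : PermOn (Finset.range (V * V)) (flip G) := by
    constructor
    · intro e he
      obtain ⟨a, b, rfl⟩ := exists_dart (Finset.mem_range.1 he)
      by_cases h : G.Adj a b
      · rw [flip_dart_of_adj h]; exact Finset.mem_range.2 (dart_lt b a)
      · rwa [flip_dart_of_not_adj h]
    · intro e he e' he' hee
      obtain ⟨a, b, rfl⟩ := exists_dart (Finset.mem_range.1 he)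
      obtain ⟨a', b', rfl⟩ := exists_dart (Finset.mem_range.1 he')
      by_cases h : G.Adj a b <;> by_cases h' : G.Adj a' b'
      · rw [flip_dart_of_adj h, flip_dart_of_adj h'] at hee
        obtain ⟨rfl, rfl⟩ := dart_inj hee; rfl
      · rw [flip_dart_of_adj h, flip_dart_of_not_adj h'] at hee
        obtain ⟨rfl, rfl⟩ := dart_inj hee; exact absurd h.symm h'
      · rw [flip_dart_of_not_adj h, flip_dart_of_adj h'] at hee
        obtain ⟨rfl, rfl⟩ := dart_inj hee; exact absurd h'.symm h
      · rwa [flip_dart_of_not_adj h, flip_dart_of_not_adj h'] at hee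
  constructor
  · intro e he
    refine Finset.mem_range.2 (Nat.mod_lt _ ?_)
    have := Finset.mem_range.1 he
    omega
  · intro e he e' he' hee
    apply hf.inj e he e' he'
    have h1 := Finset.mem_range.1 (hf.maps e he)
    have h2 := Finset.mem_range.1 (hf.maps e' he')
    have := Nat.ModEq.add_right_cancel' V hee
    rwa [Nat.ModEq, Nat.mod_eq_of_lt h1, Nat.mod_eq_of_lt h2] at this

/-- Both inserting and deleting an edge exchange two values of the tour permutation. -/
theorem tour_link {G G' : SimpleGraph (Fin V)} {a b : Fin V} (hab : ¬ G.Adj a b)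
    (hadj : ∀ x y, G'.Adj x y ↔ G.Adj x y ∨ (x = a ∧ y = b) ∨ (x = b ∧ y = a))
    {e : ℕ} (he : e < V * V) : tour G' e = exchange (tour G) (dart V a b) (dart V b a) e := by
  obtain ⟨x, y, rfl⟩ := exists_dart he
  have hba : ¬ G.Adj b a := fun h => hab h.symm
  unfold exchange
  split_ifs with h1 h2
  · obtain ⟨rfl, rfl⟩ := dart_inj h1
    rw [tour, tour, flip_dart_of_adj ((hadj _ _).2 (by simp)), flip_dart_of_not_adj hba]
  · obtain ⟨rfl, rfl⟩ := dart_inj h2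
    rw [tour, tour, flip_dart_of_adj ((hadj _ _).2 (by simp)), flip_dart_of_not_adj hab]
  · have hiff : G'.Adj x y ↔ G.Adj x y := by
      rw [hadj]
      constructor
      · rintro (h | ⟨rfl, rfl⟩ | ⟨rfl, rfl⟩)
        exacts [h, absurd rfl h1, absurd rfl h2]
      · exact Or.inl
    rw [tour, tour]
    by_cases h : G.Adj x y
    · rw [flip_dart_of_adj h, flip_dart_of_adj (hiff.2 h)]
    · rw [flip_dart_of_not_adj h, flip_dart_of_not_adj (mt hiff.1 h)]

/-- The tour permutation moves along edges only. -/
theorem reachable_of_orb {G : SimpleGraph (Fin V)} {e e' : ℕ}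
    (h : Orb (Finset.range (V * V)) (tour G) e e') {x y : Fin V} (he : e % V = x)
    (he' : e' % V = y) : G.Reachable x y := by
  have hV : 0 < V := x.pos
  have key : G.Reachable ⟨e % V, Nat.mod_lt _ hV⟩ ⟨e' % V, Nat.mod_lt _ hV⟩ := by
    clear he he'
    induction h with
    | rel a b hab =>
      obtain ⟨a, c, rfl⟩ := exists_dart (Finset.mem_range.1 hab.1)
      obtain ⟨-, rfl⟩ := hab
      by_cases h : G.Adj a c
      · simp only [tour, flip_dart_of_adj h, rot_dart_mod, dart_mod]
        exact h.reachable
      · simp only [tour, flip_dart_of_not_adj h, rot_dart_mod, dart_mod]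
        exact SimpleGraph.Reachable.refl _
    | refl => exact SimpleGraph.Reachable.refl _
    | symm _ _ _ ih => exact ih.symm
    | trans _ _ _ _ _ ih ih' => exact ih.trans ih'
  have hx : (⟨e % V, Nat.mod_lt _ hV⟩ : Fin V) = x := Fin.ext he
  have hy : (⟨e' % V, Nat.mod_lt _ hV⟩ : Fin V) = y := Fin.ext he'
  rwa [hx, hy] at key

theorem orb_rot (a b : Fin V) :
    Orb (Finset.range (V * V)) (tour (⊥ : SimpleGraph (Fin V))) (dart V a b) (a : ℕ) := by
  have key : ∀ k : ℕ, ∀ h : k < V,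
      Orb (Finset.range (V * V)) (tour (⊥ : SimpleGraph (Fin V))) (dart V a (0 : ℕ))
        (dart V a k) := by
    intro k
    induction k with
    | zero => intro _; exact Orb.refl _
    | succ k ih =>
      intro h
      have h1 := ih (by omega)
      have h2 := Orb.step (σ := tour (⊥ : SimpleGraph (Fin V)))
        (Finset.mem_range.2 (dart_lt a ⟨k, by omega⟩))
      rw [tour, flip_dart_of_not_adj (by simp), rot_dart] at h2
      simp only [Nat.mod_eq_of_lt h] at h2
      exact h1.trans h2
  have := (key b b.2).symm
  simpa [dart] using this

/-- On a forest, the darts at the vertices of a tree form a single cycle of the tour permutation. -/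
theorem orb_of_acyclic {G : SimpleGraph (Fin V)} (hG : G.IsAcyclic) :
    (∀ a b : Fin V, Orb (Finset.range (V * V)) (tour G) (dart V a b) (a : ℕ)) ∧
      ∀ a b : Fin V, G.Reachable a b → Orb (Finset.range (V * V)) (tour G) (a : ℕ) (b : ℕ) := by
  obtain ⟨n, hn⟩ : ∃ n, G.edgeSet.ncard = n := ⟨_, rfl⟩
  induction n generalizing G with
  | zero =>
    have hbot : G = ⊥ := by
      rwa [Set.ncard_eq_zero, SimpleGraph.edgeSet_eq_empty] at hn
    subst hbot
    refine ⟨orb_rot, fun a b hab => ?_⟩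
    rw [SimpleGraph.reachable_bot] at hab
    rw [hab]; exact Orb.refl _
  | succ n ih =>
    obtain ⟨e, he⟩ := (Set.ncard_pos (s := G.edgeSet)).1 (by omega)
    induction e using Sym2.ind with
    | _ a b =>
    have hcard : (G.deleteEdges {s(a, b)}).edgeSet.ncard = n := by
      rw [SimpleGraph.edgeSet_deleteEdges, Set.ncard_sdiff_singleton_of_mem he, hn]
      rfl
    rw [SimpleGraph.mem_edgeSet] at he
    obtain ⟨ih1, ih2⟩ := ih (hG.anti (SimpleGraph.deleteEdges_le _)) hcard
    have hbr : ¬ (G.deleteEdges {s(a, b)}).Reachable a b :=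
      SimpleGraph.isBridge_iff.1 (SimpleGraph.isAcyclic_iff_forall_adj_isBridge.1 hG he)
    set G₀ := G.deleteEdges {s(a, b)} with hG₀
    have hadj : ∀ x y, G.Adj x y ↔ G₀.Adj x y ∨ (x = a ∧ y = b) ∨ (x = b ∧ y = a) := by
      intro x y
      simp only [hG₀, SimpleGraph.deleteEdges_adj, Set.mem_singleton_iff, Sym2.eq_iff]
      constructor
      · intro h; by_cases h' : x = a ∧ y = b ∨ x = b ∧ y = a
        · exact Or.inr h'
        · exact Or.inl ⟨h, h'⟩
      · rintro (h | ⟨rfl, rfl⟩ | ⟨rfl, rfl⟩)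
        exacts [h.1, he, he.symm]
    have hnorb : ¬ Orb (Finset.range (V * V)) (tour G₀) (dart V a b) (dart V b a) := fun ho =>
      hbr (reachable_of_orb ho (dart_mod a b) (dart_mod b a))
    obtain ⟨h1, h2⟩ := orb_exchange (tour_permOn G₀) (Finset.mem_range.2 (dart_lt a b))
      (Finset.mem_range.2 (dart_lt b a)) hnorb
    have hcongr : ∀ u ∈ Finset.range (V * V),
        exchange (tour G₀) (dart V a b) (dart V b a) u = tour G u := fun u hu =>
      (tour_link (fun h => hbr h.reachable) hadj (Finset.mem_range.1 hu)).symm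
    have k1 : ∀ x y : Fin V, Orb (Finset.range (V * V)) (tour G) (dart V x y) (x : ℕ) :=
      fun x y => (h2 _ _ (ih1 x y)).congr hcongr
    have kab : Orb (Finset.range (V * V)) (tour G) (a : ℕ) (b : ℕ) :=
      ((k1 a b).symm.trans (h1.congr hcongr)).trans (k1 b a)
    refine ⟨k1, fun x y hxy => ?_⟩
    obtain ⟨w⟩ := hxy
    induction w with
    | nil => exact Orb.refl _
    | @cons x y z hxy _ ih =>
      refine Orb.trans ?_ ih
      rcases (hadj x y).1 hxy with h | ⟨rfl, rfl⟩ | ⟨rfl, rfl⟩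
      · exact (h2 _ _ (ih2 x y h.reachable)).congr hcongr
      · exact kab
      · exact kab.symm

end Tour

/-! ### Random heights and their weak records -/

/-- The number of entries that are at least `m` and at least all previous entries. -/
def records : ℕ → List ℕ → ℕ
  | _, [] => 0
  | m, h :: t => if m ≤ h then records h t + 1 else records m t

/-- The height given by a sample `r < B ^ L`: the largest `i ≤ L` with `r < B ^ (L - i)`. A uniform
sample thus has height at least `i` with probability `B ^ (-i)`. -/
def height (B L r : ℕ) : ℕ := Nat.findGreatest (fun i => r < B ^ (L - i)) L

theorem le_height {B L r i : ℕ} (hB : 0 < B) (hr : r < B ^ L) :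
    i ≤ height B L r ↔ i ≤ L ∧ r < B ^ (L - i) := by
  constructor
  · intro h
    have hiL : i ≤ L := h.trans (Nat.findGreatest_le L)
    refine ⟨hiL, ?_⟩
    have : r < B ^ (L - height B L r) :=
      Nat.findGreatest_spec (P := fun i => r < B ^ (L - i)) (Nat.zero_le L) hr
    exact this.trans_le (Nat.pow_le_pow_right hB (by omega))
  · rintro ⟨h1, h2⟩
    exact Nat.le_findGreatest h1 h2

section MomentGenerating

variable {B L : ℕ} {a : ℝ}

theorem sum_indicator_lt {N k : ℕ} (hk : k ≤ N) :
    ∑ x ∈ Finset.range N, (if x < k then (1 : ℝ) else 0) = k := by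
  rw [← Finset.sum_filter, Finset.sum_const, nsmul_eq_mul, mul_one]
  congr 1
  have : (Finset.range N).filter (fun x => x < k) = Finset.range k := by
    ext x; simp only [Finset.mem_filter, Finset.mem_range]; omega
  rw [this, Finset.card_range]

/-- The bound on the moment generating function of the number of records above height `m` among `n`
random heights, up to the normalization. -/
noncomputable def momentBound (B L : ℕ) (a : ℝ) (m n : ℕ) : ℝ :=
  2 ^ (L - m) * (1 + (a - 1) / (B ^ L : ℕ)) ^ n

/-- A first height `x` below `m` changes nothing; otherwise it is a record and becomes the new
threshold. Reaching `m` has probability `B ^ (-m)` and costs a factor `a`; reaching even `m + 1` is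
`B` times less likely but halves `momentBound`. For `a = 1 + 1 / (2 * B)` the gain makes up for the
loss. At `m = L`, where there is nothing to gain, the loss is the growth of `momentBound` with `n`. -/
theorem momentBound_step (hB : 0 < B) (ha : a = 1 + 1 / (2 * B)) {m : ℕ} (hm : m ≤ L) (n : ℕ) :
    ∑ x ∈ Finset.range (B ^ L), (if m ≤ height B L x then a * momentBound B L a (height B L x) n
      else momentBound B L a m n) ≤ (B ^ L : ℕ) * momentBound B L a m (n + 1) := by
  have hBr : (0 : ℝ) < B := by exact_mod_cast hB
  have ha1 : 1 ≤ a := by rw [ha]; have : 0 < 1 / (2 * (B : ℝ)) := by positivity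
                         linarith
  have hN : 0 < B ^ L := pow_pos hB L
  have hNr : (0 : ℝ) < (B ^ L : ℕ) := by exact_mod_cast hN
  set q : ℝ := 1 + (a - 1) / (B ^ L : ℕ) with hq
  have hq1 : 1 ≤ q := by
    have : 0 ≤ (a - 1) / (B ^ L : ℕ) := div_nonneg (by linarith) hNr.le
    linarith
  have hqn : 0 < q ^ n := by positivity
  rcases Nat.lt_or_ge m L with hlt | hge
  · obtain ⟨k, rfl⟩ : ∃ k, L = m + 1 + k := ⟨L - (m + 1), by omega⟩
    set N := B ^ (m + 1 + k)
    have hc1 : B ^ k ≤ N := Nat.pow_le_pow_right hB (by omega)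
    have hc2 : B ^ (k + 1) ≤ N := Nat.pow_le_pow_right hB (by omega)
    have hpt : ∀ x ∈ Finset.range N, (if m ≤ height B (m + 1 + k) x
        then a * momentBound B (m + 1 + k) a (height B (m + 1 + k) x) n
        else momentBound B (m + 1 + k) a m n) ≤ momentBound B (m + 1 + k) a m n *
          (1 + (a - 1) * (if x < B ^ (k + 1) then 1 else 0)
            - a / 2 * (if x < B ^ k then 1 else 0)) := by
      intro x hx
      have hx := Finset.mem_range.1 hx
      have e1 : (m ≤ height B (m + 1 + k) x) ↔ x < B ^ (k + 1) := by
        rw [le_height hB hx, show m + 1 + k - m = k + 1 by omega]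
        exact ⟨fun h => h.2, fun h => ⟨by omega, h⟩⟩
      have e2 : (m + 1 ≤ height B (m + 1 + k) x) ↔ x < B ^ k := by
        rw [le_height hB hx, show m + 1 + k - (m + 1) = k by omega]
        exact ⟨fun h => h.2, fun h => ⟨by omega, h⟩⟩
      by_cases h1 : x < B ^ (k + 1)
      · rw [if_pos (e1.2 h1), if_pos h1]
        by_cases h2 : x < B ^ k
        · rw [if_pos h2]
          have : momentBound B (m + 1 + k) a (height B (m + 1 + k) x) n ≤
              momentBound B (m + 1 + k) a m n / 2 := by
            have h3 := e2.2 h2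
            have h4 : (2 : ℝ) ^ (m + 1 + k - height B (m + 1 + k) x) ≤ 2 ^ k :=
              pow_le_pow_right₀ one_le_two (by omega)
            have h5 : (2 : ℝ) ^ (m + 1 + k - m) = 2 ^ k * 2 := by
              rw [show m + 1 + k - m = k + 1 by omega, pow_succ]
            unfold momentBound
            rw [h5]
            have := mul_le_mul_of_nonneg_right h4 hqn.le
            linarith
          have := mul_le_mul_of_nonneg_left this (by linarith : 0 ≤ a)
          linarith
        · rw [if_neg h2]
          have : height B (m + 1 + k) x = m := by
            have := e1.2 h1
            have := mt e2.1 h2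
            omega
          rw [this]; linarith
      · have h2 : ¬ x < B ^ k := fun h => h1 (h.trans_le (Nat.pow_le_pow_right hB (by omega)))
        rw [if_neg (mt e1.1 h1), if_neg h1, if_neg h2]; linarith
    refine (Finset.sum_le_sum hpt).trans ?_
    rw [← Finset.mul_sum, Finset.sum_sub_distrib, Finset.sum_add_distrib, ← Finset.mul_sum,
      ← Finset.mul_sum, sum_indicator_lt hc1, sum_indicator_lt hc2, Finset.sum_const,
      Finset.card_range, nsmul_eq_mul, mul_one]
    have hle : ((N : ℕ) : ℝ) + (a - 1) * ((B ^ (k + 1) : ℕ) : ℝ) - a / 2 * ((B ^ k : ℕ) : ℝ)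
        ≤ (N : ℕ) := by
      have h1 : (a - 1) * B = 1 / 2 := by rw [ha]; field_simp; ring
      have h2 : (0 : ℝ) ≤ B ^ k := by positivity
      push_cast
      rw [pow_succ]
      nlinarith
    have hpos : 0 < momentBound B (m + 1 + k) a m n := by
      unfold momentBound; positivity
    have hmono : momentBound B (m + 1 + k) a m n ≤ momentBound B (m + 1 + k) a m (n + 1) := by
      unfold momentBound
      rw [pow_succ, ← mul_assoc]
      exact le_mul_of_one_le_right (by positivity) hq1
    calc _ ≤ momentBound B (m + 1 + k) a m n * (N : ℕ) := mul_le_mul_of_nonneg_left hle hpos.le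
      _ ≤ _ := by rw [mul_comm]; exact mul_le_mul_of_nonneg_left hmono hNr.le
  · obtain rfl : m = L := le_antisymm hm hge
    have hpt : ∀ x ∈ Finset.range (B ^ m), (if m ≤ height B m x
        then a * momentBound B m a (height B m x) n
        else momentBound B m a m n) = momentBound B m a m n *
          (1 + (a - 1) * (if x < 1 then 1 else 0)) := by
      intro x hx
      have hx := Finset.mem_range.1 hx
      have e1 : (m ≤ height B m x) ↔ x < 1 := by
        rw [le_height hB hx, Nat.sub_self, pow_zero]
        exact ⟨fun h => h.2, fun h => ⟨le_rfl, h⟩⟩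
      by_cases h1 : x < 1
      · have : height B m x = m := le_antisymm (Nat.findGreatest_le m) (e1.2 h1)
        rw [if_pos (e1.2 h1), if_pos h1, this]; ring
      · rw [if_neg (mt e1.1 h1), if_neg h1]; ring
    rw [Finset.sum_congr rfl hpt, ← Finset.mul_sum, Finset.sum_add_distrib, ← Finset.mul_sum,
      sum_indicator_lt hN, Finset.sum_const, Finset.card_range, nsmul_eq_mul, mul_one]
    unfold momentBound
    rw [pow_succ]
    apply le_of_eq
    field_simp
    push_cast
    ring

/-- The moment generating function of the number of records. -/
theorem sum_pow_records_le (hB : 0 < B) (ha : a = 1 + 1 / (2 * B)) (n : ℕ) {m : ℕ} (hm : m ≤ L) :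
    ∑ x : Fin n → Fin (B ^ L), a ^ records m (List.ofFn fun j => height B L (x j)) ≤
      ((B ^ L : ℕ) : ℝ) ^ n * momentBound B L a m n := by
  have hBr : (0 : ℝ) < B := by exact_mod_cast hB
  have ha0 : 0 < a := by rw [ha]; positivity
  have hNr : (0 : ℝ) < (B ^ L : ℕ) := by exact_mod_cast pow_pos hB L
  induction n generalizing m with
  | zero => simp [records, momentBound]; exact one_le_pow₀ one_le_two
  | succ n ih =>
    rw [← (Fin.consEquiv fun _ => Fin (B ^ L)).sum_comp, Fintype.sum_prod_type]
    have hin : ∀ y : Fin (B ^ L), ∑ x : Fin n → Fin (B ^ L),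
        a ^ records m (List.ofFn fun j => height B L
          ((Fin.consEquiv fun _ => Fin (B ^ L)) (y, x) j)) ≤
        ((B ^ L : ℕ) : ℝ) ^ n * (if m ≤ height B L y then a * momentBound B L a (height B L y) n
          else momentBound B L a m n) := by
      intro y
      simp only [Fin.consEquiv_apply, List.ofFn_succ, Fin.cons_zero, Fin.cons_succ, records]
      split_ifs with h
      · simp only [pow_succ]
        rw [← Finset.sum_mul]
        have := mul_le_mul_of_nonneg_right
          (ih (m := height B L y) (Nat.findGreatest_le L)) ha0.le
        linarith
      · exact ih hm
    refine (Finset.sum_le_sum fun y _ => hin y).trans ?_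
    rw [← Finset.mul_sum, Fin.sum_univ_eq_sum_range (fun y => if m ≤ height B L y
      then a * momentBound B L a (height B L y) n else momentBound B L a m n), pow_succ, mul_assoc]
    exact mul_le_mul_of_nonneg_left (momentBound_step hB ha hm n) (by positivity)

end MomentGenerating

section Law

theorem sample_lt (ω : Tape) (k : ℕ) {N : ℕ} (hN : 0 < N) : ω.sample k N < N := Nat.mod_lt _ hN

theorem volume_sample_le {N : ℕ} (hN : 0 < N) (c : ℕ) :
    (volume : Measure unitInterval) {v | ⌊(N : ℝ) * (v : ℝ)⌋₊ % N = c} ≤ (N : ENNReal)⁻¹ := by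
  have hNr : (0 : ℝ) < N := by exact_mod_cast hN
  rw [MeasureTheory.Measure.Subtype.volume_def,
    comap_subtype_coe_apply (measurableSet_Icc) volume]
  calc volume (Subtype.val '' {v : unitInterval | ⌊(N : ℝ) * (v : ℝ)⌋₊ % N = c})
      ≤ volume (Set.Ico ((c : ℝ) / N) ((c + 1) / N) ∪ {1}) := by
        apply measure_mono
        rintro _ ⟨⟨v, h0, h1⟩, hv, rfl⟩
        simp only [Set.mem_ofPred_eq] at hv
        rcases h1.lt_or_eq with h1 | h1
        · left
          have hlt : ⌊(N : ℝ) * v⌋₊ < N := by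
            rw [Nat.floor_lt (by positivity)]; nlinarith
          rw [Nat.mod_eq_of_lt hlt, Nat.floor_eq_iff (by positivity)] at hv
          constructor
          · rw [div_le_iff₀ hNr]; linarith
          · rw [lt_div_iff₀ hNr]; linarith
        · right; exact h1
    _ ≤ volume (Set.Ico ((c : ℝ) / N) ((c + 1) / N)) + volume {(1 : ℝ)} := measure_union_le _ _
    _ = (N : ENNReal)⁻¹ := by
        rw [Real.volume_Ico, Real.volume_singleton, add_zero,
          show ((c : ℝ) + 1) / N - c / N = (N : ℝ)⁻¹ by field_simp; ring,
          ENNReal.ofReal_inv_of_pos hNr, ENNReal.ofReal_natCast]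

theorem tapeLaw_cylinder_le {N n : ℕ} (hN : 0 < N) {f : Fin n → ℕ} (hf : Function.Injective f)
    (c : Fin n → ℕ) : tapeLaw {ω | ∀ j, ω.sample (f j) N = c j} ≤ ((N : ENNReal)⁻¹) ^ n := by
  classical
  have hset : {ω : Tape | ∀ j, ω.sample (f j) N = c j} =
      Set.pi ((Finset.univ.image f : Finset ℕ) : Set ℕ)
        (fun e => {v : unitInterval | ∀ j, f j = e → ⌊(N : ℝ) * (v : ℝ)⌋₊ % N = c j}) := by
    ext ω
    simp only [Set.mem_ofPred_eq, Set.mem_pi, Finset.coe_image, Finset.coe_univ, Set.image_univ,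
      Set.mem_range, forall_exists_index, Tape.sample]
    constructor
    · rintro h e j rfl j' hj'
      rw [← hj']; exact h j'
    · intro h j
      exact h (f j) j rfl j rfl
  have hmeas : ∀ k : ℕ, MeasurableSet {v : unitInterval | ⌊(N : ℝ) * (v : ℝ)⌋₊ % N = k} := by
    intro k
    have : Measurable fun v : unitInterval => ⌊(N : ℝ) * (v : ℝ)⌋₊ % N :=
      (measurable_from_top (f := fun x : ℕ => x % N)).comp
        (Nat.measurable_floor.comp (measurable_const.mul measurable_subtype_coe))
    exact this (measurableSet_singleton k)
  rw [hset, tapeLaw, Measure.infinitePi_pi]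
  · rw [Finset.prod_image fun _ _ _ _ h => hf h]
    calc _ ≤ ∏ _j : Fin n, (N : ENNReal)⁻¹ := by
          refine Finset.prod_le_prod' fun j _ => ?_
          refine le_trans (measure_mono ?_) (volume_sample_le hN (c j))
          intro v hv
          exact hv j rfl
      _ = _ := by simp
  · intro e _
    rw [Set.ofPred_forall]
    refine MeasurableSet.iInter fun j => ?_
    by_cases h : f j = e
    · simpa [h] using hmeas (c j)
    · simp [h]

/-- Many records are unlikely. -/
theorem tapeLaw_records_le {B L : ℕ} (hB : 0 < B) {l : List ℕ} (hl : l.Nodup)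
    (hlen : l.length ≤ B ^ L) (k : ℕ) :
    tapeLaw {ω | 2 * B * (L + 4 + k) ≤ records 0 (l.map fun e => height B L (ω.sample e (B ^ L)))}
      ≤ (4 * 2 ^ k : ENNReal)⁻¹ := by
  classical
  set N := B ^ L with hNdef
  have hN : 0 < N := pow_pos hB L
  have hNr : (0 : ℝ) < N := by exact_mod_cast hN
  have hBr : (0 : ℝ) < B := by exact_mod_cast hB
  set n := l.length with hn
  set T := 2 * B * (L + 4 + k) with hT
  set a : ℝ := 1 + 1 / (2 * B) with ha
  have ha1 : 1 ≤ a := by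
    have : 0 < 1 / (2 * (B : ℝ)) := by positivity
    linarith
  set bad : Finset (Fin n → Fin N) := Finset.univ.filter fun x =>
    T ≤ records 0 (List.ofFn fun j => height B L (x j)) with hbad
  -- Markov's inequality for the exponential moment, in counting form
  have haT : (2 : ℝ) ^ (L + 4 + k) ≤ a ^ T := by
    rw [hT, pow_mul]
    refine pow_le_pow_left₀ (by norm_num) ?_ _
    have := one_add_mul_le_pow (a := 1 / (2 * (B : ℝ))) (by
      have : 0 < 1 / (2 * (B : ℝ)) := by positivity
      linarith) (2 * B)
    refine le_trans (le_of_eq ?_) this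
    push_cast
    field_simp
    norm_num
  have hfac : (1 + (a - 1) / (N : ℝ)) ^ n ≤ 4 := by
    have h0 : (a - 1) / (N : ℝ) ≤ 1 / N := by
      apply div_le_div_of_nonneg_right _ hNr.le
      rw [ha]
      have : 1 / (2 * (B : ℝ)) ≤ 1 := by
        rw [div_le_one (by positivity)]
        have : (1 : ℝ) ≤ B := by exact_mod_cast hB
        linarith
      linarith
    have h1 : 0 ≤ (a - 1) / (N : ℝ) := div_nonneg (by linarith) hNr.le
    calc (1 + (a - 1) / (N : ℝ)) ^ n ≤ (1 + 1 / (N : ℝ)) ^ N :=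
          (pow_le_pow_left₀ (by linarith) (by linarith) n).trans
            (pow_le_pow_right₀ (by linarith) hlen)
      _ ≤ (Real.exp (1 / N)) ^ N := by
          refine pow_le_pow_left₀ (by positivity) ?_ _
          have := Real.add_one_le_exp (1 / (N : ℝ)); linarith
      _ = Real.exp 1 := by rw [← Real.exp_nat_mul]; congr 1; field_simp
      _ ≤ 4 := by have := Real.exp_one_lt_d9; linarith
  have hcard : (bad.card : ℝ) * (4 * 2 ^ k) ≤ (N : ℝ) ^ n := by
    have h1 : (bad.card : ℝ) * a ^ T ≤ (N : ℝ) ^ n * momentBound B L a 0 n := by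
      refine le_trans ?_ (sum_pow_records_le hB ha n (Nat.zero_le L))
      rw [← nsmul_eq_mul, ← Finset.sum_const]
      refine (Finset.sum_le_sum fun x hx => ?_).trans
        (Finset.sum_le_sum_of_subset_of_nonneg (Finset.subset_univ bad) fun _ _ _ => by positivity)
      exact pow_le_pow_right₀ ha1 (Finset.mem_filter.1 hx).2
    have h2 : momentBound B L a 0 n ≤ 2 ^ L * 4 := by
      unfold momentBound
      rw [Nat.sub_zero]
      exact mul_le_mul_of_nonneg_left hfac (by positivity)
    have h3 : (bad.card : ℝ) * 2 ^ (L + 4 + k) ≤ (N : ℝ) ^ n * (2 ^ L * 4) :=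
      (mul_le_mul_of_nonneg_left haT (by positivity)).trans
        (h1.trans (mul_le_mul_of_nonneg_left h2 (by positivity)))
    have h4 : (2 : ℝ) ^ (L + 4 + k) = (2 ^ L * 4) * (4 * 2 ^ k) := by
      rw [pow_add, pow_add]; ring
    rw [h4] at h3
    have h5 : (0 : ℝ) < 2 ^ L * 4 := by positivity
    nlinarith
  have hsub : {ω : Tape | T ≤ records 0 (l.map fun e => height B L (ω.sample e N))} ⊆
      ⋃ x ∈ bad, {ω : Tape | ∀ j : Fin n, ω.sample (l.get j) N = x j} := by
    intro ω hω
    simp only [Set.mem_iUnion]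
    refine ⟨fun j => ⟨ω.sample (l.get j) N, sample_lt ω _ hN⟩, ?_, fun j => rfl⟩
    rw [hbad, Finset.mem_filter]
    refine ⟨Finset.mem_univ _, ?_⟩
    have : (List.ofFn fun j : Fin n => height B L (ω.sample (l.get j) N)) =
        l.map fun e => height B L (ω.sample e N) := by
      conv_rhs => rw [← List.ofFn_get l, List.map_ofFn]
      rfl
    simp only [this]
    exact hω
  calc tapeLaw {ω : Tape | T ≤ records 0 (l.map fun e => height B L (ω.sample e N))}
      ≤ ∑ x ∈ bad, tapeLaw {ω : Tape | ∀ j : Fin n, ω.sample (l.get j) N = x j} :=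
        (measure_mono hsub).trans (measure_biUnion_finset_le _ _)
    _ ≤ ∑ _x ∈ bad, ((N : ENNReal)⁻¹) ^ n := Finset.sum_le_sum fun x _ =>
        tapeLaw_cylinder_le hN (List.nodup_iff_injective_get.1 hl) fun j => x j
    _ = bad.card * ((N : ENNReal)⁻¹) ^ n := by rw [Finset.sum_const, nsmul_eq_mul]
    _ ≤ (4 * 2 ^ k : ENNReal)⁻¹ := by
        have hnat : bad.card * (4 * 2 ^ k) ≤ N ^ n := by exact_mod_cast hcard
        have hE : (bad.card : ENNReal) * (4 * 2 ^ k) ≤ (N : ENNReal) ^ n := by exact_mod_cast hnat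
        have hN0 : ((N : ENNReal) ^ n) ≠ 0 := pow_ne_zero _ (by exact_mod_cast hN.ne')
        have hNt : ((N : ENNReal) ^ n) ≠ ⊤ := ENNReal.pow_ne_top (ENNReal.natCast_ne_top N)
        rw [ENNReal.le_inv_iff_mul_le, ← ENNReal.inv_pow, mul_right_comm]
        calc _ ≤ (N : ENNReal) ^ n * ((N : ENNReal) ^ n)⁻¹ := mul_le_mul_left hE _
          _ = 1 := ENNReal.mul_inv_cancel hN0 hNt

end Law

/-! ### Chunks and records -/

/-- The elements below `E` of height at least `i`, which make up level `i`. -/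
def lev (E : ℕ) (ht : ℕ → ℕ) (i : ℕ) : Finset ℕ := (Finset.range E).filter fun e => i ≤ ht e

theorem mem_lev {E : ℕ} {ht : ℕ → ℕ} {i e : ℕ} : e ∈ lev E ht i ↔ e < E ∧ i ≤ ht e := by
  simp [lev]

theorem lev_zero {E : ℕ} {ht : ℕ → ℕ} : lev E ht 0 = Finset.range E := by simp [lev]

theorem lev_anti {E : ℕ} {ht : ℕ → ℕ} (i : ℕ) : lev E ht (i + 1) ⊆ lev E ht i := fun e he => by
  rw [mem_lev] at *; omega

section CycleList

/-- The cycle of `x` under `f`, listed from `x` on. -/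
noncomputable def cycle (f : ℕ → ℕ) (x : ℕ) : List ℕ :=
  List.iterate f x (Function.minimalPeriod f x)

variable {G : Finset ℕ} {f : ℕ → ℕ} {x : ℕ}

theorem mem_iterate {n : ℕ} {y : ℕ} (h : y ∈ List.iterate f x n) : ∃ k < n, y = f^[k] x := by
  rw [List.mem_iff_getElem] at h
  obtain ⟨k, hk, rfl⟩ := h
  rw [List.length_iterate] at hk
  exact ⟨k, hk, by rw [List.getElem_iterate]⟩

theorem cycle_nodup : (cycle f x).Nodup := by
  rw [List.nodup_iff_injective_get]
  intro a b hab
  have ha : (a : ℕ) < Function.minimalPeriod f x := by simpa [cycle] using a.2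
  have hb : (b : ℕ) < Function.minimalPeriod f x := by simpa [cycle] using b.2
  refine Fin.ext (Function.iterate_injOn_Iio_minimalPeriod ha hb ?_)
  have e : ∀ c : Fin (cycle f x).length, (cycle f x).get c = f^[c] x := fun c => by
    rw [List.get_eq_getElem]; simp only [cycle, List.getElem_iterate]
  simpa only [e] using hab

theorem cycle_length_le (h : PermOn G f) (hx : x ∈ G) : (cycle f x).length ≤ G.card := by
  rw [← List.toFinset_card_of_nodup cycle_nodup]
  refine Finset.card_le_card fun y hy => ?_
  obtain ⟨k, -, rfl⟩ := mem_iterate (List.mem_toFinset.1 hy)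
  exact h.iterate_mem hx k

theorem mem_takeWhile_iterate (p : ℕ → Bool) {n k : ℕ} (hk : k < n)
    (hp : ∀ j ≤ k, p (f^[j] x)) : f^[k] x ∈ (List.iterate f x n).takeWhile p := by
  induction n generalizing x k with
  | zero => omega
  | succ n ih =>
    have h0 := hp 0 (Nat.zero_le k)
    simp only [Function.iterate_zero, id] at h0
    rw [List.iterate, List.takeWhile_cons_of_pos h0]
    rcases k with _ | k
    · simp
    · refine List.mem_cons_of_mem _ ?_
      rw [Function.iterate_succ_apply]
      exact ih (by omega) fun j hj => hp (j + 1) (by omega)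

theorem find?_iterate (p : ℕ → Bool) {n k : ℕ} (hk : k < n)
    (hp : ∀ j < k, ¬ p (f^[j] x)) (hpk : p (f^[k] x)) :
    (List.iterate f x n).find? p = some (f^[k] x) := by
  induction n generalizing x k with
  | zero => omega
  | succ n ih =>
    rw [List.iterate]
    rcases k with _ | k
    · exact List.find?_cons_of_pos hpk
    · have h0 : ¬ p x := hp 0 (by omega)
      rw [List.find?_cons_of_neg h0, Function.iterate_succ_apply]
      exact ih (by omega) (fun j hj => hp (j + 1) (by omega)) hpk

theorem exists_lt_minimalPeriod (h : PermOn G f) (hx : x ∈ G) (k : ℕ) :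
    ∃ m < Function.minimalPeriod f x, m ≤ k ∧ f^[m] x = f^[k] x := by
  obtain ⟨n, hn, hnx⟩ := h.exists_period hx
  have hpos : 0 < Function.minimalPeriod f x := Function.IsPeriodicPt.minimalPeriod_pos hn hnx
  exact ⟨k % Function.minimalPeriod f x, Nat.mod_lt _ hpos, Nat.mod_le _ _,
    Function.iterate_mod_minimalPeriod_eq⟩

end CycleList

section Visible

variable {E : ℕ} {ht : ℕ → ℕ}

/-- The entries of height `i` in front of which no entry is higher. -/
def visible (ht : ℕ → ℕ) (i : ℕ) (l : List ℕ) : List ℕ :=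
  (l.takeWhile fun e => ht e ≤ i).filter fun e => ht e = i

theorem sum_visible_le (ht : ℕ → ℕ) (l : List ℕ) (m K : ℕ) :
    ∑ i ∈ Finset.Ico m K, (visible ht i l).length ≤ records m (l.map ht) := by
  induction l generalizing m with
  | nil => simp [visible]
  | cons x t ih =>
    rw [List.map_cons, records]
    have hlow : ∀ i, ht x < i → visible ht i (x :: t) = visible ht i t := by
      intro i hi
      rw [visible, List.takeWhile_cons_of_pos (by simpa using hi.le), List.filter_cons_of_neg
        (by simpa using hi.ne)]
      rfl
    split_ifs with h
    · have hsplit : ∑ i ∈ Finset.Ico m K, (visible ht i (x :: t)).length ≤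
          ∑ i ∈ Finset.Ico (ht x) K, ((visible ht i t).length + if i = ht x then 1 else 0) := by
        have h0 : ∀ i, i < ht x → visible ht i (x :: t) = [] := by
          intro i hi
          rw [visible, List.takeWhile_cons_of_neg (by simpa using hi)]; rfl
        calc _ = ∑ i ∈ (Finset.Ico m K).filter (fun i => ht x ≤ i),
              (visible ht i (x :: t)).length := by
              rw [Finset.sum_filter]
              refine Finset.sum_congr rfl fun i _ => ?_
              split_ifs with hi
              · rfl
              · rw [h0 i (by omega)]; rfl
          _ ≤ ∑ i ∈ (Finset.Ico m K).filter (fun i => ht x ≤ i),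
              ((visible ht i t).length + if i = ht x then 1 else 0) := by
              refine Finset.sum_le_sum fun i hi => ?_
              rcases eq_or_ne i (ht x) with rfl | hne
              · rw [visible, List.takeWhile_cons_of_pos (by simp), List.filter_cons_of_pos
                  (by simp)]
                simp [visible]
              · rw [hlow i (lt_of_le_of_ne (Finset.mem_filter.1 hi).2 hne.symm)]
                simp
          _ ≤ _ := by
              refine Finset.sum_le_sum_of_subset fun i hi => ?_
              simp only [Finset.mem_filter, Finset.mem_Ico] at *
              omega
      refine hsplit.trans ?_
      rw [Finset.sum_add_distrib]
      refine Nat.add_le_add (ih (ht x)) ?_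
      rw [Finset.sum_ite_eq']
      split_ifs <;> simp
    · refine le_trans (le_of_eq (Finset.sum_congr rfl fun i hi => ?_)) (ih m)
      rw [hlow i (by have := (Finset.mem_Ico.1 hi).1; omega)]

/-- An inverse of the permutation `σ` of `G`. -/
theorem PermOn.exists_inverse {G : Finset ℕ} {σ : ℕ → ℕ} (h : PermOn G σ) :
    ∃ τ : ℕ → ℕ, PermOn G τ ∧ ∀ u ∈ G, τ (σ u) = u := by
  classical
  have hsurj : ∀ y ∈ G, ∃ u ∈ G, σ u = y := by
    intro y hy
    obtain ⟨n, hn, hny⟩ := h.exists_period hy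
    refine ⟨σ^[n - 1] y, h.iterate_mem hy _, ?_⟩
    rw [← Function.iterate_succ_apply' σ, Nat.succ_eq_add_one, show n - 1 + 1 = n by omega, hny]
  choose! τ h1 h2 using hsurj
  refine ⟨τ, ⟨h1, fun u hu v hv huv => ?_⟩, fun u hu => ?_⟩
  · rw [← h2 u hu, ← h2 v hv, huv]
  · exact h.inj _ (h1 _ (h.maps u hu)) u hu (h2 _ (h.maps u hu))

open Classical in
/-- In total over all levels, the number of elements near `c` is bounded by the number of records
met on the two ways around the cycle of `c`. -/
theorem sum_near_le {σ τ : ℕ → ℕ} (hσ : PermOn (Finset.range E) σ)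
    (hτ : PermOn (Finset.range E) τ) (hinv : ∀ u ∈ Finset.range E, τ (σ u) = u) {c : ℕ}
    (hc : c ∈ Finset.range E) (K : ℕ) :
    ∑ i ∈ Finset.range K, ((Finset.range E).filter (Near (lev E ht) σ i c)).card ≤
      2 * K + records 0 ((cycle σ (σ c)).map ht) + records 0 ((cycle τ c).map ht) := by
  have hsub : ∀ i, ((Finset.range E).filter (Near (lev E ht) σ i c)) ⊆
      insert c ((((cycle τ c).find? fun e => ¬ ht e ≤ i).toFinset ∪
        (visible ht i (cycle σ (σ c))).toFinset) ∪ (visible ht i (cycle τ c)).toFinset) := by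
    intro i w hw
    obtain ⟨hwE, hwi, hor⟩ := Finset.mem_filter.1 hw
    have hwi := (mem_lev.1 hwi).2
    have hle : ∀ u ∈ Finset.range E, u ∉ lev E ht (i + 1) → ht u ≤ i := fun u hu hn => by
      rw [mem_lev] at hn
      have := Finset.mem_range.1 hu
      omega
    simp only [Finset.mem_insert, Finset.mem_union, List.mem_toFinset, Option.mem_toFinset,
      Option.mem_def]
    rcases hor with h | h
    · obtain ⟨k, hk, hn⟩ := h.exists_iterate
      rcases k with _ | k
      · exact Or.inl hk.symm
      · right; left; right
        have hsc := hσ.maps c hc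
        obtain ⟨m, hm, hmk, hme⟩ := exists_lt_minimalPeriod hσ hsc k
        have hw' : σ^[m] (σ c) = w := by rw [hme, ← Function.iterate_succ_apply, hk]
        have hall : ∀ j ≤ m, ht (σ^[j] (σ c)) ≤ i := fun j hj => by
          apply hle _ (hσ.iterate_mem hsc j)
          rw [← Function.iterate_succ_apply]
          exact hn (j + 1) (by omega) (by omega)
        have := mem_takeWhile_iterate (fun e => decide (ht e ≤ i)) hm (f := σ) (x := σ c)
          fun j hj => by simpa using hall j hj
        rw [hw'] at this
        refine List.mem_filter.2 ⟨this, ?_⟩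
        have := hall m le_rfl
        rw [hw'] at this
        simp only [decide_eq_true_eq]; omega
    · obtain ⟨k, hk, hn⟩ := h.exists_iterate
      have hback : ∀ j ≤ k, τ^[j] c = σ^[k - j] w := by
        intro j
        induction j with
        | zero => intro _; exact hk.symm
        | succ j ih =>
          intro hj
          rw [Function.iterate_succ_apply', ih (by omega),
            show k - j = (k - (j + 1)) + 1 by omega, Function.iterate_succ_apply',
            hinv _ (hσ.iterate_mem hwE _)]
      have hwk : τ^[k] c = w := by rw [hback k le_rfl, Nat.sub_self]; rfl
      obtain ⟨m, hm, hmk, hme⟩ := exists_lt_minimalPeriod hτ hc k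
      have hw' : τ^[m] c = w := by rw [hme, hwk]
      have hall : ∀ j < m, ht (τ^[j] c) ≤ i := fun j hj => by
        apply hle _ (hτ.iterate_mem hc j)
        rw [hback j (by omega)]
        exact hn (k - j) (by omega) (by omega)
      by_cases hwi' : ht w ≤ i
      · right; right
        have := mem_takeWhile_iterate (fun e => decide (ht e ≤ i)) hm (f := τ) (x := c)
          fun j hj => by
            rcases Nat.lt_or_ge j m with h | h
            · simpa using hall j h
            · rw [show j = m by omega, hw']; simpa using hwi'
        rw [hw'] at this
        refine List.mem_filter.2 ⟨this, ?_⟩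
        simp only [decide_eq_true_eq]; omega
      · right; left; left
        rw [← hw']
        refine find?_iterate _ hm (fun j hj => ?_) ?_
        · simpa using hall j hj
        · rw [hw']; simpa using hwi'
  have hcard : ∀ i, ((Finset.range E).filter (Near (lev E ht) σ i c)).card ≤
      2 + (visible ht i (cycle σ (σ c))).length + (visible ht i (cycle τ c)).length := by
    intro i
    refine (Finset.card_le_card (hsub i)).trans ?_
    refine (Finset.card_insert_le _ _).trans ?_
    have h1 := Finset.card_union_le (((cycle τ c).find? fun e => ¬ ht e ≤ i).toFinset ∪
        (visible ht i (cycle σ (σ c))).toFinset) (visible ht i (cycle τ c)).toFinset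
    have h2 := Finset.card_union_le ((cycle τ c).find? fun e => ¬ ht e ≤ i).toFinset
        (visible ht i (cycle σ (σ c))).toFinset
    have h3 := List.toFinset_card_le (visible ht i (cycle σ (σ c)))
    have h4 := List.toFinset_card_le (visible ht i (cycle τ c))
    have h5 : ((cycle τ c).find? fun e => ¬ ht e ≤ i).toFinset.card ≤ 1 := by
      cases ((cycle τ c).find? fun e => ¬ ht e ≤ i) <;> simp
    omega
  calc _ ≤ ∑ i ∈ Finset.range K, (2 + (visible ht i (cycle σ (σ c))).length +
          (visible ht i (cycle τ c)).length) := Finset.sum_le_sum fun i _ => hcard i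
    _ = 2 * K + ∑ i ∈ Finset.Ico 0 K, (visible ht i (cycle σ (σ c))).length +
          ∑ i ∈ Finset.Ico 0 K, (visible ht i (cycle τ c)).length := by
        rw [Finset.sum_add_distrib, Finset.sum_add_distrib, Finset.sum_const, Finset.card_range,
          Finset.range_eq_Ico, smul_eq_mul, mul_comm]
    _ ≤ _ := by
        gcongr
        · exact sum_visible_le ht _ 0 K
        · exact sum_visible_le ht _ 0 K

end Visible

/-! ### Reasoning about programs -/

section Programs

variable {D : Type u} [CommSemigroup D] {N : ℕ} {ω : Tape} {f : D → D}

/-- Total correctness: `c`, started in `s`, halts in a state that satisfies `Q`. -/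
def Halts (N : ℕ) (ω : Tape) (f : D → D) (c : Cmd) (s : State D) (Q : State D → Prop) : Prop :=
  ∃ t, Exec N ω f c s t ∧ Q t

/-- Sequential composition of a list of programs. -/
def Cmd.seqs : List Cmd → Cmd
  | [] => .skip
  | [c] => c
  | c :: cs => .seq c (seqs cs)

theorem halts_skip {s : State D} {Q : State D → Prop} : Halts N ω f .skip s Q ↔ Q s := by
  constructor
  · rintro ⟨t, h, hQ⟩; cases h; exact hQ
  · exact fun h => ⟨s, .skip s, h⟩

theorem halts_instr {i : Instr} {s : State D} {Q : State D → Prop} :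
    Halts N ω f (.instr i) s Q ↔ Q (i.run N ω f s) := by
  constructor
  · rintro ⟨t, h, hQ⟩; cases h; exact hQ
  · exact fun h => ⟨_, .instr i s, h⟩

theorem halts_seq {c₁ c₂ : Cmd} {s : State D} {Q : State D → Prop} :
    Halts N ω f (.seq c₁ c₂) s Q ↔ Halts N ω f c₁ s fun t => Halts N ω f c₂ t Q := by
  constructor
  · rintro ⟨t, h, hQ⟩
    cases h with
    | seq h1 h2 => exact ⟨_, h1, _, h2, hQ⟩
  · rintro ⟨t, h1, t', h2, hQ⟩
    exact ⟨t', .seq h1 h2, hQ⟩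

theorem halts_seqs_cons {c d : Cmd} {l : List Cmd} {s : State D} {Q : State D → Prop} :
    Halts N ω f (Cmd.seqs (c :: d :: l)) s Q ↔
      Halts N ω f c s fun t => Halts N ω f (Cmd.seqs (d :: l)) t Q := halts_seq

theorem halts_seqs_singleton {c : Cmd} {s : State D} {Q : State D → Prop} :
    Halts N ω f (Cmd.seqs [c]) s Q ↔ Halts N ω f c s Q := Iff.rfl

theorem halts_ite {r : ℕ} {c₁ c₂ : Cmd} {s : State D} {Q : State D → Prop} :
    Halts N ω f (.ite r c₁ c₂) s Q ↔
      if s.reg r = 0 then Halts N ω f c₂ s.tick Q else Halts N ω f c₁ s.tick Q := by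
  constructor
  · rintro ⟨t, h, hQ⟩
    cases h with
    | ite_true h0 h => rw [if_neg h0]; exact ⟨t, h, hQ⟩
    | ite_false h0 h => rw [if_pos h0]; exact ⟨t, h, hQ⟩
  · split_ifs with h0
    · rintro ⟨t, h, hQ⟩; exact ⟨t, .ite_false h0 h, hQ⟩
    · rintro ⟨t, h, hQ⟩; exact ⟨t, .ite_true h0 h, hQ⟩

theorem Halts.mono {c : Cmd} {s : State D} {Q Q' : State D → Prop} (h : Halts N ω f c s Q)
    (hQ : ∀ t, Q t → Q' t) : Halts N ω f c s Q' := by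
  obtain ⟨t, ht, hq⟩ := h
  exact ⟨t, ht, hQ t hq⟩

/-- A loop that decreases the counter `k` of the invariant `I k` with every iteration. -/
theorem halts_loop {r : ℕ} {c : Cmd} {Q : State D → Prop} (I : ℕ → State D → Prop)
    (step : ∀ k s, I k s → s.reg r ≠ 0 → ∃ j < k, Halts N ω f c s.tick (I j))
    (done : ∀ k s, I k s → s.reg r = 0 → Q s.tick) {k : ℕ} {s : State D} (h : I k s) :
    Halts N ω f (.loop r c) s Q := by
  induction k using Nat.strong_induction_on generalizing s with
  | _ k ih =>
    by_cases h0 : s.reg r = 0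
    · exact ⟨_, .loop_done h0, done k s h h0⟩
    · obtain ⟨j, hj, t, ht, hI⟩ := step k s h h0
      obtain ⟨t', ht', hQ⟩ := ih j hj hI
      exact ⟨t', .loop_step h0 ht ht', hQ⟩

theorem Exec.unique {c : Cmd} {s t t' : State D} (h : Exec N ω f c s t) (h' : Exec N ω f c s t') :
    t = t' := by
  induction h generalizing t' with
  | skip s => cases h'; rfl
  | instr i s => cases h'; rfl
  | seq _ _ ih1 ih2 =>
    cases h' with
    | seq h1 h2 => rw [ih1 h1] at ih2; exact ih2 h2
  | ite_true h0 _ ih =>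
    cases h' with
    | ite_true _ h => exact ih h
    | ite_false h1 _ => exact absurd h1 h0
  | ite_false h0 _ ih =>
    cases h' with
    | ite_true h1 _ => exact absurd h0 h1
    | ite_false _ h => exact ih h
  | loop_done h0 =>
    cases h' with
    | loop_done _ => rfl
    | loop_step h1 _ _ => exact absurd h0 h1
  | loop_step h0 _ _ ih1 ih2 =>
    cases h' with
    | loop_done h1 => exact absurd h1 h0
    | loop_step _ h1 h2 => rw [ih1 h1] at ih2; exact ih2 h2

end Programs

/-! ### Rebuilding one chunk -/

open Cmd Instr

/-- Rebuild the chunk that starts with the node in register `10`: make the node above it the parent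
of all nodes of the chunk and store there the aggregate and the successor on the next level.
Registers: `3` holds `E`, `4`, `5`, `6` hold the offsets `M`, `2 * M`, `3 * M` of the tables, `7`
holds zero; `11` is the parent, `12` the current node, `13` tells whether the parent has a value.
The chunk ends in front of an element of the next level or, on a cycle without such an element, at
the node where it started, which is recognized by `|a - b| = (a - b) + (b - a)` in truncated
subtraction. -/
def walkBody : Cmd := seqs [
  instr (add 15 12 4), instr (store 15 11),
  instr (add 15 12 6), instr (load 16 15),
  ite 16 (seq (ite 13 (instr (aggregate 11 11 12)) (instr (copy 11 12))) (instr (const 13 1))) skip,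
  instr (load 12 12),
  instr (add 15 12 3), instr (add 15 15 5), instr (load 16 15),
  ite 16 (instr (const 14 0))
    (seqs [instr (sub 15 12 10), instr (sub 16 10 12), instr (add 14 15 16)])]

/-- Prepare the registers, rebuild the chunk node by node, and record in the tables the successor of
the parent and whether the parent has a value. -/
def walk : Cmd := seqs [
  instr (add 11 10 3), instr (add 12 10 7), instr (const 13 0), instr (const 14 1),
  loop 14 walkBody,
  instr (add 15 12 3), instr (store 11 15), instr (add 15 11 6), instr (store 15 13)]

section Walk

variable {D : Type u} [CommSemigroup D] {N : ℕ} {ω : Tape} {f : D → D}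

/-- The aggregate stored at a node: a node without a value has the empty aggregate. -/
def aggAt (M : ℕ) (mem : ℕ → ℕ) (val : ℕ → D) (a : ℕ) : WithOne D :=
  if mem (a + 3 * M) = 0 then 1 else (val a : WithOne D)

/-- The registers that hold the constants of the data structure. -/
structure Consts (E M : ℕ) (s : State D) : Prop where
  r3 : s.reg 3 = E
  r4 : s.reg 4 = M
  r5 : s.reg 5 = 2 * M
  r6 : s.reg 6 = 3 * M
  r7 : s.reg 7 = 0

/-- The state `s` after `k` of the elements `g 0, g 1, …` of a chunk have been processed. -/
structure WalkInv (N E M o x : ℕ) (g : ℕ → ℕ) (s₀ : State D) (k : ℕ) (s : State D) : Prop where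
  r11 : s.reg 11 = o + E + x
  r12 : s.reg 12 = o + g k
  keep : ∀ r, r < 11 ∨ 17 ≤ r → s.reg r = s₀.reg r
  mem : ∀ a, s.mem a = if ∃ j < k, a = o + g j + M then o + E + x else s₀.mem a
  val : ∀ a, a ≠ o + E + x → s.val a = s₀.val a
  acc : (if s.reg 13 = 0 then 1 else (s.val (o + E + x) : WithOne D)) =
    ∏ j ∈ Finset.range k, aggAt M s₀.mem s₀.val (o + g j)
  r13 : s.reg 13 < N
  drawn : s.drawn = s₀.drawn
  mods : s.modifications = s₀.modifications
  steps : s.steps ≤ s₀.steps + 20 * k + 4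
  aggs : s.aggregations ≤ s₀.aggregations + k

set_option maxHeartbeats 1000000 in
theorem walkBody_spec {E M o x : ℕ} {g : ℕ → ℕ} {s₀ s : State D} {k : ℕ}
    (hc : Consts E M s₀) (hN : 4 * M ≤ N) (ho : o + 2 * E ≤ M) (hx : x < E)
    (h10 : s₀.reg 10 = o + x) (hg : ∀ j, g j < E) (hnxt : s₀.mem (o + g k) = o + g (k + 1))
    (hreal : s₀.mem (o + E + g (k + 1) + 2 * M) < N) (hflag : s₀.mem (o + g k + 3 * M) < N)
    (h : WalkInv N E M o x g s₀ k s) :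
    Halts N ω f walkBody s.tick fun t => WalkInv N E M o x g s₀ (k + 1) t ∧
      (t.reg 14 ≠ 0 ↔ s₀.mem (o + E + g (k + 1) + 2 * M) = 0 ∧ g (k + 1) ≠ x) := by
  have hgk := hg k
  have hgk1 := hg (k + 1)
  have e3 : s.reg 3 = E := by rw [h.keep 3 (by omega), hc.r3]
  have e4 : s.reg 4 = M := by rw [h.keep 4 (by omega), hc.r4]
  have e5 : s.reg 5 = 2 * M := by rw [h.keep 5 (by omega), hc.r5]
  have e6 : s.reg 6 = 3 * M := by rw [h.keep 6 (by omega), hc.r6]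
  have e10 : s.reg 10 = o + x := by rw [h.keep 10 (by omega), h10]
  have e11 := h.r11
  have e12 := h.r12
  have m1 : (o + g k + M) % N = o + g k + M := Nat.mod_eq_of_lt (by omega)
  have m2 : (o + g k + 3 * M) % N = o + g k + 3 * M := Nat.mod_eq_of_lt (by omega)
  have m3 : (o + g (k + 1) + E) % N = o + g (k + 1) + E := Nat.mod_eq_of_lt (by omega)
  have m4 : (o + g (k + 1) + E + 2 * M) % N = o + g (k + 1) + E + 2 * M :=
    Nat.mod_eq_of_lt (by omega)
  have memne : ∀ a, (a < M ∨ 2 * M ≤ a) → s.mem a = s₀.mem a := by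
    intro a ha
    rw [h.mem a, if_neg]
    rintro ⟨j, -, rfl⟩
    have := hg j
    omega
  have l1 : s.mem (o + g k + 3 * M) = s₀.mem (o + g k + 3 * M) := memne _ (by omega)
  have l2 : s.mem (o + g k) = o + g (k + 1) := by rw [memne _ (by omega), hnxt]
  have l3 : s.mem (o + g (k + 1) + E + 2 * M) = s₀.mem (o + E + g (k + 1) + 2 * M) := by
    rw [memne _ (by omega)]; congr 1; omega
  have n1 : ¬ o + g k + 3 * M = o + g k + M := by omega
  have n2 : ¬ o + g k = o + g k + M := by omega
  have n3 : ¬ o + g (k + 1) + E + 2 * M = o + g k + M := by omega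
  have m5 : (o + g (k + 1)) % N = o + g (k + 1) := Nat.mod_eq_of_lt (by omega)
  have m6 : s₀.mem (o + g k + 3 * M) % N = s₀.mem (o + g k + 3 * M) := Nat.mod_eq_of_lt hflag
  have m7 : s₀.mem (o + E + g (k + 1) + 2 * M) % N = s₀.mem (o + E + g (k + 1) + 2 * M) :=
    Nat.mod_eq_of_lt hreal
  unfold walkBody
  simp only [seqs, halts_seq, halts_instr, halts_ite, halts_skip, Instr.run, State.put, State.tick,
    Function.update_apply, e3, e4, e5, e6, e10, e11, e12, Nat.reduceEqDiff, reduceIte, m1, m2, m3,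
    m4, m5, m6, m7, n1, n2, n3, l1, l2, l3]
  have hmem : ∀ a, Function.update s.mem (o + g k + M) (o + E + x) a =
      if ∃ j < k + 1, a = o + g j + M then o + E + x else s₀.mem a := by
    intro a
    by_cases ha : a = o + g k + M
    · rw [ha, Function.update_self, if_pos ⟨k, by omega, rfl⟩]
    · rw [Function.update_of_ne ha, h.mem a]
      refine if_congr ⟨?_, ?_⟩ rfl rfl
      · rintro ⟨j, hj, rfl⟩; exact ⟨j, by omega, rfl⟩
      · rintro ⟨j, hj, rfl⟩
        rcases Nat.lt_succ_iff_lt_or_eq.1 hj with hj | rfl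
        · exact ⟨j, hj, rfl⟩
        · exact absurd rfl ha
  have hp := Finset.prod_range_succ (fun j => aggAt M s₀.mem s₀.val (o + g j)) k
  have hacc := h.acc
  have hvk : s.val (o + g k) = s₀.val (o + g k) := h.val _ (by omega)
  have hst := h.steps
  have hag := h.aggs
  have h13 := h.r13
  have hN1 : 1 < N := by omega
  have d1 : (o + g (k + 1) - (o + x)) % N = o + g (k + 1) - (o + x) := Nat.mod_eq_of_lt (by omega)
  have d2 : (o + x - (o + g (k + 1))) % N = o + x - (o + g (k + 1)) := Nat.mod_eq_of_lt (by omega)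
  have d3 : (o + g (k + 1) - (o + x) + (o + x - (o + g (k + 1)))) % N =
    o + g (k + 1) - (o + x) + (o + x - (o + g (k + 1))) := Nat.mod_eq_of_lt (by omega)
  have d4 : 1 % N = 1 := Nat.mod_eq_of_lt hN1
  have hkeep : ∀ r, r < 11 ∨ 17 ≤ r →
      r ≠ 12 ∧ r ≠ 13 ∧ r ≠ 14 ∧ r ≠ 15 ∧ r ≠ 16 := fun r hr => by omega
  have hval : ∀ (v : D) a, a ≠ o + E + x → Function.update s.val (o + E + x) v a = s₀.val a :=
    fun v a ha => by rw [Function.update_of_ne ha, h.val a ha]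
  simp only [d1, d2, d3, d4, Nat.zero_mod]
  split_ifs with hf hr h1 hr hr
  all_goals
    refine ⟨⟨?_, ?_, ?_, hmem, ?_, ?_, ?_, h.drawn, h.mods, ?_, ?_⟩, ?_⟩
  any_goals exact hval _
  any_goals exact h.val
  all_goals try simp only [Function.update_apply, Nat.reduceEqDiff, reduceIte]
  any_goals exact e11
  any_goals first | omega | exact h13 | exact hN1
  any_goals
    intro r hr
    obtain ⟨k12, k13, k14, k15, k16⟩ := hkeep r hr
    simp only [k12, k13, k14, k15, k16, if_false]
    exact h.keep r hr
  any_goals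
    rw [hp, ← hacc, aggAt, if_pos hf, mul_one]
  any_goals
    rw [hp, ← hacc, aggAt, if_neg hf, if_pos h1, one_mul, hvk]
  any_goals
    rw [hp, ← hacc, aggAt, if_neg hf, if_neg h1, hvk, WithOne.coe_mul]

end Walk

section WalkSpec

variable {D : Type u} [CommSemigroup D] {N : ℕ} {ω : Tape} {f : D → D}

open Classical in
/-- The effect of rebuilding the chunk of the element `x` on the level whose nodes start at address
`o`, where `σ` is the cyclic order on the level and `H` the set of elements of the next level. -/
structure Walked (N E M o : ℕ) (G H : Finset ℕ) (σ : ℕ → ℕ) (x : ℕ) (s t : State D) : Prop where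
  exit : ∃ w, Seg H σ x w ∧ t.mem (o + E + x) = o + E + σ w ∧ (σ w ∈ H ∨ σ w = x)
  par : ∀ u, Seg H σ x u → t.mem (o + u + M) = o + E + x
  flag : t.mem (o + E + x + 3 * M) < N
  agg : aggAt M t.mem t.val (o + E + x) =
    ∏ u ∈ G with Seg H σ x u, aggAt M s.mem s.val (o + u)
  mem : ∀ a, a ≠ o + E + x → a ≠ o + E + x + 3 * M → (∀ u, Seg H σ x u → a ≠ o + u + M) →
    t.mem a = s.mem a
  val : ∀ a, a ≠ o + E + x → t.val a = s.val a
  keep : ∀ r, r < 11 ∨ 17 ≤ r → t.reg r = s.reg r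
  drawn : t.drawn = s.drawn
  mods : t.modifications = s.modifications
  steps : t.steps ≤ s.steps + 20 * (G.filter (Seg H σ x)).card + 9
  aggs : t.aggregations ≤ s.aggregations + (G.filter (Seg H σ x)).card

open Classical in
/-- The elements of a chunk are the first iterates of the order. -/
theorem exists_chunk_length {G H : Finset ℕ} {σ : ℕ → ℕ} (hσ : PermOn G σ) {x : ℕ} (hx : x ∈ G) :
    ∃ K, (∀ j, 0 < j → j < K → σ^[j] x ∉ H ∧ σ^[j] x ≠ x) ∧ 0 < K ∧
      (σ^[K] x ∈ H ∨ σ^[K] x = x) ∧ (∀ u, Seg H σ x u ↔ ∃ j < K, u = σ^[j] x) ∧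
      Set.InjOn (fun j => σ^[j] x) (Finset.range K) := by
  have hP : ∃ d, σ^[d + 1] x ∈ H ∨ σ^[d + 1] x = x := by
    obtain ⟨n, hn, hnx⟩ := hσ.exists_period hx
    exact ⟨n - 1, Or.inr (by rw [show n - 1 + 1 = n by omega, hnx])⟩
  obtain ⟨d, hd, hmin⟩ : ∃ d, (σ^[d + 1] x ∈ H ∨ σ^[d + 1] x = x) ∧
      ∀ m < d, ¬ (σ^[m + 1] x ∈ H ∨ σ^[m + 1] x = x) :=
    ⟨Nat.find hP, Nat.find_spec hP, fun m hm => Nat.find_min hP hm⟩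
  have hlow : ∀ j, 0 < j → j < d + 1 → σ^[j] x ∉ H ∧ σ^[j] x ≠ x := by
    intro j h0 hj
    have := hmin (j - 1) (by omega)
    rw [show j - 1 + 1 = j by omega] at this
    exact not_or.1 this
  refine ⟨d + 1, hlow, Nat.succ_pos _, hd, fun u => ⟨fun h => ?_, ?_⟩, ?_⟩
  · induction h with
    | refl => exact ⟨0, Nat.succ_pos _, rfl⟩
    | @tail a b _ hab ih =>
      obtain ⟨j, hj, rfl⟩ := ih
      have hb : b = σ^[j + 1] x := by rw [hab.1, Function.iterate_succ_apply']
      rcases Nat.lt_or_ge (j + 1) (d + 1) with h | h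
      · exact ⟨j + 1, h, hb⟩
      · have hjd : j = d := by omega
        subst hjd
        rcases hd with hd | hd
        · exact absurd (hb ▸ hd) hab.2
        · exact ⟨0, Nat.succ_pos _, hb.trans hd⟩
  · rintro ⟨j, hj, rfl⟩
    exact Seg.iterate j fun i h0 hi => (hlow i h0 (by omega)).1
  · have key : ∀ a b, a < b → b < d + 1 → σ^[a] x ≠ σ^[b] x := by
      intro a b hab hb he
      refine (hlow (b - a) (by omega) (by omega)).2 ?_
      refine (hσ.iterate_cancel hx (hσ.iterate_mem hx (b - a)) a ?_).symm
      rw [he, ← Function.iterate_add_apply, show a + (b - a) = b by omega]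
    intro a ha b hb hab
    simp only [Finset.coe_range, Set.mem_Iio] at ha hb
    rcases Nat.lt_trichotomy a b with h | h | h
    · exact absurd hab (key a b h hb)
    · exact h
    · exact absurd hab.symm (key b a h ha)

open Classical in
set_option maxHeartbeats 1000000 in
theorem walk_spec {E M o x : ℕ} {G H : Finset ℕ} {σ : ℕ → ℕ} {s₀ : State D}
    (hc : Consts E M s₀) (hN : 4 * M ≤ N) (ho : o + 2 * E ≤ M)
    (hσ : PermOn G σ) (hG : ∀ u ∈ G, u < E) (hx : x ∈ G) (h10 : s₀.reg 10 = o + x)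
    (hnxt : ∀ u ∈ G, s₀.mem (o + u) = o + σ u)
    (hreal : ∀ u ∈ G, s₀.mem (o + E + u + 2 * M) < N)
    (hH : ∀ u ∈ G, s₀.mem (o + E + u + 2 * M) ≠ 0 ↔ u ∈ H)
    (hflag : ∀ u ∈ G, s₀.mem (o + u + 3 * M) < N) :
    Halts N ω f walk s₀ (Walked N E M o G H σ x s₀) := by
  obtain ⟨K, hlow, hK0, hK, hseg, hinj⟩ := exists_chunk_length (H := H) hσ hx
  have hxE := hG x hx
  have hgG : ∀ j, σ^[j] x ∈ G := hσ.iterate_mem hx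
  have hgE : ∀ j, σ^[j] x < E := fun j => hG _ (hgG j)
  have hfil : G.filter (Seg H σ x) = (Finset.range K).image fun j => σ^[j] x := by
    ext u
    simp only [Finset.mem_filter, hseg, Finset.mem_image, Finset.mem_range]
    constructor
    · rintro ⟨-, j, hj, rfl⟩; exact ⟨j, hj, rfl⟩
    · rintro ⟨j, hj, rfl⟩; exact ⟨hgG j, j, hj, rfl⟩
  have hcard : (G.filter (Seg H σ x)).card = K := by
    rw [hfil, Finset.card_image_of_injOn hinj, Finset.card_range]
  have e3 := hc.r3
  have e6 := hc.r6
  have e7 := hc.r7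
  have m1 : (o + x + E) % N = o + x + E := Nat.mod_eq_of_lt (by omega)
  have m2 : (o + x) % N = o + x := Nat.mod_eq_of_lt (by omega)
  have m3 : 1 % N = 1 := Nat.mod_eq_of_lt (by omega)
  unfold walk
  simp only [seqs, halts_seq, halts_instr, Instr.run, State.put, State.tick,
    Function.update_apply, e3, e7, h10, Nat.reduceEqDiff, reduceIte, m1, m2, m3, add_zero,
    Nat.zero_mod]
  apply halts_loop fun m s => ∃ k, m + k = K ∧ WalkInv N E M o x (fun j => σ^[j] x) s₀ k s ∧
    (s.reg 14 ≠ 0 ↔ k < K)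
  · rintro m s ⟨k, hmk, hinv, hgo⟩ h14
    have hkK := hgo.1 h14
    refine ⟨m - 1, by omega, (walkBody_spec (g := fun j => σ^[j] x) hc hN ho hxE h10 hgE ?_
      (hreal _ (hgG (k + 1))) (hflag _ (hgG k)) hinv).mono ?_⟩
    · simp only [Function.iterate_succ_apply']
      exact hnxt _ (hgG k)
    · rintro t ⟨hinv', hgo'⟩
      refine ⟨k + 1, by omega, hinv', ?_⟩
      rw [hgo', ← not_ne_iff, hH _ (hgG (k + 1))]
      constructor
      · rintro ⟨h1, h2⟩
        by_contra hcon
        have : k + 1 = K := by omega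
        rw [this] at h1 h2
        exact hK.elim h1 h2
      · intro hlt
        exact hlow (k + 1) (Nat.succ_pos _) hlt
  · rintro m s ⟨k, hmk, hinv, hgo⟩ h14
    have hkK : k = K := by
      by_contra hne
      exact (hgo.2 (by omega)) h14
    subst hkK
    have hkE := hgE k
    have k3 : s.reg 3 = E := by rw [hinv.keep 3 (by omega), e3]
    have k6 : s.reg 6 = 3 * M := by rw [hinv.keep 6 (by omega), e6]
    have k11 := hinv.r11
    have k12 : s.reg 12 = o + σ^[k] x := hinv.r12
    have n1 : (o + σ^[k] x + E) % N = o + σ^[k] x + E := Nat.mod_eq_of_lt (by omega)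
    have n2 : (o + E + x + 3 * M) % N = o + E + x + 3 * M := Nat.mod_eq_of_lt (by omega)
    simp only [State.tick, k3, k6, k11, k12, n1, n2]
    obtain ⟨d, rfl⟩ : ∃ d, k = d + 1 := ⟨k - 1, by omega⟩
    have hsu : σ^[d + 1] x = σ (σ^[d] x) := Function.iterate_succ_apply' ..
    have hst := hinv.steps
    have hag := hinv.aggs
    refine ⟨⟨σ^[d] x, (hseg _).2 ⟨d, by omega, rfl⟩, ?_, ?_⟩, ?_, ?_, ?_, ?_, ?_, ?_, hinv.drawn,
      hinv.mods, ?_, ?_⟩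
    · simp only [Function.update_apply]
      rw [if_neg (by omega), if_pos trivial, hsu]
      omega
    · rw [← hsu]; exact hK
    · intro u hu
      obtain ⟨j, hj, rfl⟩ := (hseg u).1 hu
      have := hgE j
      simp only [Function.update_apply]
      rw [if_neg (by omega), if_neg (by omega), hinv.mem, if_pos ⟨j, hj, rfl⟩]
    · simp only [Function.update_apply, reduceIte]
      exact hinv.r13
    · rw [hfil, Finset.prod_image hinj, ← hinv.acc]
      simp only [aggAt, Function.update_apply, reduceIte]
    · intro a h1 h2 h3
      simp only [Function.update_apply, if_neg h1, if_neg h2]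
      rw [hinv.mem, if_neg]
      rintro ⟨j, hj, ha⟩
      exact h3 _ ((hseg _).2 ⟨j, hj, rfl⟩) ha
    · exact hinv.val
    · intro r hr
      have h15 : r ≠ 15 := by omega
      simp only [Function.update_apply, if_neg h15]
      exact hinv.keep r hr
    · rw [hcard]; simp only; omega
    · rw [hcard]; exact hag
  · refine ⟨0, by omega, ⟨?_, ?_, ?_, ?_, ?_, ?_, ?_, rfl, rfl, ?_, ?_⟩, ?_⟩
    · simp only [Function.update_apply, Nat.reduceEqDiff, reduceIte]; omega
    · simp only [Function.update_apply, Nat.reduceEqDiff, reduceIte]; rfl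
    · intro r hr
      have h11 : r ≠ 11 := by omega
      have h12 : r ≠ 12 := by omega
      have h13 : r ≠ 13 := by omega
      have h14 : r ≠ 14 := by omega
      simp only [Function.update_apply, if_neg h11, if_neg h12, if_neg h13, if_neg h14]
    · intro a; simp
    · intro a _; rfl
    · simp
    · simp only [Function.update_apply, Nat.reduceEqDiff, reduceIte]; omega
    · simp only; omega
    · simp
    · simpa using hK0

end WalkSpec

/-! ### The hierarchy in memory -/

/-- The memory contains the hierarchy `sc, hd, A`. The node of the element `u` on level `i` has the
number `i * E + u`; with `M = (L + 2) * E`, its successor is stored at this address, and its parent,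
a word that is nonzero if the node is present, and a word that is nonzero if the node has a value
are stored at the offsets `M`, `2 * M` and `3 * M` from it. -/
structure Rep {D : Type u} [CommSemigroup D] (N E L : ℕ) (H : ℕ → Finset ℕ) (sc hd : ℕ → ℕ → ℕ)
    (A : ℕ → ℕ → WithOne D) (mem : ℕ → ℕ) (val : ℕ → D) : Prop where
  nxt : ∀ i, ∀ u ∈ H i, mem (i * E + u) = i * E + sc i u
  par : ∀ i, ∀ u ∈ H i, mem (i * E + u + (L + 2) * E) = (i + 1) * E + hd i u
  real : ∀ i ≤ L + 1, ∀ u < E, mem (i * E + u + 2 * ((L + 2) * E)) < N ∧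
    (mem (i * E + u + 2 * ((L + 2) * E)) ≠ 0 ↔ u ∈ H i)
  flag : ∀ i ≤ L + 1, ∀ u < E, mem (i * E + u + 3 * ((L + 2) * E)) < N
  agg : ∀ i ≤ L + 1, ∀ u < E, A i u = aggAt ((L + 2) * E) mem val (i * E + u)

theorem node_inj {E i j u v : ℕ} (hu : u < E) (hv : v < E) (h : i * E + u = j * E + v) :
    i = j ∧ u = v := by
  have h1 : (i * E + u) / E = i := by
    rw [mul_comm, Nat.mul_add_div (by omega), Nat.div_eq_of_lt hu, add_zero]
  have h2 : (j * E + v) / E = j := by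
    rw [mul_comm, Nat.mul_add_div (by omega), Nat.div_eq_of_lt hv, add_zero]
  have hij : i = j := by rw [← h1, h, h2]
  subst hij
  exact ⟨rfl, by omega⟩

theorem node_lt {E L i u : ℕ} (hi : i ≤ L + 1) (hu : u < E) : i * E + u < (L + 2) * E := by
  have : (i + 1) * E ≤ (L + 2) * E := Nat.mul_le_mul_right E (by omega)
  rw [Nat.add_mul] at this
  omega

open Classical in
/-- The hierarchy `sc', hd', A'` arises from `sc, hd, A` by rebuilding, one after the other, the
chunks on level `i` that start at the elements of the list `l`. -/
structure Walks {M : Type u} [CommMonoid M] (H : ℕ → Finset ℕ) (sc hd : ℕ → ℕ → ℕ)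
    (A : ℕ → ℕ → M) (sc' hd' : ℕ → ℕ → ℕ) (A' : ℕ → ℕ → M) (i : ℕ) (l : List ℕ) : Prop where
  s_other : ∀ j, j ≠ i + 1 → sc' j = sc j
  hd_other : ∀ j, j ≠ i → hd' j = hd j
  A_other : ∀ j, j ≠ i + 1 → A' j = A j
  hd_eq : ∀ u, hd' i u =
    l.foldl (fun r x => if Seg (H (i + 1)) (sc i) x u then x else r) (hd i u)
  exit : ∀ x ∈ l,
    ∃ w, Seg (H (i + 1)) (sc i) x w ∧ sc' (i + 1) x = sc i w ∧ (sc i w ∈ H (i + 1) ∨ sc i w = x)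
  s_keep : ∀ x, x ∉ l → sc' (i + 1) x = sc (i + 1) x
  A_start : ∀ x ∈ l, A' (i + 1) x = ∏ u ∈ H i with Seg (H (i + 1)) (sc i) x u, A i u
  A_keep : ∀ x, x ∉ l → A' (i + 1) x = A (i + 1) x

namespace Walks

variable {M : Type u} [CommMonoid M] {H : ℕ → Finset ℕ} {sc hd sc' hd' sc'' hd'' : ℕ → ℕ → ℕ}
  {A A' A'' : ℕ → ℕ → M} {i p q y₁ y₂ : ℕ} {l l' : List ℕ}

theorem append (h : Walks H sc hd A sc' hd' A' i l) (h' : Walks H sc' hd' A' sc'' hd'' A'' i l') :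
    Walks H sc hd A sc'' hd'' A'' i (l ++ l') := by
  have hs : sc' i = sc i := h.s_other i (by omega)
  have hA : A' i = A i := h.A_other i (by omega)
  refine ⟨fun j hj => (h'.s_other j hj).trans (h.s_other j hj),
    fun j hj => (h'.hd_other j hj).trans (h.hd_other j hj),
    fun j hj => (h'.A_other j hj).trans (h.A_other j hj), fun u => ?_, fun x hx => ?_, fun x hx => ?_,
    fun x hx => ?_, fun x hx => ?_⟩
  · rw [h'.hd_eq, h.hd_eq, hs, List.foldl_append]
  · by_cases hx' : x ∈ l'
    · have := h'.exit x hx'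
      rwa [hs] at this
    · rw [h'.s_keep x hx']
      exact h.exit x ((List.mem_append.1 hx).resolve_right hx')
  · rw [List.mem_append, not_or] at hx
    rw [h'.s_keep x hx.2, h.s_keep x hx.1]
  · by_cases hx' : x ∈ l'
    · have := h'.A_start x hx'
      rwa [hs, hA] at this
    · rw [h'.A_keep x hx']
      exact h.A_start x ((List.mem_append.1 hx).resolve_right hx')
  · rw [List.mem_append, not_or] at hx
    rw [h'.A_keep x hx.2, h.A_keep x hx.1]

theorem rewalk (h : Walks H sc hd A sc' hd' A' i [p, q, y₁, y₂]) :
    Rewalk H sc hd A sc' hd' A' i p q y₁ y₂ := by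
  have hl : ∀ x, Rebuild.Start p q y₁ y₂ x ↔ x ∈ [p, q, y₁, y₂] := by simp [Rebuild.Start]
  refine ⟨h.s_other, h.hd_other, h.A_other, fun u _ => ?_, fun x hx => h.exit x ((hl x).1 hx),
    fun x hx => h.s_keep x fun hx' => hx ((hl x).2 hx'), fun x hx => h.A_start x ((hl x).1 hx),
    fun x hx => h.A_keep x fun hx' => hx ((hl x).2 hx')⟩
  rw [h.hd_eq]
  rfl

theorem rewalk_self (h : Walks H sc hd A sc' hd' A' i [p, q]) :
    Rewalk H sc hd A sc' hd' A' i p q p q := by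
  have hl : ∀ x, Rebuild.Start p q p q x ↔ x ∈ [p, q] := by
    intro x; simp [Rebuild.Start]; tauto
  refine ⟨h.s_other, h.hd_other, h.A_other, fun u _ => ?_, fun x hx => h.exit x ((hl x).1 hx),
    fun x hx => h.s_keep x fun hx' => hx ((hl x).2 hx'), fun x hx => h.A_start x ((hl x).1 hx),
    fun x hx => h.A_keep x fun hx' => hx ((hl x).2 hx')⟩
  rw [h.hd_eq]
  simp only [List.foldl, rehead]
  split_ifs <;> rfl

end Walks

section Splice

variable {D : Type u} [CommSemigroup D] {N : ℕ} {ω : Tape} {f : D → D} {E L : ℕ}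
  {H : ℕ → Finset ℕ} {sc hd : ℕ → ℕ → ℕ} {A : ℕ → ℕ → WithOne D}

/-- Rebuild the chunk of the node in register `r`. -/
def walkAt (r : ℕ) : Cmd := .seq (instr (add 10 r 7)) walk

open Classical in
theorem walkAt_spec (hN : 4 * ((L + 2) * E) ≤ N) (hH : ∀ i, ∀ u ∈ H i, u < E ∧ i ≤ L)
    {r i x : ℕ} {st : State D} (hc : Consts E ((L + 2) * E) st)
    (h : Rep N E L H sc hd A st.mem st.val) (hp : PermOn (H i) (sc i)) (hx : x ∈ H i)
    (hrx : st.reg r = i * E + x) :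
    Halts N ω f (walkAt r) st fun t => ∃ sc' hd' A',
      Walks H sc hd A sc' hd' A' i [x] ∧ Rep N E L H sc' hd' A' t.mem t.val ∧
      Consts E ((L + 2) * E) t ∧ (∀ r, r < 10 ∨ 17 ≤ r → t.reg r = st.reg r) ∧
      t.drawn = st.drawn ∧ t.modifications = st.modifications ∧
      t.steps ≤ st.steps + 20 * ((H i).filter (Seg (H (i + 1)) (sc i) x)).card + 10 ∧
      t.aggregations ≤ st.aggregations + ((H i).filter (Seg (H (i + 1)) (sc i) x)).card := by
  obtain ⟨hxE, hiL⟩ := hH i x hx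
  set M := (L + 2) * E with hM
  have hxM : i * E + x < M := node_lt (by omega) hxE
  have hiE : (i + 1) * E = i * E + E := by ring
  have hoM : i * E + 2 * E ≤ M := by
    have : (i + 2) * E ≤ (L + 2) * E := Nat.mul_le_mul_right E (by omega)
    rw [Nat.add_mul] at this
    omega
  have m1 : (i * E + x) % N = i * E + x := Nat.mod_eq_of_lt (by omega)
  unfold walkAt
  simp only [halts_seq, halts_instr, Instr.run, State.put, State.tick, hrx, hc.r7, add_zero, m1]
  have hc' : Consts E M
      { st with reg := Function.update st.reg 10 (i * E + x), steps := st.steps + 1 } := by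
    refine ⟨?_, ?_, ?_, ?_, ?_⟩ <;> simp only [Function.update_apply, Nat.reduceEqDiff, reduceIte]
    exacts [hc.r3, hc.r4, hc.r5, hc.r6, hc.r7]
  refine (walk_spec (G := H i) (H := H (i + 1)) (σ := sc i) (o := i * E) (x := x) hc' hN hoM hp
    (fun u hu => (hH i u hu).1) hx (by simp) (h.nxt i) ?_ ?_ ?_).mono ?_
  · intro u hu
    have := (h.real (i + 1) (by omega) u (hH i u hu).1).1
    rwa [hiE] at this
  · intro u hu
    have := (h.real (i + 1) (by omega) u (hH i u hu).1).2
    rwa [hiE] at this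
  · intro u hu
    exact h.flag i (by omega) u (hH i u hu).1
  intro t ht
  obtain ⟨w, hw, hmw, hwx⟩ := ht.exit
  have hmem := ht.mem
  have hagg := ht.agg
  have hflag := ht.flag
  have hval := ht.val
  have hpar := ht.par
  simp only at hmem hagg hval
  rw [← hiE] at hmem hagg hval hmw hflag
  simp only [← hiE] at hpar
  have hxM' : (i + 1) * E + x < M := node_lt (by omega) hxE
  have hsegE : ∀ u, Seg (H (i + 1)) (sc i) x u → u ∈ H i := fun u hu => hu.mem hp hx
  have hsegM : ∀ u, Seg (H (i + 1)) (sc i) x u → i * E + u < M := fun u hu =>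
    node_lt (by omega) (hH i u (hsegE u hu)).1
  have keep : ∀ r, r < 10 ∨ 17 ≤ r → t.reg r = st.reg r := by
    intro r hr
    rw [ht.keep r (by omega)]
    exact Function.update_of_ne (by omega) _ _
  have hmem2 : ∀ a, a < M → a ≠ (i + 1) * E + x → t.mem a = st.mem a := fun a ha hne =>
    hmem a hne (by omega) fun u _ => by omega
  have hmem3 : ∀ a, a < M → (∀ u, Seg (H (i + 1)) (sc i) x u → a ≠ i * E + u) →
      t.mem (a + M) = st.mem (a + M) := fun a ha hne =>
    hmem _ (by omega) (by omega) fun u hu => by have := hne u hu; omega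
  have hmem4 : ∀ a, a < M → t.mem (a + 2 * M) = st.mem (a + 2 * M) := fun a ha =>
    hmem _ (by omega) (by omega) fun u hu => by have := hsegM u hu; omega
  have hmem5 : ∀ a, a < M → a ≠ (i + 1) * E + x → t.mem (a + 3 * M) = st.mem (a + 3 * M) :=
    fun a ha hne => hmem _ (by omega) (by omega) fun u hu => by have := hsegM u hu; omega
  refine ⟨Function.update sc (i + 1) (Function.update (sc (i + 1)) x (sc i w)),
    Function.update hd i fun u => if Seg (H (i + 1)) (sc i) x u then x else hd i u,
    Function.update A (i + 1) (Function.update (A (i + 1)) x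
      (∏ u ∈ H i with Seg (H (i + 1)) (sc i) x u, A i u)), ?_, ?_, ?_, keep, ht.drawn, ht.mods, ?_,
      ht.aggs⟩
  · refine ⟨fun j hj => Function.update_of_ne hj _ _, fun j hj => Function.update_of_ne hj _ _,
      fun j hj => Function.update_of_ne hj _ _, fun u => ?_, ?_, ?_, ?_, ?_⟩
    · simp
    · simp only [List.mem_singleton, forall_eq, Function.update_self]
      exact ⟨w, hw, rfl, hwx⟩
    · intro y hy
      simp only [List.mem_singleton] at hy
      simp [hy]
    · simp only [List.mem_singleton, forall_eq, Function.update_self]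
    · intro y hy
      simp only [List.mem_singleton] at hy
      simp [hy]
  · refine ⟨fun j u hu => ?_, fun j u hu => ?_, fun j hj u hu => ?_, fun j hj u hu => ?_,
      fun j hj u hu => ?_⟩
    · obtain ⟨huE, hjL⟩ := hH j u hu
      have hlt : j * E + u < M := node_lt (by omega) huE
      by_cases he : j * E + u = (i + 1) * E + x
      · obtain ⟨rfl, rfl⟩ := node_inj huE hxE he
        rw [Function.update_self, Function.update_self, hmw]
      · rw [hmem2 _ hlt he, h.nxt j u hu]
        congr 1
        by_cases hji : j = i + 1
        · subst hji
          rw [Function.update_self, Function.update_of_ne]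
          rintro rfl
          exact he rfl
        · rw [Function.update_of_ne hji]
    · obtain ⟨huE, hjL⟩ := hH j u hu
      have hlt : j * E + u < M := node_lt (by omega) huE
      by_cases hji : j = i
      · subst hji
        rw [Function.update_self]
        split_ifs with hs
        · exact hpar u hs
        · rw [hmem3 _ hlt, h.par j u hu]
          intro v hv he
          obtain rfl : u = v := by omega
          exact hs hv
      · rw [Function.update_of_ne hji, hmem3 _ hlt, h.par j u hu]
        intro v hv he
        exact hji (node_inj huE (hH i v (hsegE v hv)).1 he).1
    · rw [hmem4 _ (node_lt hj hu)]
      exact h.real j hj u hu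
    · by_cases he : j * E + u = (i + 1) * E + x
      · rw [he]; exact hflag
      · rw [hmem5 _ (node_lt hj hu) he]
        exact h.flag j hj u hu
    · by_cases he : j * E + u = (i + 1) * E + x
      · obtain ⟨rfl, rfl⟩ := node_inj hu hxE he
        rw [Function.update_self, Function.update_self, hagg]
        refine Finset.prod_congr rfl fun v hv => ?_
        exact h.agg i (by omega) v (hH i v (Finset.mem_filter.1 hv).1).1
      · have : Function.update A (i + 1) (Function.update (A (i + 1)) x
            (∏ u ∈ H i with Seg (H (i + 1)) (sc i) x u, A i u)) j u = A j u := by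
          by_cases hji : j = i + 1
          · subst hji
            rw [Function.update_self, Function.update_of_ne]
            rintro rfl
            exact he rfl
          · rw [Function.update_of_ne hji]
        rw [this, h.agg j hj u hu, aggAt, aggAt, hmem5 _ (node_lt hj hu) he, hval _ he]
  · refine ⟨?_, ?_, ?_, ?_, ?_⟩ <;> rw [keep _ (by omega)]
    exacts [hc.r3, hc.r4, hc.r5, hc.r6, hc.r7]
  · have := ht.steps
    simp only at this
    omega

end Splice

/-! ### Exchanging two successors -/

/-- Repair one level. Registers: `20`, `21` hold the nodes whose successors have changed. If one of
the heads `23`, `24` of their old chunks is present, then `20`, `21` are replaced by such heads, and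
register `22` is nonzero. -/
def spliceBody : Cmd := seqs [
  seqs [instr (add 25 20 4), instr (load 23 25), instr (add 25 21 4), instr (load 24 25)],
  walkAt 20, walkAt 21,
  seqs [instr (add 25 23 5), instr (load 26 25), instr (add 25 24 5), instr (load 27 25),
    ite 26 skip (instr (add 23 24 7)), ite 27 skip (instr (add 24 23 7)),
    instr (add 25 23 5), instr (load 22 25),
    instr (sub 25 23 3), instr (sub 26 24 3)],
  ite 22 (seqs [walkAt 25, walkAt 26, instr (add 20 23 7), instr (add 21 24 7)]) skip]

/-- Exchange the successors of the elements in registers `20` and `21` and repair the hierarchy. -/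
def splice : Cmd := seqs [
  instr (load 25 20), instr (load 26 21), instr (store 20 26), instr (store 21 25),
  instr (const 22 1), loop 22 spliceBody]

section Splice

variable {D : Type u} [CommSemigroup D] {N : ℕ} {ω : Tape} {f : D → D} {E L : ℕ}
  {H : ℕ → Finset ℕ} {sc hd s₀ hd₀ : ℕ → ℕ → ℕ} {A A₀ : ℕ → ℕ → WithOne D}

open Classical in
/-- The number of elements of level `i` near `a` or `b`. -/
noncomputable def nearCount (E : ℕ) (H : ℕ → Finset ℕ) (σ : ℕ → ℕ) (a b i : ℕ) : ℕ :=
  ((Finset.range E).filter (Near H σ i a)).card + ((Finset.range E).filter (Near H σ i b)).card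

open Classical in
theorem Mid.card_le {M : Type u} [CommMonoid M] {A A₀ : ℕ → ℕ → M} {a b : ℕ} {σ : ℕ → ℕ}
    {X : ℕ → M} {i p q x : ℕ} (hH : ∀ i, ∀ u ∈ H i, u < E ∧ i ≤ L)
    (h : Mid H s₀ hd₀ A₀ a b σ X sc hd A i p q)
    (hx : x = p ∨ x = q ∨ (x ∈ H (i + 1) ∧ (x = hd i p ∨ x = hd i q))) :
    ((H i).filter (Seg (H (i + 1)) (sc i) x)).card ≤ nearCount E H (s₀ 0) a b i := by
  refine le_trans (Finset.card_le_card (t := (Finset.range E).filter (Near H (s₀ 0) i a) ∪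
    (Finset.range E).filter (Near H (s₀ 0) i b)) fun u hu => ?_) (Finset.card_union_le _ _)
  obtain ⟨hu, hs⟩ := Finset.mem_filter.1 hu
  simp only [Finset.mem_union, Finset.mem_filter, Finset.mem_range, (hH i u hu).1, true_and]
  exact h.near hx hs

omit [CommSemigroup D] in
theorem Consts.congr {M : ℕ} {s t : State D} (h : Consts E M s)
    (hr : ∀ r, 3 ≤ r ∧ r < 10 → t.reg r = s.reg r) : Consts E M t := by
  refine ⟨?_, ?_, ?_, ?_, ?_⟩ <;> rw [hr _ (by omega)]
  exacts [h.r3, h.r4, h.r5, h.r6, h.r7]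

/-- The state of `splice` when the levels below `i` have been repaired. -/
structure SpliceInv (N E L : ℕ) (H : ℕ → Finset ℕ) (s₀ hd₀ : ℕ → ℕ → ℕ) (A₀ : ℕ → ℕ → WithOne D)
    (a b : ℕ) (st₀ : State D) (sc hd : ℕ → ℕ → ℕ) (A : ℕ → ℕ → WithOne D) (i : ℕ)
    (st : State D) : Prop where
  rep : Rep N E L H sc hd A st.mem st.val
  consts : Consts E ((L + 2) * E) st
  keep : ∀ r, r < 10 ∨ 28 ≤ r → st.reg r = st₀.reg r
  drawn : st.drawn = st₀.drawn
  mods : st.modifications = st₀.modifications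
  steps : st.steps ≤ st₀.steps + 5 + ∑ j ∈ Finset.range i, (80 * nearCount E H (s₀ 0) a b j + 60)
  aggs : st.aggregations ≤ st₀.aggregations +
    ∑ j ∈ Finset.range i, 4 * nearCount E H (s₀ 0) a b j

/-- Running on, the repair of one level leads to the next level or completes the hierarchy. -/
theorem spliceBody_spec (hN : 4 * ((L + 2) * E) ≤ N) (hH : ∀ i, ∀ u ∈ H i, u < E ∧ i ≤ L)
    {a b i p q : ℕ} {σ : ℕ → ℕ} {X : ℕ → WithOne D} {st₀ st : State D}
    (h : Mid H s₀ hd₀ A₀ a b σ X sc hd A i p q)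
    (hi : SpliceInv N E L H s₀ hd₀ A₀ a b st₀ sc hd A i st)
    (h20 : st.reg 20 = i * E + p) (h21 : st.reg 21 = i * E + q) :
    Halts N ω f spliceBody st.tick fun t => ∃ sc' hd' A',
      SpliceInv N E L H s₀ hd₀ A₀ a b st₀ sc' hd' A' (i + 1) t ∧
      ((t.reg 22 ≠ 0 ∧ ∃ p' q', Mid H s₀ hd₀ A₀ a b σ X sc' hd' A' (i + 1) p' q' ∧
        t.reg 20 = (i + 1) * E + p' ∧ t.reg 21 = (i + 1) * E + q') ∨
      (t.reg 22 = 0 ∧ Hier H sc' hd' A' ∧ (∀ u ∈ H 0, sc' 0 u = σ u) ∧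
        ∀ u ∈ H 0, A' 0 u = X u)) := by
  have hp := hH i p h.hp
  have hq := hH i q h.hq
  have ok := h.old.level i
  have hP : hd i p ∈ H i := by
    rw [h.heads i le_rfl p h.hp]; exact ok.mem p h.hp
  have hQ : hd i q ∈ H i := by
    rw [h.heads i le_rfl q h.hq]; exact ok.mem q h.hq
  have hPE := (hH i _ hP).1
  have hQE := (hH i _ hQ).1
  have np := node_lt (L := L) (i := i) (by omega) hp.1
  have nq := node_lt (L := L) (i := i) (by omega) hq.1
  have nP := node_lt (L := L) (i := i + 1) (by omega) hPE
  have nQ := node_lt (L := L) (i := i + 1) (by omega) hQE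
  have nP' := node_lt (L := L) (i := i) (by omega) hPE
  have nQ' := node_lt (L := L) (i := i) (by omega) hQE
  have lp := hi.rep.par i p h.hp
  have lq := hi.rep.par i q h.hq
  have c3 := hi.consts.r3
  have c4 := hi.consts.r4
  have c5 := hi.consts.r5
  have c6 := hi.consts.r6
  have c7 := hi.consts.r7
  have hiE : (i + 1) * E = i * E + E := by ring
  have card1 := h.card_le hH (x := p) (Or.inl rfl)
  have card2 := h.card_le hH (x := q) (Or.inr (Or.inl rfl))
  set n := nearCount E H (s₀ 0) a b i with hn
  set M := (L + 2) * E with hM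
  unfold spliceBody
  rw [halts_seqs_cons]
  -- Read off the old heads.
  have m1 : (i * E + p + M) % N = i * E + p + M := Nat.mod_eq_of_lt (by omega)
  have m2 : (i * E + q + M) % N = i * E + q + M := Nat.mod_eq_of_lt (by omega)
  have m3 : ((i + 1) * E + hd i p) % N = (i + 1) * E + hd i p := Nat.mod_eq_of_lt (by omega)
  have m4 : ((i + 1) * E + hd i q) % N = (i + 1) * E + hd i q := Nat.mod_eq_of_lt (by omega)
  have b1 : Halts N ω f
      (seqs [instr (add 25 20 4), instr (load 23 25), instr (add 25 21 4), instr (load 24 25)])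
      st.tick fun t => t.mem = st.mem ∧ t.val = st.val ∧ t.drawn = st.drawn ∧
        t.modifications = st.modifications ∧ t.aggregations = st.aggregations ∧
        t.steps = st.steps + 5 ∧ t.reg 23 = (i + 1) * E + hd i p ∧
        t.reg 24 = (i + 1) * E + hd i q ∧
        ∀ r, r ≠ 23 → r ≠ 24 → r ≠ 25 → t.reg r = st.reg r := by
    simp only [seqs, halts_seq, halts_instr, Instr.run, State.put, State.tick,
      Function.update_apply, h20, h21, c4, Nat.reduceEqDiff, reduceIte, m1, m2, lp, lq, m3, m4,
      true_and]
    intro r h1 h2 h3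
    simp [h1, h2, h3]
  refine b1.mono ?_
  rintro t₁ ⟨e1, e2, e3, e4, e5, e6, h23, h24, e7⟩
  have r₁ : Rep N E L H sc hd A t₁.mem t₁.val := by rw [e1, e2]; exact hi.rep
  have c₁ : Consts E M t₁ := hi.consts.congr fun r hr => e7 r (by omega) (by omega) (by omega)
  rw [halts_seqs_cons]
  refine (walkAt_spec hN hH (r := 20) c₁ r₁ h.perm h.hp
    (by rw [e7 _ (by omega) (by omega) (by omega), h20])).mono ?_
  rintro t₂ ⟨sc₂, hd₂, A₂, w₂, r₂, c₂, k₂, d₂, mo₂, st₂, ag₂⟩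
  have hs₂ : sc₂ i = sc i := w₂.s_other i (by omega)
  rw [halts_seqs_cons]
  refine (walkAt_spec hN hH (r := 21) c₂ r₂ (hs₂ ▸ h.perm) h.hq (by
    rw [k₂ _ (by omega), e7 _ (by omega) (by omega) (by omega), h21])).mono ?_
  rintro t₃ ⟨sc₃, hd₃, A₃, w₃, r₃, c₃, k₃, d₃, mo₃, st₃, ag₃⟩
  rw [hs₂] at st₃ ag₃
  have w₃' := w₂.append w₃
  have hs₃ : sc₃ i = sc i := w₃'.s_other i (by omega)
  have g23 : t₃.reg 23 = (i + 1) * E + hd i p := by rw [k₃ _ (by omega), k₂ _ (by omega), h23]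
  have g24 : t₃.reg 24 = (i + 1) * E + hd i q := by rw [k₃ _ (by omega), k₂ _ (by omega), h24]
  have realP := r₃.real (i + 1) (by omega) _ hPE
  have realQ := r₃.real (i + 1) (by omega) _ hQE
  rw [← hM] at realP realQ c₃
  rw [halts_seqs_cons]
  -- Replace an absent head by the other one.
  have b2 : ∃ y₁ y₂ : ℕ, (y₁ = hd i p ∨ y₁ = hd i q) ∧ (y₂ = hd i p ∨ y₂ = hd i q) ∧
      ((y₁ ∈ H (i + 1) ∧ y₂ ∈ H (i + 1) ∧
        ∀ v, v = p ∨ v = q → hd i v ∈ H (i + 1) → hd i v = y₁ ∨ hd i v = y₂) ∨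
      (y₁ ∉ H (i + 1) ∧ hd i p ∉ H (i + 1) ∧ hd i q ∉ H (i + 1))) ∧ Halts N ω f
      (seqs [instr (add 25 23 5), instr (load 26 25), instr (add 25 24 5), instr (load 27 25),
        ite 26 skip (instr (add 23 24 7)), ite 27 skip (instr (add 24 23 7)),
        instr (add 25 23 5), instr (load 22 25),
        instr (sub 25 23 3), instr (sub 26 24 3)])
      t₃ fun t => t.mem = t₃.mem ∧ t.val = t₃.val ∧ t.drawn = t₃.drawn ∧
        t.modifications = t₃.modifications ∧ t.aggregations = t₃.aggregations ∧
        t.steps ≤ t₃.steps + 12 ∧ t.reg 23 = (i + 1) * E + y₁ ∧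
        t.reg 24 = (i + 1) * E + y₂ ∧ t.reg 25 = i * E + y₁ ∧ t.reg 26 = i * E + y₂ ∧
        (t.reg 22 ≠ 0 ↔ y₁ ∈ H (i + 1)) ∧
        ∀ r, r < 20 ∨ 28 ≤ r → t.reg r = t₃.reg r := by
    have m5 : ((i + 1) * E + hd i p + 2 * M) % N = (i + 1) * E + hd i p + 2 * M :=
      Nat.mod_eq_of_lt (by omega)
    have m6 : ((i + 1) * E + hd i q + 2 * M) % N = (i + 1) * E + hd i q + 2 * M :=
      Nat.mod_eq_of_lt (by omega)
    have m7 := Nat.mod_eq_of_lt realP.1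
    have m8 := Nat.mod_eq_of_lt realQ.1
    have sP : ((i + 1) * E + hd i p - E) % N = i * E + hd i p := by
      rw [Nat.mod_eq_of_lt (by omega)]; omega
    have sQ : ((i + 1) * E + hd i q - E) % N = i * E + hd i q := by
      rw [Nat.mod_eq_of_lt (by omega)]; omega
    by_cases zP : hd i p ∈ H (i + 1) <;> by_cases zQ : hd i q ∈ H (i + 1)
    · have z1 := realP.2.2 zP
      have z2 := realQ.2.2 zQ
      refine ⟨hd i p, hd i q, by simp, by simp, Or.inl ⟨zP, zQ, ?_⟩, ?_⟩
      · rintro v (rfl | rfl) _ <;> simp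
      simp only [seqs, halts_seq, halts_instr, halts_ite, halts_skip, Instr.run, State.put,
        State.tick, Function.update_apply, g23, g24, c₃.r3, c₃.r5, c₃.r7, Nat.reduceEqDiff,
        reduceIte, m5, m6, m7, m8, z1, z2, sP, sQ, zP, true_and, ne_eq, not_false_eq_true]
      refine ⟨by omega, fun r hr => ?_⟩
      simp (disch := omega) only [if_neg]
    · have z1 := realP.2.2 zP
      have z2 := not_ne_iff.1 (mt realQ.2.1 zQ)
      refine ⟨hd i p, hd i p, by simp, by simp, Or.inl ⟨zP, zP, ?_⟩, ?_⟩
      · rintro v (rfl | rfl) hv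
        · simp
        · exact absurd hv zQ
      simp only [seqs, halts_seq, halts_instr, halts_ite, halts_skip, Instr.run, State.put,
        State.tick, Function.update_apply, g23, g24, c₃.r3, c₃.r5, c₃.r7, Nat.reduceEqDiff,
        reduceIte, m3, m5, m6, m7, z1, z2, sP, sQ, zP, true_and, ne_eq, not_false_eq_true,
        add_zero, Nat.zero_mod]
      refine ⟨by omega, fun r hr => ?_⟩
      simp (disch := omega) only [if_neg]
    · have z1 := not_ne_iff.1 (mt realP.2.1 zP)
      have z2 := realQ.2.2 zQ
      refine ⟨hd i q, hd i q, by simp, by simp, Or.inl ⟨zQ, zQ, ?_⟩, ?_⟩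
      · rintro v (rfl | rfl) hv
        · exact absurd hv zP
        · simp
      simp only [seqs, halts_seq, halts_instr, halts_ite, halts_skip, Instr.run, State.put,
        State.tick, Function.update_apply, g23, g24, c₃.r3, c₃.r5, c₃.r7, Nat.reduceEqDiff,
        reduceIte, m4, m5, m6, m8, z1, z2, sP, sQ, zQ, true_and, ne_eq, not_false_eq_true,
        add_zero, Nat.zero_mod]
      refine ⟨by omega, fun r hr => ?_⟩
      simp (disch := omega) only [if_neg]
    · have z1 := not_ne_iff.1 (mt realP.2.1 zP)
      have z2 := not_ne_iff.1 (mt realQ.2.1 zQ)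
      refine ⟨hd i q, hd i q, by simp, by simp, Or.inr ⟨zQ, zP, zQ⟩, ?_⟩
      simp only [seqs, halts_seq, halts_instr, halts_ite, halts_skip, Instr.run, State.put,
        State.tick, Function.update_apply, g23, g24, c₃.r3, c₃.r5, c₃.r7, Nat.reduceEqDiff,
        reduceIte, m4, m5, m6, z1, z2, sP, sQ, zQ, true_and, ne_eq, not_true_eq_false,
        add_zero, Nat.zero_mod]
      refine ⟨by omega, fun r hr => ?_⟩
      simp (disch := omega) only [if_neg]
  obtain ⟨y₁, y₂, hy₁, hy₂, hcase, b2⟩ := b2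
  refine b2.mono ?_
  rintro t₄ ⟨f1, f2, f3, f4, f5, f6, f23, f24, f25, f26, f22, f7⟩
  have r₄ : Rep N E L H sc₃ hd₃ A₃ t₄.mem t₄.val := by rw [f1, f2]; exact r₃
  have c₄ : Consts E M t₄ := c₃.congr fun r hr => f7 r (by omega)
  have keep₄ : ∀ r, r < 10 ∨ 28 ≤ r → t₄.reg r = st₀.reg r := by
    intro r hr
    rw [f7 r (by omega), k₃ r (by omega), k₂ r (by omega), e7 r (by omega) (by omega) (by omega),
      hi.keep r hr]
  have ss := hi.steps
  have sa := hi.aggs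
  rw [halts_seqs_singleton, halts_ite]
  have sum1 : ∑ j ∈ Finset.range (i + 1), (80 * nearCount E H (s₀ 0) a b j + 60) =
    ∑ j ∈ Finset.range i, (80 * nearCount E H (s₀ 0) a b j + 60) + (80 * n + 60) :=
    Finset.sum_range_succ ..
  have sum2 : ∑ j ∈ Finset.range (i + 1), 4 * nearCount E H (s₀ 0) a b j =
    ∑ j ∈ Finset.range i, 4 * nearCount E H (s₀ 0) a b j + 4 * n :=
    Finset.sum_range_succ ..
  rcases hcase with ⟨hm₁, hm₂, heads⟩ | ⟨hm₁, hn1, hn2⟩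
  · have g22 := f22.2 hm₁
    rw [if_neg g22]
    have card3 := h.card_le hH (x := y₁) (Or.inr (Or.inr ⟨hm₁, hy₁⟩))
    have card4 := h.card_le hH (x := y₂) (Or.inr (Or.inr ⟨hm₂, hy₂⟩))
    have nE₁ := hH _ _ hm₁
    have nE₂ := hH _ _ hm₂
    have n₁ := node_lt (L := L) (i := i + 1) (by omega) nE₁.1
    have n₂ := node_lt (L := L) (i := i + 1) (by omega) nE₂.1
    have hyi₁ := h.old.anti i hm₁
    have hyi₂ := h.old.anti i hm₂
    rw [halts_seqs_cons]
    refine (walkAt_spec hN hH (r := 25) (st := t₄.tick) (c₄.congr fun _ _ => rfl) r₄ (hs₃ ▸ h.perm) hyi₁ f25).mono ?_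
    rintro t₅ ⟨sc₅, hd₅, A₅, w₅, r₅, c₅, k₅, d₅, mo₅, st₅, ag₅⟩
    rw [hs₃] at st₅ ag₅
    have w₅' := w₃'.append w₅
    have hs₅ : sc₅ i = sc i := w₅'.s_other i (by omega)
    rw [halts_seqs_cons]
    refine (walkAt_spec hN hH (r := 26) c₅ r₅ (hs₅ ▸ h.perm) hyi₂
      ((k₅ _ (by omega)).trans f26)).mono ?_
    rintro t₆ ⟨sc₆, hd₆, A₆, w₆, r₆, c₆, k₆, d₆, mo₆, st₆, ag₆⟩
    rw [hs₅] at st₆ ag₆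
    have w₆' := (w₅'.append w₆).rewalk
    have g23 : t₆.reg 23 = (i + 1) * E + y₁ := by
      rw [k₆ _ (by omega), k₅ _ (by omega)]; exact f23
    have g24 : t₆.reg 24 = (i + 1) * E + y₂ := by
      rw [k₆ _ (by omega), k₅ _ (by omega)]; exact f24
    have g22' : t₆.reg 22 ≠ 0 := by
      rw [k₆ _ (by omega), k₅ _ (by omega)]; exact g22
    have m5 : ((i + 1) * E + y₁) % N = (i + 1) * E + y₁ := Nat.mod_eq_of_lt (by omega)
    have m6 : ((i + 1) * E + y₂) % N = (i + 1) * E + y₂ := Nat.mod_eq_of_lt (by omega)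
    simp only [seqs, halts_seq, halts_instr, Instr.run, State.put, State.tick,
      Function.update_apply, g23, g24, c₆.r7, Nat.reduceEqDiff, reduceIte, m5, m6, add_zero]
    refine ⟨sc₆, hd₆, A₆, ⟨r₆, c₆.congr fun r hr => ?_, ?_, ?_, ?_, ?_, ?_⟩,
      Or.inl ⟨g22', y₁, y₂, h.step w₆' heads hm₁ hm₂ hy₁ hy₂, rfl, rfl⟩⟩
    · simp (disch := omega) only [Function.update_apply, if_neg]
    · intro r hr
      have q1 : r ≠ 20 := by omega
      have q2 : r ≠ 21 := by omega
      simp only [Function.update_apply, if_neg q1, if_neg q2]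
      rw [k₆ _ (by omega), k₅ _ (by omega)]
      exact keep₄ r hr
    · have := hi.drawn
      simp only [State.tick] at d₅ ⊢
      omega
    · have := hi.mods
      simp only [State.tick] at mo₅ ⊢
      omega
    · rw [sum1]; simp only [State.tick] at st₅ ⊢; omega
    · rw [sum2]; simp only [State.tick] at ag₅ ⊢; omega
  · have g22 : t₄.reg 22 = 0 := not_ne_iff.1 (mt f22.1 hm₁)
    rw [if_pos g22, halts_skip]
    refine ⟨sc₃, hd₃, A₃, ⟨r₄, c₄.congr fun _ _ => rfl, keep₄, ?_, ?_, ?_, ?_⟩, Or.inr ⟨g22,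
      h.finish w₃'.rewalk_self hn1 hn2⟩⟩
    · have := hi.drawn; simp only [State.tick]; omega
    · have := hi.mods; simp only [State.tick]; omega
    · rw [sum1]; simp only [State.tick]; omega
    · rw [sum2]; simp only [State.tick]; omega

/-- Exchanging two successors and repairing the hierarchy takes time proportional to the number of
elements near the two places. -/
theorem splice_spec (hN : 4 * ((L + 2) * E) ≤ N) (hH : ∀ i, ∀ u ∈ H i, u < E ∧ i ≤ L)
    {a b : ℕ} {st : State D} (ha : a ∈ H 0) (hb : b ∈ H 0) (h : Hier H sc hd A)
    (hr : Rep N E L H sc hd A st.mem st.val) (hc : Consts E ((L + 2) * E) st)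
    (h20 : st.reg 20 = a) (h21 : st.reg 21 = b) :
    Halts N ω f splice st fun t => ∃ sc' hd' A', Hier H sc' hd' A' ∧
      Rep N E L H sc' hd' A' t.mem t.val ∧ (∀ r, r < 10 ∨ 28 ≤ r → t.reg r = st.reg r) ∧
      (∀ u ∈ H 0, sc' 0 u = exchange (sc 0) a b u) ∧ (∀ u ∈ H 0, A' 0 u = A 0 u) ∧
      t.drawn = st.drawn ∧ t.modifications = st.modifications ∧
      t.steps ≤ st.steps + 6 +
        ∑ j ∈ Finset.range (L + 1), (80 * nearCount E H (sc 0) a b j + 60) ∧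
      t.aggregations ≤ st.aggregations +
        ∑ j ∈ Finset.range (L + 1), 4 * nearCount E H (sc 0) a b j := by
  have haE := (hH 0 a ha).1
  have hbE := (hH 0 b hb).1
  have hM : 2 * E ≤ (L + 2) * E := Nat.mul_le_mul_right E (by omega)
  have la : st.mem a = sc 0 a := by simpa using hr.nxt 0 a ha
  have lb : st.mem b = sc 0 b := by simpa using hr.nxt 0 b hb
  have sa := (hH 0 _ (h.perm0.maps a ha)).1
  have sb := (hH 0 _ (h.perm0.maps b hb)).1
  have m1 : sc 0 a % N = sc 0 a := Nat.mod_eq_of_lt (by omega)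
  have m2 : sc 0 b % N = sc 0 b := Nat.mod_eq_of_lt (by omega)
  have m3 : 1 % N = 1 := Nat.mod_eq_of_lt (by omega)
  unfold splice
  simp only [seqs, halts_seq, halts_instr, Instr.run, State.put, State.tick,
    Function.update_apply, h20, h21, la, lb, Nat.reduceEqDiff, reduceIte, m1, m2, m3]
  set σ := exchange (sc 0) a b with hσ
  apply halts_loop fun m t => ∃ sc' hd' A' i, SpliceInv N E L H sc hd A a b st sc' hd' A' i t ∧
    ((t.reg 22 ≠ 0 ∧ m + i = L + 1 ∧ ∃ p q, Mid H sc hd A a b σ (A 0) sc' hd' A' i p q ∧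
      t.reg 20 = i * E + p ∧ t.reg 21 = i * E + q) ∨
    (t.reg 22 = 0 ∧ m = 0 ∧ i ≤ L + 1 ∧ Hier H sc' hd' A' ∧ (∀ u ∈ H 0, sc' 0 u = σ u) ∧
      ∀ u ∈ H 0, A' 0 u = A 0 u))
  · rintro m t ⟨sc', hd', A', i, hi, ⟨-, hm, p, q, hmid, g20, g21⟩ | ⟨h0, -⟩⟩ h22
    · have hiL := (hH i p hmid.hp).2
      by_cases hend : ∃ t', Exec N ω f spliceBody t.tick t' ∧ t'.reg 22 = 0
      · obtain ⟨t', ht', hz⟩ := hend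
        refine ⟨0, by omega, t', ht', ?_⟩
        obtain ⟨t'', ht'', sc'', hd'', A'', hi'', hor⟩ :=
          spliceBody_spec (N := N) (ω := ω) (f := f) hN hH hmid hi g20 g21
        obtain rfl := ht''.unique ht'
        rcases hor with ⟨hnz, -⟩ | ⟨-, hfin⟩
        · exact absurd hz hnz
        · exact ⟨sc'', hd'', A'', i + 1, hi'', Or.inr ⟨hz, rfl, by omega, hfin⟩⟩
      · refine ⟨m - 1, by omega,
          (spliceBody_spec (N := N) (ω := ω) (f := f) hN hH hmid hi g20 g21).imp ?_⟩
        rintro t' ⟨ht', sc'', hd'', A'', hi'', ⟨hnz, hmid'⟩ | ⟨hz, -⟩⟩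
        · exact ⟨ht', sc'', hd'', A'', i + 1, hi'', Or.inl ⟨hnz, by omega, hmid'⟩⟩
        · exact absurd ⟨t', ht', hz⟩ hend
    · exact absurd h0 h22
  · rintro m t ⟨sc', hd', A', i, hi, ⟨hnz, -⟩ | ⟨-, -, hiL, hier, hs, hA⟩⟩ h22
    · exact absurd h22 hnz
    · have hsub : Finset.range i ⊆ Finset.range (L + 1) := Finset.range_mono hiL
      refine ⟨sc', hd', A', hier, hi.rep, hi.keep, hs, hA, hi.drawn, hi.mods, ?_, ?_⟩
      · have h1 := Finset.sum_le_sum_of_subset (f := fun j => 80 * nearCount E H (sc 0) a b j + 60)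
          hsub
        have h2 := hi.steps
        simp only [State.tick] at h1 ⊢
        omega
      · have h1 := Finset.sum_le_sum_of_subset (f := fun j => 4 * nearCount E H (sc 0) a b j) hsub
        have h2 := hi.aggs
        simp only [State.tick] at h1 ⊢
        omega
  · refine ⟨Function.update sc 0 σ, hd, A, 0, ⟨?_, hc.congr fun r hr => ?_, fun r hr => ?_, rfl, rfl,
      ?_, ?_⟩, Or.inl ⟨?_, rfl, a, b, ?_, ?_, ?_⟩⟩
    · have high : ∀ c, E ≤ c →
        Function.update (Function.update st.mem a (sc 0 b)) b (sc 0 a) c = st.mem c := fun c hc => by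
        rw [Function.update_of_ne (by omega), Function.update_of_ne (by omega)]
      change Rep N E L H _ hd A (Function.update (Function.update st.mem a (sc 0 b)) b (sc 0 a))
        st.val
      refine ⟨fun i u hu => ?_, fun i u hu => ?_, fun i hi u hu => ?_, fun i hi u hu => ?_,
        fun i hi u hu => ?_⟩
      · rcases Nat.eq_zero_or_pos i with rfl | hi
        · rw [Function.update_self, hσ, exchange]
          simp only [zero_mul, zero_add, Function.update_apply]
          by_cases h1 : u = a
          · subst h1
            by_cases h2 : u = b
            · subst h2; simp
            · simp [h2]
          · by_cases h2 : u = b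
            · subst h2; simp [h1]
            · simpa [h1, h2] using hr.nxt 0 u hu
        · have : E ≤ i * E := Nat.le_mul_of_pos_left E hi
          rw [high _ (by omega), hr.nxt i u hu, Function.update_of_ne (by omega)]
      · rw [high _ (by omega)]; exact hr.par i u hu
      · rw [high _ (by omega)]; exact hr.real i hi u hu
      · rw [high _ (by omega)]; exact hr.flag i hi u hu
      · rw [aggAt, high _ (by omega)]; exact hr.agg i hi u hu
    · simp (disch := omega) only [Function.update_apply, if_neg]
    · simp (disch := omega) only [Function.update_apply, if_neg]
    · simp
    · simp
    · simp
    · have perm : PermOn (H 0) σ := exchange_permOn h.perm0 ha hb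
      refine ⟨h, ha, hb, ?_, fun _ _ => rfl, fun j hj => absurd hj (Nat.not_lt_zero j),
        fun j hj => absurd hj (Nat.not_lt_zero j), ?_, ?_, ?_, fun _ _ _ _ => rfl, ?_,
        fun _ _ _ _ => rfl, fun _ _ _ _ => rfl, Or.inl (Seg.refl a), Or.inr (Seg.refl b)⟩
      · intro u _; rw [Function.update_self]
      · rw [Function.update_self]; exact perm
      · rw [Function.update_self]; exact perm
      · intro u _ h1 h2
        rw [Function.update_self, hσ, exchange, if_neg h1, if_neg h2]
      · intro j hj u _
        rw [Function.update_of_ne (by omega)]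
    · simp [h20]
    · simp [h21]

end Splice

/-! ### The programs of the operations -/

/-- Climb from the vertex in register `0` to the root. -/
def rootCode : Cmd := seqs [
  instr (add 20 0 5), instr (load 21 20),
  loop 21 (seqs [instr (add 20 0 4), instr (load 0 20), instr (add 20 0 5), instr (load 21 20)])]

/-- Climb from the vertex in register `0` to the root, updating the aggregates on the way. -/
def updateCode : Cmd := seqs [
  instr (modify 0), instr (add 20 0 5), instr (load 21 20),
  loop 21 (seqs [instr (add 20 0 4), instr (load 0 20), instr (modify 0), instr (add 20 0 5),
    instr (load 21 20)])]

/-- Exchange the successors of the two darts between the vertices in registers `0` and `1`. -/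
def linkCode : Cmd := seqs [
  instr (mul 20 1 2), instr (add 20 20 0), instr (mul 21 0 2), instr (add 21 21 1), splice]

section Operations

variable {D : Type u} [CommSemigroup D] {N : ℕ} {ω : Tape} {f : D → D} {E L : ℕ}
  {H : ℕ → Finset ℕ} {sc hd : ℕ → ℕ → ℕ} {A : ℕ → ℕ → WithOne D}

theorem Climb.bounds (hH : ∀ i, ∀ u ∈ H i, u < E ∧ i ≤ L) (h : Hier H sc hd A) {v j x : ℕ}
    (hv : v < E) (hc : Climb H hd (0, v) (j, x)) : x < E ∧ j ≤ L + 1 := by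
  rcases Relation.ReflTransGen.cases_tail hc with h' | ⟨c, -, hc, hb⟩
  · simp only [Prod.mk.injEq] at h'
    omega
  · simp only [Prod.mk.injEq] at hb
    have h1 := (hH _ _ hc).2
    have h2 := (hH _ _ ((h.level _).mem _ hc)).1
    omega

theorem rootCode_spec (hN : 4 * ((L + 2) * E) ≤ N) (hH : ∀ i, ∀ u ∈ H i, u < E ∧ i ≤ L)
    (h : Hier H sc hd A) {st : State D} (hr : Rep N E L H sc hd A st.mem st.val)
    (hc : Consts E ((L + 2) * E) st) {v : ℕ} (hv : v < E) (h0 : st.reg 0 = v) :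
    Halts N ω f rootCode st fun t => ∃ r : ℕ × ℕ, IsRoot H hd (0, v) r ∧ t.reg 0 = r.1 * E + r.2 ∧
      t.mem = st.mem ∧ t.val = st.val ∧ (∀ r, 1 ≤ r → r < 10 → t.reg r = st.reg r) ∧
      t.modifications = st.modifications ∧ t.aggregations = st.aggregations ∧
      t.steps ≤ st.steps + 5 * (L + 2) := by
  set M := (L + 2) * E with hM
  have c4 := hc.r4
  have c5 := hc.r5
  have np : ∀ j x, Climb H hd (0, v) (j, x) → j * E + x < M := fun j x hc => by
    obtain ⟨h1, h2⟩ := hc.bounds hH h hv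
    exact node_lt h2 h1
  have hv0 := np 0 v Relation.ReflTransGen.refl
  have m1 : (v + 2 * M) % N = v + 2 * M := Nat.mod_eq_of_lt (by omega)
  have rv := hr.real 0 (by omega) v hv
  simp only [zero_mul, zero_add, ← hM] at rv
  have m2 := Nat.mod_eq_of_lt rv.1
  unfold rootCode
  simp only [halts_seqs_cons, halts_instr, Instr.run, State.put, State.tick,
    Function.update_apply, h0, c5, reduceIte, m1, m2]
  rw [halts_seqs_singleton]
  refine halts_loop (k := L + 1) (fun m t => ∃ j x, Climb H hd (0, v) (j, x) ∧ m + j = L + 1 ∧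
    t.reg 0 = j * E + x ∧ (t.reg 21 ≠ 0 ↔ x ∈ H j) ∧ t.mem = st.mem ∧ t.val = st.val ∧
    (∀ r, 1 ≤ r → r < 10 → t.reg r = st.reg r) ∧
    t.modifications = st.modifications ∧ t.aggregations = st.aggregations ∧
    t.steps ≤ st.steps + 2 + 5 * j) ?_ ?_ ?_
  · rintro m t ⟨j, x, hcl, hm, g0, g21, e1, e2, e3, e4, e5, e6⟩ hne
    have hx := g21.1 hne
    have hxE := hH j x hx
    have hstep : Climb H hd (0, v) (j + 1, hd j x) := hcl.tail ⟨hx, rfl⟩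
    have n1 := np _ _ hcl
    have n2 := np _ _ hstep
    have m3 : (j * E + x + M) % N = j * E + x + M := Nat.mod_eq_of_lt (by omega)
    have m4 : ((j + 1) * E + hd j x) % N = (j + 1) * E + hd j x := Nat.mod_eq_of_lt (by omega)
    have m5 : ((j + 1) * E + hd j x + 2 * M) % N = (j + 1) * E + hd j x + 2 * M :=
      Nat.mod_eq_of_lt (by omega)
    have rj := hr.real (j + 1) (by omega) _ (hH j _ ((h.level j).mem x hx)).1
    rw [← hM] at rj
    have m6 := Nat.mod_eq_of_lt rj.1
    have lx := hr.par j x hx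
    rw [← hM] at lx
    refine ⟨m - 1, by omega, ?_⟩
    simp only [seqs, halts_seq, halts_instr, Instr.run, State.put, State.tick,
      Function.update_apply, g0, e1, e3 4 (by omega) (by omega), e3 5 (by omega) (by omega), c4, c5,
      Nat.reduceEqDiff, reduceIte, m3, m4, m5, m6, lx]
    refine ⟨j + 1, hd j x, hstep, by omega, rfl, rj.2, trivial, e2, fun r h1 h2 => ?_, e4, e5, by omega⟩
    simp (disch := omega) only [if_neg]
    exact e3 r h1 h2
  · rintro m t ⟨j, x, hcl, hm, g0, g21, e1, e2, e3, e4, e5, e6⟩ hz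
    refine ⟨(j, x), ⟨hcl, fun hx => g21.2 hx hz⟩, g0, e1, e2, e3, e4, e5, ?_⟩
    have := (hcl.bounds hH h hv).2
    simp only [State.tick]
    omega
  · refine ⟨0, v, Relation.ReflTransGen.refl, by omega, ?_, ?_, rfl, rfl, fun r h1 h2 => ?_, rfl, rfl,
      by simp only; omega⟩
    · simp only [Function.update_apply, Nat.reduceEqDiff, reduceIte]; omega
    · simpa using rv.2
    · simp (disch := omega) only [Function.update_apply, if_neg]

open Classical in
theorem updateCode_spec (hN : 4 * ((L + 2) * E) ≤ N) (hH : ∀ i, ∀ u ∈ H i, u < E ∧ i ≤ L)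
    (h : Hier H sc hd A) {st : State D} (hr : Rep N E L H sc hd A st.mem st.val)
    (hc : Consts E ((L + 2) * E) st) {v : ℕ} (hv : v ∈ H 0) (h0 : st.reg 0 = v) {d : D}
    (hd0 : A 0 v = d) (hf : ∀ r, f (d * r) = f d * r) :
    Halts N ω f updateCode st fun t => ∃ A', Hier H sc hd A' ∧ Rep N E L H sc hd A' t.mem t.val ∧
      A' 0 v = (f d : D) ∧ (∀ u, u ≠ v → A' 0 u = A 0 u) ∧ t.mem = st.mem ∧
      (∀ r, 1 ≤ r → r < 10 → t.reg r = st.reg r) ∧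
      t.modifications ≤ st.modifications + (L + 2) ∧ t.aggregations = st.aggregations ∧
      t.steps ≤ st.steps + 5 * (L + 2) := by
  have hvE := (hH 0 v hv).1
  set M := (L + 2) * E with hM
  have c4 := hc.r4
  have c5 := hc.r5
  have np : ∀ j x, Climb H hd (0, v) (j, x) → j * E + x < M := fun j x hc => by
    obtain ⟨h1, h2⟩ := hc.bounds hH h hvE
    exact node_lt h2 h1
  have hv0 := np 0 v Relation.ReflTransGen.refl
  have m1 : (v + 2 * M) % N = v + 2 * M := Nat.mod_eq_of_lt (by omega)
  have rv := hr.real 0 (by omega) v hvE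
  simp only [zero_mul, zero_add, ← hM] at rv
  have m2 := Nat.mod_eq_of_lt rv.1
  unfold updateCode
  simp only [halts_seqs_cons, halts_instr, Instr.run, State.put, State.tick,
    Function.update_apply, h0, c5, reduceIte, m1, m2]
  rw [halts_seqs_singleton]
  refine halts_loop (k := L + 1) (fun m t => ∃ j x, Climb H hd (0, v) (j, x) ∧ m + j = L + 1 ∧
    t.reg 0 = j * E + x ∧ (t.reg 21 ≠ 0 ↔ x ∈ H j) ∧ t.mem = st.mem ∧
    (∀ a, t.val a = if ∃ i ≤ j, ∃ y, Climb H hd (0, v) (i, y) ∧ a = i * E + y then f (st.val a)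
      else st.val a) ∧
    (∀ r, 1 ≤ r → r < 10 → t.reg r = st.reg r) ∧
    t.modifications = st.modifications + (j + 1) ∧ t.aggregations = st.aggregations ∧
    t.steps ≤ st.steps + 2 + 5 * j) ?_ ?_ ?_
  · rintro m t ⟨j, x, hcl, hm, g0, g21, e1, e2, e3, e4, e5, e6⟩ hne
    have hx := g21.1 hne
    have hxE := hH j x hx
    have hstep : Climb H hd (0, v) (j + 1, hd j x) := hcl.tail ⟨hx, rfl⟩
    have n1 := np _ _ hcl
    have n2 := np _ _ hstep
    have m3 : (j * E + x + M) % N = j * E + x + M := Nat.mod_eq_of_lt (by omega)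
    have m4 : ((j + 1) * E + hd j x) % N = (j + 1) * E + hd j x := Nat.mod_eq_of_lt (by omega)
    have m5 : ((j + 1) * E + hd j x + 2 * M) % N = (j + 1) * E + hd j x + 2 * M :=
      Nat.mod_eq_of_lt (by omega)
    have rj := hr.real (j + 1) (by omega) _ (hH j _ ((h.level j).mem x hx)).1
    rw [← hM] at rj
    have m6 := Nat.mod_eq_of_lt rj.1
    have lx := hr.par j x hx
    rw [← hM] at lx
    refine ⟨m - 1, by omega, ?_⟩
    simp only [seqs, halts_seq, halts_instr, Instr.run, State.put, State.tick,
      Function.update_apply, g0, e1, e3 4 (by omega) (by omega), e3 5 (by omega) (by omega), c4, c5,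
      Nat.reduceEqDiff, reduceIte, m3, m4, m5, m6, lx]
    refine ⟨j + 1, hd j x, hstep, by omega, rfl, rj.2, trivial, fun a => ?_, fun r h1 h2 => ?_, by omega,
      e5, by omega⟩
    · have hinj : ∀ i y, Climb H hd (0, v) (i, y) → (j + 1) * E + hd j x = i * E + y →
          i = j + 1 := fun i y hcl' he =>
        (node_inj (hstep.bounds hH h hvE).1 (hcl'.bounds hH h hvE).1 he).1.symm
      by_cases ha : a = (j + 1) * E + hd j x
      · subst ha
        rw [if_pos rfl, if_pos ⟨j + 1, le_rfl, hd j x, hstep, rfl⟩, e2, if_neg]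
        rintro ⟨i, hi, y, hcl', he⟩
        have := hinj i y hcl' he
        omega
      · rw [if_neg ha, e2]
        refine if_congr ⟨?_, ?_⟩ rfl rfl
        · rintro ⟨i, hi, y, hcl', he⟩; exact ⟨i, by omega, y, hcl', he⟩
        · rintro ⟨i, hi, y, hcl', he⟩
          refine ⟨i, ?_, y, hcl', he⟩
          by_contra hlt
          obtain rfl : i = j + 1 := by omega
          exact ha (by rw [he, hcl'.unique hstep])
    · simp (disch := omega) only [if_neg]
      exact e3 r h1 h2
  · rintro m t ⟨j, x, hcl, hm, g0, g21, e1, e2, e3, e4, e5, e6⟩ hz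
    have hjL := (hcl.bounds hH h hvE).2
    have hend : x ∉ H j := fun hx => g21.2 hx hz
    let g : WithOne D → WithOne D := WithOne.recOneCoe 1 fun z => (f z : WithOne D)
    have hg : ∀ R, g (A 0 v * R) = g (A 0 v) * R := by
      intro R
      rw [hd0]
      induction R using WithOne.recOneCoe with
      | one => simp
      | coe r =>
        rw [← WithOne.coe_mul]
        change ((f (d * r) : D) : WithOne D) = (f d : D) * (r : D)
        rw [hf, WithOne.coe_mul]
    have hclimb : ∀ i u, i ≤ L + 1 → u < E →
        ((∃ i' ≤ j, ∃ y, Climb H hd (0, v) (i', y) ∧ i * E + u = i' * E + y) ↔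
          Climb H hd (0, v) (i, u)) := by
      intro i u hi hu
      constructor
      · rintro ⟨i', -, y, hcl', he⟩
        obtain ⟨rfl, rfl⟩ := node_inj hu (hcl'.bounds hH h hvE).1 he
        exact hcl'
      · intro hcl'
        refine ⟨i, ?_, u, hcl', rfl⟩
        rcases Climb.total hcl hcl' with h' | h'
        · rcases Relation.ReflTransGen.cases_head h' with h'' | ⟨c, hc', -⟩
          · exact (Prod.ext_iff.1 h'').1.ge
          · exact absurd hc'.1 hend
        · exact Climb.level_le h'
    refine ⟨_, h.update hv g hg, ⟨fun i u hu => ?_, fun i u hu => ?_, fun i hi u hu => ?_,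
      fun i hi u hu => ?_, fun i hi u hu => ?_⟩, ?_, fun u hu => ?_, e1, e3, ?_, e5, ?_⟩
    · simp only [State.tick, e1]; exact hr.nxt i u hu
    · simp only [State.tick, e1]; exact hr.par i u hu
    · simp only [State.tick, e1]; exact hr.real i hi u hu
    · simp only [State.tick, e1]; exact hr.flag i hi u hu
    · simp only [State.tick, e1, aggAt, e2]
      rw [hr.agg i hi u hu, aggAt]
      simp only [hclimb i u hi hu]
      split_ifs <;> rfl
    · simp only [if_pos (show Climb H hd (0, v) (0, v) from Relation.ReflTransGen.refl), hd0]
      rfl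
    · rw [if_neg]
      exact fun hcl' => hu (hcl'.unique Relation.ReflTransGen.refl)
    · simp only [State.tick]; omega
    · simp only [State.tick]; omega
  · refine ⟨0, v, Relation.ReflTransGen.refl, by omega, ?_, ?_, rfl, fun a => ?_, fun r h1 h2 => ?_,
      rfl, rfl, by simp only; omega⟩
    · simp only [Function.update_apply, Nat.reduceEqDiff, reduceIte]; omega
    · simpa using rv.2
    · by_cases ha : a = v
      · subst ha
        rw [if_pos ⟨0, le_rfl, a, Relation.ReflTransGen.refl, by simp⟩]
        simp
      · rw [if_neg]
        · simp [ha]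
        · rintro ⟨i, hi, y, hcl, he⟩
          obtain rfl : i = 0 := by omega
          have := hcl.unique Relation.ReflTransGen.refl
          subst this
          simp only [zero_mul, zero_add] at he
          exact ha he
    · simp (disch := omega) only [Function.update_apply, if_neg]

end Operations

/-! ### The invariant of the data structure -/

/-- The state represents the forest `F`: the memory contains the hierarchy over the tour of `F`, and
the aggregates at the bottom are the values of the vertices. -/
structure Repr {D : Type u} [CommSemigroup D] {V : ℕ} (N L : ℕ) (H : ℕ → Finset ℕ) (F : Forest V D)
    (sc hd : ℕ → ℕ → ℕ) (A : ℕ → ℕ → WithOne D) (st : State D) : Prop where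
  hier : Hier H sc hd A
  rep : Rep N (V * V) L H sc hd A st.mem st.val
  consts : Consts (V * V) ((L + 2) * (V * V)) st
  r2 : st.reg 2 = V
  tour : ∀ e < V * V, sc 0 e = tour F.graph e
  value : ∀ v : Fin V, A 0 v = F.value v
  one : ∀ e < V * V, V ≤ e → A 0 e = 1
  acyclic : F.graph.IsAcyclic

/-! ### Setting up the edgeless forest -/

/-- The branching parameter: a level keeps one out of `base V` elements. -/
def base (V : ℕ) : ℕ := Nat.log 2 V + 2

/-- The number of levels. -/
def depth (V : ℕ) : ℕ := Nat.clog (base V) (V * V)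

theorem one_lt_base (V : ℕ) : 1 < base V := by unfold base; omega

theorem sq_le_base_pow (V : ℕ) : V * V ≤ base V ^ depth V := Nat.le_pow_clog (one_lt_base V) _

/-- All numbers that occur are words. -/
theorem word_bounds {V : ℕ} (hV : 3 ≤ V) : base V ^ depth V < V ^ 10 ∧
    base V * (V * V) ≤ V ^ 10 ∧ 4 * ((depth V + 2) * (V * V)) ≤ V ^ 10 := by
  have hb : base V ≤ V + 1 := by
    have := Nat.log_lt_self 2 (x := V) (by omega)
    unfold base; omega
  have hlt : base V ^ (depth V - 1) < V * V :=
    Nat.pow_pred_clog_lt_self (one_lt_base V) (by nlinarith)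
  have hpos : 0 < depth V := Nat.clog_pos (one_lt_base V) (by nlinarith)
  have hL : depth V ≤ V * V := by
    have h1 : 2 ^ (depth V - 1) ≤ base V ^ (depth V - 1) :=
      Nat.pow_le_pow_left (one_lt_base V) _
    have h2 : depth V - 1 < 2 ^ (depth V - 1) := Nat.lt_two_pow_self
    omega
  have hP : base V ^ depth V ≤ base V * (V * V) := by
    obtain ⟨d, hd⟩ : ∃ d, depth V = d + 1 := ⟨depth V - 1, by omega⟩
    rw [hd] at hlt ⊢
    rw [pow_succ']
    exact Nat.mul_le_mul_left _ hlt.le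
  have h6 : V ^ 6 < V ^ 10 := Nat.pow_lt_pow_right (by omega) (by omega)
  have h9 : 9 ≤ V ^ 2 := by nlinarith
  have hB : base V * (V * V) < V ^ 10 := by
    refine lt_of_le_of_lt ?_ h6
    calc base V * (V * V) ≤ (V + 1) * (V * V) := Nat.mul_le_mul_right _ hb
      _ ≤ (V ^ 2 * V ^ 2) * V ^ 2 := by
        rw [← sq]
        refine Nat.mul_le_mul_right _ ?_
        nlinarith
      _ = V ^ 6 := by ring
  refine ⟨hP.trans_lt hB, hB.le, le_trans ?_ h6.le⟩
  calc 4 * ((depth V + 2) * (V * V)) ≤ 4 * ((V * V + 2) * (V * V)) := by gcongr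
    _ ≤ (V ^ 2 * V ^ 2) * V ^ 2 := by rw [← sq]; nlinarith
    _ = V ^ 6 := by ring

/-- Compute the constants: registers `2` to `6` hold `V`, the number `V * V` of elements and the
offsets of the tables, `8` and `9` the range of the random samples and the branching parameter. -/
def paramsCode : Cmd := seqs [
  seqs [instr (add 2 0 7), instr (mul 3 2 2), instr (const 9 1), instr (const 29 2),
    instr (const 30 1), instr (add 28 2 7)],
  loop 28 (seqs [instr (div 28 28 29), instr (add 9 9 30)]),
  seqs [instr (add 9 9 7), instr (const 8 1), instr (sub 32 3 8)],
  loop 32 (seqs [instr (mul 8 8 9), instr (add 31 31 30), instr (sub 32 3 8)]),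
  seqs [instr (add 31 31 29), instr (mul 4 31 3), instr (add 5 4 4), instr (add 6 5 4)]]

/-- The contents of the registers once the constants have been computed. -/
structure ParamRegs {D : Type u} (V : ℕ) (s : State D) : Prop where
  consts : Consts (V * V) ((depth V + 2) * (V * V)) s
  r2 : s.reg 2 = V
  r8 : s.reg 8 = base V ^ depth V
  r9 : s.reg 9 = base V
  r30 : s.reg 30 = 1

section Params

variable {D : Type u} [CommSemigroup D] {ω : Tape} {f : D → D} {V : ℕ}

theorem paramsCode_spec (hV : 3 ≤ V) (x : ℕ → D) :
    Halts (V ^ 10) ω f paramsCode (blank V x) fun t => ParamRegs V t ∧ t.mem = (fun _ => 0) ∧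
      t.val = x ∧ t.drawn = 0 := by
  obtain ⟨hP, hB, hM⟩ := word_bounds hV
  have hE : V * V ≤ V ^ 10 := by
    rw [← sq]; exact Nat.pow_le_pow_right (by omega) (by omega)
  have hVE : V + 6 ≤ V * V := by nlinarith
  set N := V ^ 10 with hN
  have hb := one_lt_base V
  have hbE : base V * 1 ≤ base V * (V * V) := Nat.mul_le_mul_left _ (by omega)
  unfold paramsCode
  rw [halts_seqs_cons]
  have b1 : Halts N ω f (seqs [instr (add 2 0 7), instr (mul 3 2 2), instr (const 9 1),
      instr (const 29 2), instr (const 30 1), instr (add 28 2 7)]) (blank V x) fun t =>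
      t.reg 2 = V ∧ t.reg 3 = V * V ∧ t.reg 7 = 0 ∧ t.reg 9 = 1 ∧ t.reg 29 = 2 ∧ t.reg 30 = 1 ∧
      t.reg 31 = 0 ∧ t.reg 28 = V ∧ t.mem = (fun _ => 0) ∧ t.val = x ∧ t.drawn = 0 := by
    have m1 : V % N = V := Nat.mod_eq_of_lt (by omega)
    have m2 : (V * V) % N = V * V := by
      apply Nat.mod_eq_of_lt
      calc V * V < V ^ 3 := by nlinarith
        _ ≤ N := Nat.pow_le_pow_right (by omega) (by omega)
    have m3 : 1 % N = 1 := Nat.mod_eq_of_lt (by omega)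
    have m4 : 2 % N = 2 := Nat.mod_eq_of_lt (by omega)
    simp only [seqs, halts_seq, halts_instr, Instr.run, State.put, State.tick, blank,
      Function.update_apply, Nat.reduceEqDiff, reduceIte, add_zero, m1, m2, m3, m4, and_self]
  refine b1.mono ?_
  rintro t₁ ⟨r2, r3, r7, r9, r29, r30, r31, r28, e1, e2, e3⟩
  have m1 : 1 % N = 1 := Nat.mod_eq_of_lt (by omega)
  rw [halts_seqs_cons]
  have b2 : Halts N ω f (loop 28 (seqs [instr (div 28 28 29), instr (add 9 9 30)])) t₁ fun t =>
      t.reg 9 = base V ∧ t.mem = t₁.mem ∧ t.val = t₁.val ∧ t.drawn = t₁.drawn ∧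
      ∀ r, r ≠ 28 → r ≠ 9 → t.reg r = t₁.reg r := by
    refine halts_loop (k := V) (fun k t => t.reg 28 = k ∧ k ≤ V ∧
      t.reg 9 + (if k = 0 then 0 else Nat.log 2 k + 1) = base V ∧ t.mem = t₁.mem ∧
      t.val = t₁.val ∧ t.drawn = t₁.drawn ∧ ∀ r, r ≠ 28 → r ≠ 9 → t.reg r = t₁.reg r) ?_ ?_ ?_
    · rintro k t ⟨h1, h2, h3, h4, h5, h6, h7⟩ h0
      rw [h1] at h0
      rw [if_neg h0] at h3
      have q1 := h7 29 (by omega) (by omega)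
      have q2 := h7 30 (by omega) (by omega)
      rw [r29] at q1
      rw [r30] at q2
      have hk2 : k / 2 < k := Nat.div_lt_self (by omega) (by omega)
      have m2 : (k / 2) % N = k / 2 := Nat.mod_eq_of_lt (by omega)
      have m3 : (t.reg 9 + 1) % N = t.reg 9 + 1 := Nat.mod_eq_of_lt (by
        have := Nat.zero_le (Nat.log 2 k)
        have : base V * 9 ≤ base V * (V * V) := Nat.mul_le_mul_left _ (by omega)
        omega)
      refine ⟨k / 2, hk2, ?_⟩
      simp only [seqs, halts_seq, halts_instr, Instr.run, State.put, State.tick,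
        Function.update_apply, Nat.reduceEqDiff, reduceIte, h1, q1, q2, m2, m3]
      refine ⟨trivial, by omega, ?_, h4, h5, h6, fun r n1 n2 => ?_⟩
      · rw [← h3]
        rcases Nat.lt_or_ge k 2 with hk | hk
        · obtain rfl : k = 1 := by omega
          simp
        · rw [if_neg (by omega), Nat.log_of_one_lt_of_le (by omega : 1 < 2) hk]
          omega
      · rw [if_neg n2, if_neg n1]; exact h7 r n1 n2
    · rintro k t ⟨h1, h2, h3, h4, h5, h6, h7⟩ h0
      rw [h1] at h0
      rw [if_pos h0] at h3
      exact ⟨h3, h4, h5, h6, h7⟩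
    · refine ⟨r28, le_rfl, ?_, rfl, rfl, rfl, fun _ _ _ => rfl⟩
      rw [if_neg (by omega), r9, base]
      omega
  refine b2.mono ?_
  rintro t₂ ⟨s9, f1, f2, f3, f4⟩
  rw [halts_seqs_cons]
  have hEpos : (V * V - 1) % N = V * V - 1 := Nat.mod_eq_of_lt (by omega)
  have m9 : base V % N = base V := Nat.mod_eq_of_lt (by
    have : base V * 9 ≤ base V * (V * V) := Nat.mul_le_mul_left _ (by omega)
    omega)
  simp only [seqs, halts_seq, halts_instr, Instr.run, State.put, State.tick,
    Function.update_apply, Nat.reduceEqDiff, reduceIte, m1, f4 3 (by omega) (by omega), r3, hEpos,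
    s9, m9, f4 7 (by omega) (by omega), r7, add_zero]
  refine Halts.mono (Q := fun t => t.reg 8 = base V ^ depth V ∧ t.reg 31 = depth V ∧
    t.mem = t₂.mem ∧ t.val = t₂.val ∧ t.drawn = t₂.drawn ∧
    ∀ r, r ≠ 8 → r ≠ 31 → r ≠ 32 → t.reg r = t₂.reg r) ?_ ?_
  · refine halts_loop (k := depth V) (fun m t => ∃ j, m + j = depth V ∧ t.reg 8 = base V ^ j ∧
      t.reg 31 = j ∧ t.reg 32 = V * V - base V ^ j ∧
      t.mem = t₂.mem ∧ t.val = t₂.val ∧ t.drawn = t₂.drawn ∧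
      ∀ r, r ≠ 8 → r ≠ 31 → r ≠ 32 → t.reg r = t₂.reg r) ?_ ?_ ?_
    · rintro m t ⟨j, h1, h2, h3, h4, h5, h6, h7, h8⟩ h0
      rw [h4] at h0
      have hlt : j < depth V := (Nat.lt_clog_iff_pow_lt hb).2 (by omega)
      have q3 := h8 3 (by omega) (by omega) (by omega)
      have q9 := h8 9 (by omega) (by omega) (by omega)
      have q30 := h8 30 (by omega) (by omega) (by omega)
      rw [f4 3 (by omega) (by omega), r3] at q3
      rw [s9] at q9
      rw [f4 30 (by omega) (by omega), r30] at q30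
      have hmul : base V ^ j * base V < N := by
        calc base V ^ j * base V < (V * V) * base V :=
              Nat.mul_lt_mul_of_pos_right (by omega) (by omega)
          _ ≤ N := by rw [mul_comm]; exact hB
      have m2 : (base V ^ j * base V) % N = base V ^ (j + 1) := by
        rw [Nat.mod_eq_of_lt hmul, pow_succ]
      have hj : j < base V ^ j := Nat.lt_pow_self hb
      have m3 : (j + 1) % N = j + 1 := Nat.mod_eq_of_lt (by omega)
      have m4 : (V * V - base V ^ (j + 1)) % N = V * V - base V ^ (j + 1) :=
        Nat.mod_eq_of_lt (by have : 0 < base V ^ (j + 1) := pow_pos (by omega) _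
                             omega)
      refine ⟨m - 1, by omega, ?_⟩
      simp only [halts_seq, halts_instr, Instr.run, State.put, State.tick,
        Function.update_apply, Nat.reduceEqDiff, reduceIte, h2, h3, q3, q9, q30, m2, m3, m4]
      refine ⟨j + 1, by omega, rfl, rfl, rfl, h5, h6, h7, fun r n1 n2 n3 => ?_⟩
      rw [if_neg n3, if_neg n2, if_neg n1]; exact h8 r n1 n2 n3
    · rintro m t ⟨j, h1, h2, h3, h4, h5, h6, h7, h8⟩ h0
      rw [h4] at h0
      have hle : depth V ≤ j := (Nat.clog_le_iff_le_pow hb).2 (by omega)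
      obtain rfl : j = depth V := by omega
      exact ⟨h2, h3, h5, h6, h7, h8⟩
    · refine ⟨0, by omega, ?_, ?_, ?_, rfl, rfl, rfl, fun r n1 n2 n3 => ?_⟩
      · simp
      · simp only [Function.update_apply, Nat.reduceEqDiff, reduceIte]
        rw [f4 31 (by omega) (by omega), r31]
      · simp
      · by_cases h9 : r = 9
        · subst h9; simp [s9]
        · simp only [Function.update_apply, if_neg h9, if_neg n1, if_neg n3]
  rintro t₃ ⟨g8, g31, g1, g2, g3, g4⟩
  have q3 := g4 3 (by omega) (by omega) (by omega)
  have q7 := g4 7 (by omega) (by omega) (by omega)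
  have q2 := g4 2 (by omega) (by omega) (by omega)
  have q9 := g4 9 (by omega) (by omega) (by omega)
  have q30 := g4 30 (by omega) (by omega) (by omega)
  have q29 := g4 29 (by omega) (by omega) (by omega)
  rw [f4 _ (by omega) (by omega)] at q3 q7 q2 q30 q29
  set M := (depth V + 2) * (V * V) with hMdef
  have hdM : depth V + 2 ≤ M := Nat.le_mul_of_pos_right _ (by omega)
  have m2 : (depth V + 2) % N = depth V + 2 := Nat.mod_eq_of_lt (by omega)
  have m3 : M % N = M := Nat.mod_eq_of_lt (by omega)
  have m4 : (M + M) % N = 2 * M := by rw [Nat.mod_eq_of_lt (by omega)]; omega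
  have m5 : (2 * M + M) % N = 3 * M := by rw [Nat.mod_eq_of_lt (by omega)]; omega
  simp only [g31, q29, q3, r3, r29, m2, ← hMdef, m3, m4, m5]
  refine ⟨⟨⟨?_, ?_, ?_, ?_, ?_⟩, ?_, ?_, ?_, ?_⟩, ?_, ?_, ?_⟩
  all_goals try simp only [Function.update_apply, Nat.reduceEqDiff, reduceIte]
  · rw [q3, r3]
  · rfl
  · rfl
  · rfl
  · rw [q7, r7]
  · rw [q2, r2]
  · exact g8
  · rw [q9, s9]
  · rw [q30, r30]
  · rw [g1, f1, e1]
  · rw [g2, f2, e2]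
  · rw [g3, f3, e3]

end Params

/-- Fill in one node, as the only element of its cycle, and pass on the value to its parent.
Registers: `2` to `6` and `9` hold constants, `35` the sample of the element, `36` the power of the
branching parameter that belongs to the level, `37` the node, `38` is nonzero if it has a value. -/
def rowBody : Cmd := seqs [
  instr (sub 39 36 35), instr (add 40 37 5), instr (store 40 39), instr (store 37 37),
  instr (add 40 37 3), instr (add 41 37 4), instr (store 41 40),
  instr (add 41 37 6), instr (store 41 38), instr (add 41 40 6), instr (store 41 38),
  ite 38 (instr (copy 40 37)) skip,
  instr (add 37 40 7), instr (div 36 36 9)]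

/-- Draw the heights and make every element a cycle of its own. -/
def rowsCode : Cmd := seqs [
  instr (add 33 7 7), instr (add 34 3 7),
  loop 34 (seqs [
    seqs [instr (rand 35 8), instr (add 36 8 7), instr (add 37 33 7), instr (sub 38 2 33)],
    loop 36 rowBody,
    seqs [instr (add 33 33 30), instr (sub 34 34 30)]])]

/-- Join the darts at each vertex to a cycle. -/
def rotCode : Cmd := seqs [
  instr (add 33 7 7), instr (sub 34 3 2),
  loop 34 (seqs [
    seqs [instr (add 20 33 7), instr (add 21 33 2)],
    splice,
    seqs [instr (add 33 33 30), instr (sub 34 34 30)]])]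

/-- Build the hierarchy over the tour of the edgeless forest. -/
def setupCode : Cmd := seqs [paramsCode, rowsCode, rotCode]

section Rows

variable {D : Type u} [CommSemigroup D] {ω : Tape} {f : D → D} {V : ℕ}

/-- The nodes of the rows in `S` have been filled in, for heights with samples `ρ`. -/
structure Filled (V : ℕ) (ρ : ℕ → ℕ) (x : ℕ → D) (S : ℕ → ℕ → Prop) (mem : ℕ → ℕ) (val : ℕ → D) :
    Prop where
  nxt : ∀ j ≤ depth V, ∀ e < V * V, S j e → mem (j * (V * V) + e) = j * (V * V) + e
  par : ∀ j ≤ depth V, ∀ e < V * V, S j e →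
    mem (j * (V * V) + e + (depth V + 2) * (V * V)) = (j + 1) * (V * V) + e
  real : ∀ j ≤ depth V, ∀ e < V * V, S j e →
    mem (j * (V * V) + e + 2 * ((depth V + 2) * (V * V))) = base V ^ (depth V - j) - ρ e
  flag : ∀ j ≤ depth V, ∀ e < V * V, S j e →
    mem (j * (V * V) + e + 3 * ((depth V + 2) * (V * V))) = V - e
  flag' : ∀ j ≤ depth V, ∀ e < V * V, S j e →
    mem ((j + 1) * (V * V) + e + 3 * ((depth V + 2) * (V * V))) = V - e
  val0 : ∀ e < V, val e = x e
  val : ∀ j ≤ depth V, ∀ e < V, S j e → val ((j + 1) * (V * V) + e) = x e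
  top : ∀ e < V * V, mem ((depth V + 1) * (V * V) + e + 2 * ((depth V + 2) * (V * V))) = 0

omit [CommSemigroup D] in
theorem Filled.congr {ρ : ℕ → ℕ} {x : ℕ → D} {S S' : ℕ → ℕ → Prop} {mem : ℕ → ℕ} {val : ℕ → D}
    (h : Filled V ρ x S mem val) (hS : ∀ j ≤ depth V, ∀ e < V * V, S' j e → S j e) :
    Filled V ρ x S' mem val := by
  have hVE : ∀ e < V, e < V * V := fun e he => he.trans_le (Nat.le_mul_self V)
  exact ⟨fun j hj e he hs => h.nxt j hj e he (hS j hj e he hs),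
    fun j hj e he hs => h.par j hj e he (hS j hj e he hs),
    fun j hj e he hs => h.real j hj e he (hS j hj e he hs),
    fun j hj e he hs => h.flag j hj e he (hS j hj e he hs),
    fun j hj e he hs => h.flag' j hj e he (hS j hj e he hs), h.val0,
    fun j hj e he hs => h.val j hj e he (hS j hj e (hVE e he) hs), h.top⟩

omit [CommSemigroup D] in
theorem Filled.step (hV : 0 < V) {ρ : ℕ → ℕ} {x : ℕ → D} {k i : ℕ} {mem mem' : ℕ → ℕ}
    {val val' : ℕ → D} (h : Filled V ρ x (fun j e => e < k ∨ e = k ∧ j < i) mem val)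
    (hk : k < V * V) (hi : i ≤ depth V)
    (hmem : ∀ a, mem' a =
      if a = i * (V * V) + k + V * V + 3 * ((depth V + 2) * (V * V)) then V - k
      else if a = i * (V * V) + k + 3 * ((depth V + 2) * (V * V)) then V - k
      else if a = i * (V * V) + k + (depth V + 2) * (V * V) then i * (V * V) + k + V * V
      else if a = i * (V * V) + k then i * (V * V) + k
      else if a = i * (V * V) + k + 2 * ((depth V + 2) * (V * V)) then
        base V ^ (depth V - i) - ρ k
      else mem a)
    (hval : ∀ a, val' a = if a = i * (V * V) + k + V * V ∧ k < V then val (i * (V * V) + k)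
      else val a) :
    Filled V ρ x (fun j e => e < k ∨ e = k ∧ j < i + 1) mem' val' := by
  have n1 := node_lt (L := depth V) (i := i) (by omega) hk
  have n2 := node_lt (L := depth V) (i := i + 1) (by omega) hk
  have hiE : i * (V * V) + k + V * V = (i + 1) * (V * V) + k := by ring
  have hVE : V ≤ V * V := Nat.le_mul_self V
  rw [hiE] at hmem hval
  have inj := fun (j e l c : ℕ) (he : e < V * V) (hc : c < V * V) => node_inj (i := j) (j := l) he hc
  have node := fun (j e : ℕ) (hj : j ≤ depth V + 1) (he : e < V * V) =>
    node_lt (L := depth V) hj he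
  -- A node other than the new one has been filled in before.
  have old : ∀ j e, (e < k ∨ e = k ∧ j < i + 1) → ¬ (j = i ∧ e = k) →
      (e < k ∨ e = k ∧ j < i) := by
    intro j e h1 h2; omega
  refine ⟨fun j hj e he hs => ?_, fun j hj e he hs => ?_, fun j hj e he hs => ?_,
    fun j hj e he hs => ?_, fun j hj e he hs => ?_, fun e he => ?_, fun j hj e he hs => ?_,
    fun e he => ?_⟩
  · have q := node j e (by omega) he
    rw [hmem, if_neg (by omega), if_neg (by omega), if_neg (by omega)]
    by_cases hp : j * (V * V) + e = i * (V * V) + k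
    · rw [if_pos hp, hp]
    · rw [if_neg hp, if_neg (by omega)]
      exact h.nxt j hj e he (old j e hs fun hje => hp (by rw [hje.1, hje.2]))
  · have q := node j e (by omega) he
    rw [hmem, if_neg (by omega), if_neg (by omega)]
    by_cases hp : j * (V * V) + e = i * (V * V) + k
    · obtain ⟨rfl, rfl⟩ := inj _ _ _ _ he hk hp
      rw [if_pos rfl]
    · rw [if_neg (by omega), if_neg (by omega), if_neg (by omega)]
      have := h.par j hj e he (old j e hs fun hje => hp (by rw [hje.1, hje.2]))
      exact this
  · have q := node j e (by omega) he
    rw [hmem, if_neg (by omega), if_neg (by omega), if_neg (by omega), if_neg (by omega)]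
    by_cases hp : j * (V * V) + e = i * (V * V) + k
    · obtain ⟨rfl, rfl⟩ := inj _ _ _ _ he hk hp
      rw [if_pos rfl]
    · rw [if_neg (by omega)]
      have := h.real j hj e he (old j e hs fun hje => hp (by rw [hje.1, hje.2]))
      exact this
  · have q := node j e (by omega) he
    rw [hmem]
    split_ifs with h1 h2
    · rw [(inj j e (i + 1) k he hk (by omega)).2]
    · rw [(inj j e i k he hk (by omega)).2]
    any_goals omega
    have := h.flag j hj e he (old j e hs fun hje => h2 (by rw [hje.1, hje.2]))
    exact this
  · have q := node (j + 1) e (by omega) he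
    rw [hmem]
    split_ifs with h1 h2
    · rw [(inj (j + 1) e (i + 1) k he hk (by omega)).2]
    · rw [(inj (j + 1) e i k he hk (by omega)).2]
    any_goals omega
    have := h.flag' j hj e he (old j e hs fun hje => h1 (by rw [hje.1, hje.2]))
    exact this
  · rw [hval, if_neg]
    · exact h.val0 e he
    · rintro ⟨h1, -⟩
      have := (inj 0 e (i + 1) k (by omega) hk (by rw [← h1]; ring)).1
      omega
  · rw [hval]
    split_ifs with h1
    · have he' := inj (j + 1) e (i + 1) k (by omega) hk h1.1
      obtain ⟨h2, rfl⟩ := he'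
      rcases Nat.eq_zero_or_pos i with rfl | hi0
      · simpa using h.val0 e he
      · have := h.val (i - 1) (by omega) e he (Or.inr ⟨rfl, by omega⟩)
        rwa [show i - 1 + 1 = i by omega] at this
    · refine h.val j hj e he (old j e hs ?_)
      rintro ⟨rfl, rfl⟩
      exact h1 ⟨rfl, he⟩
  · have q := node (depth V + 1) e (by omega) he
    rw [hmem, if_neg (by omega), if_neg (by omega), if_neg (by omega), if_neg (by omega), if_neg]
    · have := h.top e he
      exact this
    · intro h1
      have := (inj (depth V + 1) e i k he hk (by omega)).1
      omega

/-- The state while the rows are filled in, from the first to the last element and from the bottom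
to the top; `k` elements are complete, and so are `i` nodes of the element `k`. -/
structure RowInv (V : ℕ) (ρ : ℕ → ℕ) (x : ℕ → D) (k i : ℕ) (s : State D) : Prop where
  regs : ParamRegs V s
  filled : Filled V ρ x (fun j e => e < k ∨ e = k ∧ j < i) s.mem s.val
  r33 : s.reg 33 = k
  r34 : s.reg 34 = V * V - k

omit [CommSemigroup D] in
theorem ParamRegs.congr {s t : State D} (h : ParamRegs V s)
    (hr : ∀ r, (r < 10 ∨ r = 30) → t.reg r = s.reg r) : ParamRegs V t := by
  refine ⟨h.consts.congr fun r hr' => hr r (by omega), ?_, ?_, ?_, ?_⟩ <;> rw [hr _ (by omega)]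
  exacts [h.r2, h.r8, h.r9, h.r30]

set_option maxHeartbeats 1000000 in
theorem rowBody_spec (hV : 3 ≤ V) {ρ : ℕ → ℕ} {x : ℕ → D} {k i : ℕ} {s : State D}
    (h : RowInv V ρ x k i s) (hk : k < V * V) (hi : i ≤ depth V)
    (h35 : s.reg 35 = ρ k) (h36 : s.reg 36 = base V ^ (depth V - i))
    (h37 : s.reg 37 = i * (V * V) + k) (h38 : s.reg 38 = V - k) :
    Halts (V ^ 10) ω f rowBody s.tick fun t => RowInv V ρ x k (i + 1) t ∧ t.drawn = s.drawn ∧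
      t.reg 35 = ρ k ∧ t.reg 36 = base V ^ (depth V - i) / base V ∧
      t.reg 37 = (i + 1) * (V * V) + k ∧ t.reg 38 = V - k := by
  obtain ⟨hP, hB, hM4⟩ := word_bounds hV
  have c3 := h.regs.consts.r3
  have c4 := h.regs.consts.r4
  have c5 := h.regs.consts.r5
  have c6 := h.regs.consts.r6
  have c7 := h.regs.consts.r7
  have c9 := h.regs.r9
  have n1 := node_lt (L := depth V) (i := i) (by omega) hk
  have n2 := node_lt (L := depth V) (i := i + 1) (by omega) hk
  have hnode : ∀ j e, j ≤ depth V + 1 → e < V * V →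
      j * (V * V) + e < (depth V + 2) * (V * V) := fun j e hj he => node_lt hj he
  have hVE : V ≤ V * V := Nat.le_mul_self V
  have hiE : i * (V * V) + k + V * V = (i + 1) * (V * V) + k := by ring
  have hpow : base V ^ (depth V - i) ≤ base V ^ depth V :=
    Nat.pow_le_pow_right (by have := one_lt_base V; omega) (by omega)
  have hVpos : V * V ≤ (depth V + 2) * (V * V) := Nat.le_mul_of_pos_left _ (by omega)
  have m1 : (base V ^ (depth V - i) - ρ k) % V ^ 10 = base V ^ (depth V - i) - ρ k :=
    Nat.mod_eq_of_lt (by omega)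
  have m2 : (i * (V * V) + k + 2 * ((depth V + 2) * (V * V))) % V ^ 10 =
      i * (V * V) + k + 2 * ((depth V + 2) * (V * V)) := Nat.mod_eq_of_lt (by omega)
  have m3 : (i * (V * V) + k + V * V) % V ^ 10 = i * (V * V) + k + V * V :=
    Nat.mod_eq_of_lt (by omega)
  have m4 : (i * (V * V) + k + (depth V + 2) * (V * V)) % V ^ 10 =
      i * (V * V) + k + (depth V + 2) * (V * V) := Nat.mod_eq_of_lt (by omega)
  have m5 : (i * (V * V) + k + 3 * ((depth V + 2) * (V * V))) % V ^ 10 =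
      i * (V * V) + k + 3 * ((depth V + 2) * (V * V)) := Nat.mod_eq_of_lt (by omega)
  have m6 : (i * (V * V) + k + V * V + 3 * ((depth V + 2) * (V * V))) % V ^ 10 =
      i * (V * V) + k + V * V + 3 * ((depth V + 2) * (V * V)) := Nat.mod_eq_of_lt (by omega)
  have m7 : (base V ^ (depth V - i) / base V) % V ^ 10 = base V ^ (depth V - i) / base V :=
    Nat.mod_eq_of_lt (by
      have := Nat.div_le_self (base V ^ (depth V - i)) (base V)
      omega)
  unfold rowBody
  simp only [seqs, halts_seq, halts_instr, halts_ite, halts_skip, Instr.run, State.put, State.tick,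
    Function.update_apply, c3, c4, c5, c6, c7, c9, h35, h36, h37, h38, Nat.reduceEqDiff, reduceIte,
    m1, m2, m3, m4, m5, m6, m7, add_zero]
  have hregs : ∀ r, r < 10 ∨ r = 30 ∨ r = 33 ∨ r = 34 → r ≠ 36 ∧ r ≠ 37 ∧ r ≠ 39 ∧ r ≠ 40 ∧ r ≠ 41 := by
    intro r hr; omega
  split_ifs with h0
  all_goals
    refine ⟨⟨h.regs.congr fun r hr => ?_,
      h.filled.step (by omega) hk hi (fun a => ?_) (fun a => ?_), ?_, ?_⟩, trivial, ?_, ?_, ?_, ?_⟩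
  any_goals
    simp only [Function.update_apply, Nat.reduceEqDiff, reduceIte]
  any_goals first | exact h.r33 | exact h.r34 | exact h35 | exact h38
  any_goals
    obtain ⟨z1, z2, z3, z4, z5⟩ := hregs r (by omega)
    simp only [if_neg z1, if_neg z2, if_neg z3, if_neg z4, if_neg z5]
  any_goals exact hiE
  · rw [if_neg (by omega)]
  · simp only [show k < V by omega, and_true]

theorem rowsCode_spec (hV : 3 ≤ V) {x : ℕ → D} {s : State D} (h : ParamRegs V s)
    (hmem : s.mem = fun _ => 0) (hval : s.val = x) (hdr : s.drawn = 0) :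
    Halts (V ^ 10) ω f rowsCode s fun t => ParamRegs V t ∧
      Filled V (fun e => ω.sample e (base V ^ depth V)) x (fun _ e => e < V * V) t.mem t.val := by
  obtain ⟨hP, hB, hM4⟩ := word_bounds hV
  set ρ : ℕ → ℕ := fun e => ω.sample e (base V ^ depth V) with hρ
  have hb := one_lt_base V
  have hEM : V * V ≤ (depth V + 2) * (V * V) := Nat.le_mul_of_pos_left _ (by omega)
  have hVE : V ≤ V * V := Nat.le_mul_self V
  have m1 : (V * V) % V ^ 10 = V * V := Nat.mod_eq_of_lt (by omega)
  unfold rowsCode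
  simp only [halts_seqs_cons, halts_instr, Instr.run, State.put, State.tick,
    Function.update_apply, h.consts.r7, h.consts.r3, Nat.reduceEqDiff, reduceIte, add_zero,
    Nat.zero_mod, m1]
  rw [halts_seqs_singleton]
  refine halts_loop (k := V * V) (fun m t => ∃ k, m + k = V * V ∧ RowInv V ρ x k 0 t ∧
    t.drawn = k) ?_ ?_ ?_
  · rintro m t ⟨k, hm, hinv, hd⟩ h34
    have hk : k < V * V := by rw [hinv.r34] at h34; omega
    have m2 : base V ^ depth V % V ^ 10 = base V ^ depth V := Nat.mod_eq_of_lt hP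
    have m3 : ω.sample k (base V ^ depth V) % V ^ 10 = ρ k :=
      Nat.mod_eq_of_lt ((sample_lt ω k (pow_pos (by omega) _)).trans hP)
    have m4 : k % V ^ 10 = k := Nat.mod_eq_of_lt (by omega)
    have m5 : (V - k) % V ^ 10 = V - k := Nat.mod_eq_of_lt (by omega)
    refine ⟨m - 1, by omega, ?_⟩
    rw [halts_seqs_cons]
    simp only [seqs, halts_seq, halts_instr, Instr.run, State.put, State.tick,
      Function.update_apply, Nat.reduceEqDiff, reduceIte, hinv.regs.r8, hinv.regs.r2, hinv.r33,
      hinv.regs.consts.r7, add_zero, hd, m2, m3, m4, m5]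
    refine Halts.mono (Q := fun t => RowInv V ρ x k (depth V + 1) t ∧ t.drawn = k + 1) ?_ ?_
    · refine halts_loop (k := depth V + 1) (fun m t => ∃ i, m + i = depth V + 1 ∧
        RowInv V ρ x k i t ∧ t.drawn = k + 1 ∧ t.reg 35 = ρ k ∧
        t.reg 36 = (if i ≤ depth V then base V ^ (depth V - i) else 0) ∧
        t.reg 37 = i * (V * V) + k ∧ t.reg 38 = V - k) ?_ ?_ ?_
      · rintro m t ⟨i, hm, hi, hd, h35, h36, h37, h38⟩ hne
        have hiL : i ≤ depth V := by
          by_contra hlt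
          rw [if_neg hlt] at h36
          exact hne h36
        rw [if_pos hiL] at h36
        refine ⟨m - 1, by omega, (rowBody_spec hV hi hk hiL h35 h36 h37 h38).mono ?_⟩
        rintro t' ⟨hi', hd', h35', h36', h37', h38'⟩
        refine ⟨i + 1, by omega, hi', hd'.trans hd, h35', ?_, h37', h38'⟩
        rw [h36']
        split_ifs with h1
        · rw [show depth V - i = depth V - (i + 1) + 1 by omega, pow_succ,
            Nat.mul_div_cancel _ (by omega)]
        · rw [show depth V - i = 0 by omega, pow_zero, Nat.div_eq_of_lt hb]
      · rintro m t ⟨i, hm, hi, hd, h35, h36, h37, h38⟩ h0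
        have hiL : ¬ i ≤ depth V := by
          intro hle
          rw [if_pos hle, h0] at h36
          exact absurd h36.symm (pow_pos (by omega) _).ne'
        obtain rfl : i = depth V + 1 := by omega
        exact ⟨⟨hi.regs.congr fun _ _ => rfl, hi.filled, hi.r33, hi.r34⟩, hd⟩
      · refine ⟨0, by omega, ⟨hinv.regs.congr fun r hr => ?_, hinv.filled, ?_, ?_⟩, ?_, ?_, ?_, ?_,
          ?_⟩
        · simp (disch := omega) only [Function.update_apply, if_neg]
        · simpa [Function.update_apply] using hinv.r33
        · simpa [Function.update_apply] using hinv.r34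
        all_goals simp
    · rintro t' ⟨hi, hd'⟩
      have m6 : (k + 1) % V ^ 10 = k + 1 := Nat.mod_eq_of_lt (by omega)
      have m7 : (V * V - k - 1) % V ^ 10 = V * V - k - 1 := Nat.mod_eq_of_lt (by omega)
      simp only [hi.r33, hi.r34, hi.regs.r30, m6, m7]
      refine ⟨k + 1, by omega, ⟨hi.regs.congr fun r hr => ?_, hi.filled.congr ?_, ?_, ?_⟩, hd'⟩
      · simp (disch := omega) only [Function.update_apply, if_neg]
      · intro j hj e _ hs
        omega
      · simp
      · simp [Nat.sub_sub]
  · rintro m t ⟨k, hm, hinv, hd⟩ h0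
    rw [hinv.r34] at h0
    refine ⟨hinv.regs.congr fun _ _ => rfl, hinv.filled.congr ?_⟩
    intro j hj e he hs
    omega
  · refine ⟨0, by omega, ⟨h.congr fun r hr => ?_, ?_, ?_, ?_⟩, hdr⟩
    · simp (disch := omega) only [Function.update_apply, if_neg]
    · simp only [hmem, hval]
      refine ⟨?_, ?_, ?_, ?_, ?_, fun _ _ => rfl, ?_, fun _ _ => rfl⟩ <;>
        exact fun j _ e _ hs => absurd hs (by omega)
    · simp
    · simp

/-- The order of the elements when the first `k` of them have been joined to their successors. -/
def rotStage (V k e : ℕ) : ℕ := if e < k then e + V else if e < k + V then e % V else e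

theorem rotStage_zero (V e : ℕ) : rotStage V 0 e = e := by
  unfold rotStage
  split_ifs with h1 h2
  · omega
  · exact Nat.mod_eq_of_lt (by omega)
  · rfl

theorem rotStage_succ (hV : 0 < V) (k e : ℕ) :
    exchange (rotStage V k) k (k + V) e = rotStage V (k + 1) e := by
  unfold exchange rotStage
  by_cases h1 : e = k
  · subst h1; simp
  · by_cases h2 : e = k + V
    · subst h2
      rw [if_neg (by omega), if_pos rfl, if_neg (by omega), if_pos (by omega), if_neg (by omega),
        if_pos (by omega), Nat.add_mod_right]
    · rw [if_neg h1, if_neg h2]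
      split_ifs <;> first | rfl | omega

theorem rotStage_last {e : ℕ} (he : e < V * V) :
    rotStage V (V * V - V) e = tour (⊥ : SimpleGraph (Fin V)) e := by
  have hV : 0 < V := by
    rcases Nat.eq_zero_or_pos V with rfl | h
    · simp at he
    · exact h
  have hVE : V ≤ V * V := Nat.le_mul_self V
  have hflip : flip (⊥ : SimpleGraph (Fin V)) e = e := by simp [flip]
  rw [tour, hflip, rot, rotStage]
  split_ifs with h1 h2
  · rw [Nat.mod_eq_of_lt (by omega)]
  · have h3 : e + V = (e + V - V * V) + V * V := by omega
    rw [h3, Nat.add_mod_right, Nat.mod_eq_of_lt (by omega : e + V - V * V < V * V)]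
    have h4 : e = (e + V - V * V) + V * (V - 1) := by rw [Nat.mul_sub_one]; omega
    conv_lhs => rw [h4]
    rw [Nat.add_mul_mod_self_left, Nat.mod_eq_of_lt (by omega)]
  · omega

/-- The sets of elements that are present on the levels. -/
noncomputable def levels (V : ℕ) (ω : Tape) : ℕ → Finset ℕ :=
  lev (V * V) fun e => height (base V) (depth V) (ω.sample e (base V ^ depth V))

theorem mem_levels {i e : ℕ} : e ∈ levels V ω i ↔
    e < V * V ∧ i ≤ depth V ∧ ω.sample e (base V ^ depth V) < base V ^ (depth V - i) := by
  have hb := one_lt_base V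
  rw [levels, mem_lev, le_height (by omega) (sample_lt ω e (pow_pos (by omega) _))]

theorem levels_bound (V : ℕ) (ω : Tape) : ∀ i, ∀ u ∈ levels V ω i, u < V * V ∧ i ≤ depth V :=
  fun _ _ hu => ⟨(mem_levels.1 hu).1, (mem_levels.1 hu).2.1⟩

theorem levels_zero (V : ℕ) (ω : Tape) : levels V ω 0 = Finset.range (V * V) := lev_zero

theorem rotCode_spec (hV : 3 ≤ V) {x : ℕ → D} {s : State D} (h : ParamRegs V s)
    (hfill : Filled V (fun e => ω.sample e (base V ^ depth V)) x (fun _ e => e < V * V)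
      s.mem s.val) :
    Halts (V ^ 10) ω f rotCode s fun t => ∃ sc hd A,
      Repr (V ^ 10) (depth V) (levels V ω) (Forest.edgeless V x) sc hd A t := by
  obtain ⟨hP, hB, hM4⟩ := word_bounds hV
  have hH := levels_bound V ω
  have hEM : V * V ≤ (depth V + 2) * (V * V) := Nat.le_mul_of_pos_left _ (by omega)
  have hVE : V ≤ V * V := Nat.le_mul_self V
  have m1 : (V * V - V) % V ^ 10 = V * V - V := Nat.mod_eq_of_lt (by omega)
  have hmem0 : ∀ e, e ∈ levels V ω 0 ↔ e < V * V := by simp [levels_zero]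
  unfold rotCode
  simp only [halts_seqs_cons, halts_instr, Instr.run, State.put, State.tick,
    Function.update_apply, h.consts.r7, h.consts.r3, h.r2, Nat.reduceEqDiff, reduceIte, add_zero,
    Nat.zero_mod, m1]
  rw [halts_seqs_singleton]
  set A₀ : ℕ → WithOne D := fun e => if e < V then (x e : WithOne D) else 1 with hA₀
  refine halts_loop (k := V * V - V) (fun m t => ∃ k, m + k = V * V - V ∧ ∃ sc hd A,
    Hier (levels V ω) sc hd A ∧ Rep (V ^ 10) (V * V) (depth V) (levels V ω) sc hd A t.mem t.val ∧
    ParamRegs V t ∧ t.reg 33 = k ∧ t.reg 34 = V * V - V - k ∧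
    (∀ e < V * V, sc 0 e = rotStage V k e) ∧ ∀ e < V * V, A 0 e = A₀ e) ?_ ?_ ?_
  · rintro m t ⟨k, hm, sc, hd, A, hier, hr, hp, h33, h34, hs, hA⟩ hne
    rw [h34] at hne
    have m2 : k % V ^ 10 = k := Nat.mod_eq_of_lt (by omega)
    have m3 : (k + V) % V ^ 10 = k + V := Nat.mod_eq_of_lt (by omega)
    have m4 : (k + 1) % V ^ 10 = k + 1 := Nat.mod_eq_of_lt (by omega)
    have m5 : (V * V - V - k - 1) % V ^ 10 = V * V - V - k - 1 := Nat.mod_eq_of_lt (by omega)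
    refine ⟨m - 1, by omega, ?_⟩
    rw [halts_seqs_cons]
    simp only [seqs, halts_seq, halts_instr, Instr.run, State.put, State.tick,
      Function.update_apply, Nat.reduceEqDiff, reduceIte, hp.r2, h33, hp.consts.r7, add_zero,
      m2, m3]
    refine Halts.mono (splice_spec (E := V * V) (L := depth V) (H := levels V ω) (a := k)
      (b := k + V) hM4 hH ((hmem0 k).2 (by omega)) ((hmem0 (k + V)).2 (by omega)) hier hr
      (hp.consts.congr fun r hr => ?_) ?_ ?_) ?_
    · simp (disch := omega) only [Function.update_apply, if_neg]
    · simp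
    · simp
    rintro t' ⟨sc', hd', A', hier', hr', hk', hs', hA', -⟩
    have k33 := hk' 33 (by omega)
    have k34 := hk' 34 (by omega)
    have k30 := hk' 30 (by omega)
    simp only [Function.update_apply, Nat.reduceEqDiff, reduceIte] at k33 k34 k30
    rw [h33] at k33
    rw [h34] at k34
    rw [hp.r30] at k30
    simp only [k33, k34, k30, m4, m5]
    refine ⟨k + 1, by omega, sc', hd', A', hier', hr', hp.congr fun r hr => ?_, ?_, ?_, ?_, ?_⟩
    · simp (disch := omega) only [Function.update_apply, if_neg]
      rw [hk' r (by omega)]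
      simp (disch := omega) only [Function.update_apply, if_neg]
    · simp
    · simp [Nat.sub_sub, add_assoc]
    · intro e he
      rw [hs' e ((hmem0 e).2 he), ← rotStage_succ (by omega)]
      unfold exchange
      rw [hs _ he, hs k (by omega), hs (k + V) (by omega)]
    · intro e he
      rw [hA' e ((hmem0 e).2 he), hA e he]
  · rintro m t ⟨k, hm, sc, hd, A, hier, hr, hp, h33, h34, hs, hA⟩ h0
    rw [h34] at h0
    obtain rfl : k = V * V - V := by omega
    refine ⟨sc, hd, A, hier, hr, hp.consts.congr fun _ _ => rfl, hp.r2, fun e he => ?_, fun v => ?_,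
      fun e he hVe => ?_, SimpleGraph.isAcyclic_bot⟩
    · rw [hs e he, rotStage_last he]; rfl
    · rw [hA v (v.2.trans_le hVE), hA₀]
      simp [Forest.edgeless]
    · rw [hA e he, hA₀]
      simp only [if_neg (show ¬ e < V by omega)]
  · refine ⟨0, by omega, fun _ u => u, fun _ u => u, fun _ u => A₀ u, ?_, ?_,
      h.congr fun r hr => ?_, ?_, ?_, ?_, ?_⟩
    · have anti : ∀ i, levels V ω (i + 1) ⊆ levels V ω i := fun i => lev_anti i
      refine ⟨anti, ⟨fun u hu => hu, fun u _ v _ h => h⟩, fun i => ⟨fun u hu => hu,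
        fun u _ => Seg.refl u, fun _ _ _ => rfl, fun u _ hu => ⟨hu, rfl⟩⟩, ?_⟩
      rintro i r ⟨u, hu, rfl⟩
      rw [Finset.filter_eq' , if_pos hu, Finset.prod_singleton]
    · have hb := one_lt_base V
      refine ⟨fun i u hu => ?_, fun i u hu => ?_, fun i hi u hu => ?_, fun i hi u hu => ?_,
        fun i hi u hu => ?_⟩
      · exact hfill.nxt i (hH i u hu).2 u (hH i u hu).1 (hH i u hu).1
      · exact hfill.par i (hH i u hu).2 u (hH i u hu).1 (hH i u hu).1
      · simp only [mem_levels]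
        rcases Nat.lt_or_ge (depth V) i with hlt | hle
        · obtain rfl : i = depth V + 1 := by omega
          rw [hfill.top u hu]
          refine ⟨by omega, by simp⟩
        · rw [hfill.real i hle u hu hu]
          have : base V ^ (depth V - i) ≤ base V ^ depth V :=
            Nat.pow_le_pow_right (by omega) (by omega)
          refine ⟨by omega, ?_⟩
          simp only [hu, hle, true_and]
          omega
      · simp only
        rcases Nat.lt_or_ge (depth V) i with hlt | hle
        · obtain rfl : i = depth V + 1 := by omega
          rw [hfill.flag' (depth V) le_rfl u hu hu]
          omega
        · rw [hfill.flag i hle u hu hu]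
          omega
      · have hfl : s.mem (i * (V * V) + u + 3 * ((depth V + 2) * (V * V))) = V - u := by
          rcases Nat.lt_or_ge (depth V) i with hlt | hle
          · obtain rfl : i = depth V + 1 := by omega
            exact hfill.flag' (depth V) le_rfl u hu hu
          · exact hfill.flag i hle u hu hu
        simp only [aggAt, hfl, hA₀]
        by_cases huV : u < V
        · rw [if_pos huV, if_neg (by omega)]
          rcases Nat.eq_zero_or_pos i with rfl | hi0
          · rw [zero_mul, zero_add, hfill.val0 u huV]
          · obtain ⟨j, rfl⟩ : ∃ j, i = j + 1 := ⟨i - 1, by omega⟩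
            rw [hfill.val j (by omega) u huV hu]
        · rw [if_neg huV, if_pos (by omega)]
    · simp (disch := omega) only [Function.update_apply, if_neg]
    · simp
    · simp
    · intro e _; rw [rotStage_zero]
    · intro e _; rfl

theorem setupCode_spec (hV : 3 ≤ V) (x : ℕ → D) :
    Halts (V ^ 10) ω f setupCode (blank V x) fun t => ∃ sc hd A,
      Repr (V ^ 10) (depth V) (levels V ω) (Forest.edgeless V x) sc hd A t := by
  unfold setupCode
  rw [halts_seqs_cons]
  refine (paramsCode_spec hV x).mono ?_
  rintro t₁ ⟨h1, h2, h3, h4⟩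
  rw [halts_seqs_cons]
  refine (rowsCode_spec hV h1 h2 h3 h4).mono ?_
  rintro t₂ ⟨h5, h6⟩
  exact rotCode_spec hV h5 h6

end Rows

/-! ### Correctness of the operations -/

/-- Tours of the trees, cut into chunks of expected length `base V` on each of `depth V` levels. -/
def tourStructure : DataStructure where
  wordExp := 10
  setup := setupCode
  root := rootCode
  update := updateCode
  link := linkCode
  cut := linkCode

section Operations

variable {D : Type u} [CommSemigroup D] {ω : Tape} {f : D → D} {V : ℕ} {F : Forest V D}
  {sc hd : ℕ → ℕ → ℕ} {A : ℕ → ℕ → WithOne D} {st : State D} {w y : ℝ}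

/-- The total number of elements near the darts between `a` and `b`. -/
noncomputable def nearSum (ω : Tape) (F : Forest V D) (a b : Fin V) : ℕ :=
  ∑ j ∈ Finset.range (depth V + 1),
    nearCount (V * V) (levels V ω) (tour F.graph) (dart V a b) (dart V b a) j

/-- A bound on the time of an operation, in units of the time for handling a value. -/
noncomputable def Op.cost (ω : Tape) (F : Forest V D) : Op V D → ℕ
  | .root _ => 5 * (depth V + 2)
  | .update _ _ => 6 * (depth V + 2)
  | .link a b => 84 * nearSum ω F a b + 60 * (depth V + 1) + 20
  | .cut a b => 84 * nearSum ω F a b + 60 * (depth V + 1) + 20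

/-- The time for handling a value during an operation. -/
def Op.weight (w y : ℝ) : Op V D → ℝ
  | .root _ => 1
  | .update _ _ => w
  | .link _ _ => y
  | .cut _ _ => y

omit [CommSemigroup D] in
theorem Op.start_reg (o : Op V D) (s : State D) {r : ℕ} (hr : 2 ≤ r) :
    (o.start s).reg r = s.reg r := by
  have h0 : r ≠ 0 := by omega
  have h1 : r ≠ 1 := by omega
  cases o <;> simp [Op.start, h0, h1]

theorem levels_eq_empty (V : ℕ) (ω : Tape) (i : ℕ) (hi : depth V < i) : levels V ω i = ∅ :=
  Finset.eq_empty_of_forall_notMem fun u hu => by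
    have := (levels_bound V ω i u hu).2
    omega

theorem node_mem (ω : Tape) (v : Fin V) : (v : ℕ) ∈ levels V ω 0 := by
  rw [levels_zero, Finset.mem_range]
  exact v.2.trans_le (Nat.le_mul_self V)

theorem Repr.root (hV : 3 ≤ V) (h : Repr (V ^ 10) (depth V) (levels V ω) F sc hd A st) (v : Fin V) :
    Halts (V ^ 10) ω f rootCode ((Op.root v : Op V D).start st) fun t =>
      Repr (V ^ 10) (depth V) (levels V ω) F sc hd A t ∧
      (∃ r : ℕ × ℕ, IsRoot (levels V ω) hd (0, (v : ℕ)) r ∧ t.reg 0 = r.1 * (V * V) + r.2) ∧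
      t.time w y ≤ (Op.root v : Op V D).weight w y * (Op.root v : Op V D).cost ω F := by
  have hv := Finset.mem_range.1 (levels_zero V ω ▸ node_mem ω v)
  refine (rootCode_spec (word_bounds hV).2.2 (levels_bound V ω) h.hier
    (st := (Op.root v : Op V D).start st) h.rep
    (h.consts.congr fun r hr => Op.start_reg _ _ (by omega)) hv (by simp [Op.start])).mono ?_
  rintro t ⟨r, hr, h0, e1, e2, e3, e4, e5, e6⟩
  have k2 := e3 2 (by omega) (by omega)
  rw [Op.start_reg _ _ le_rfl, h.r2] at k2
  refine ⟨⟨h.hier, ?_, h.consts.congr fun r hr => ?_, k2, h.tour, h.value, h.one, h.acyclic⟩,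
    ⟨r, hr, h0⟩, ?_⟩
  · rw [e1, e2]; exact h.rep
  · rw [e3 r (by omega) hr.2, Op.start_reg _ _ (by omega)]
  · have e4' : t.modifications = 0 := e4
    have e5' : t.aggregations = 0 := e5
    have e6' : t.steps ≤ 5 * (depth V + 2) := by simpa [Op.start] using e6
    simp only [State.time, e4', e5', Op.weight, Op.cost, one_mul, Nat.cast_zero, mul_zero, add_zero]
    exact_mod_cast e6'

theorem Repr.update (hV : 3 ≤ V) (h : Repr (V ^ 10) (depth V) (levels V ω) F sc hd A st)
    (hw : 1 ≤ w) {v : Fin V} (hval : (Op.update v f).Valid F) :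
    Halts (V ^ 10) ω f updateCode ((Op.update v f).start st) fun t =>
      (∃ A', Repr (V ^ 10) (depth V) (levels V ω) ((Op.update v f).apply F) sc hd A' t) ∧
      t.time w y ≤ (Op.update v f).weight w y * (Op.update v f).cost ω F := by
  refine (updateCode_spec (word_bounds hV).2.2 (levels_bound V ω) h.hier
    (st := (Op.update v f).start st) h.rep
    (h.consts.congr fun r hr => Op.start_reg _ _ (by omega)) (node_mem ω v) (by simp [Op.start])
    (h.value v) hval).mono ?_
  rintro t ⟨A', hier, hr, hA1, hA2, e1, e3, e4, e5, e6⟩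
  have k2 := e3 2 (by omega) (by omega)
  rw [Op.start_reg _ _ le_rfl, h.r2] at k2
  refine ⟨⟨A', hier, hr, h.consts.congr fun r hr => ?_, k2, h.tour, fun u => ?_,
    fun e he hVe => ?_, h.acyclic⟩, ?_⟩
  · rw [e3 r (by omega) hr.2, Op.start_reg _ _ (by omega)]
  · by_cases huv : u = v
    · subst huv; simp [Op.apply, hA1]
    · rw [hA2 u fun h' => huv (Fin.ext h'), h.value u]
      simp [Op.apply, huv]
  · rw [hA2 e (by have := v.2; omega), h.one e he hVe]
  · have e4' : t.modifications ≤ depth V + 2 := by simpa [Op.start] using e4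
    have e5' : t.aggregations = 0 := e5
    have e6' : t.steps ≤ 5 * (depth V + 2) := by simpa [Op.start] using e6
    simp only [State.time, e5', Op.weight, Op.cost, Nat.cast_zero, mul_zero, add_zero]
    have r4 : (t.modifications : ℝ) ≤ depth V + 2 := by exact_mod_cast e4'
    have r6 : (t.steps : ℝ) ≤ 5 * (depth V + 2) := by exact_mod_cast e6'
    push_cast
    have : (0 : ℝ) ≤ depth V + 2 := by positivity
    nlinarith [mul_le_mul_of_nonneg_left r4 (by linarith : (0 : ℝ) ≤ w)]

/-- Links and cuts both exchange the successors of the two darts of the edge. -/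
theorem Repr.exchange (hV : 3 ≤ V) (h : Repr (V ^ 10) (depth V) (levels V ω) F sc hd A st)
    (hy : 1 ≤ y) {a b : Fin V} {G' : SimpleGraph (Fin V)} (hG' : G'.IsAcyclic)
    (ht : ∀ e < V * V,
      AugTree.tour G' e = AugTree.exchange (AugTree.tour F.graph) (dart V a b) (dart V b a) e) :
    Halts (V ^ 10) ω f linkCode ((Op.link a b : Op V D).start st) fun t =>
      (∃ sc' hd' A', Repr (V ^ 10) (depth V) (levels V ω) { F with graph := G' } sc' hd' A' t) ∧
      t.time w y ≤ y * (84 * nearSum ω F a b + 60 * (depth V + 1) + 20 : ℕ) := by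
  obtain ⟨hP, hB, hM4⟩ := word_bounds hV
  have hab := dart_lt a b
  have hba := dart_lt b a
  have hmem0 : ∀ e, e ∈ levels V ω 0 ↔ e < V * V := by simp [levels_zero]
  have hEM : V * V ≤ (depth V + 2) * (V * V) := Nat.le_mul_of_pos_left _ (by omega)
  have m1 : (b * V : ℕ) % V ^ 10 = b * V := Nat.mod_eq_of_lt (by unfold dart at hab; omega)
  have m2 : (a * V : ℕ) % V ^ 10 = a * V := Nat.mod_eq_of_lt (by unfold dart at hba; omega)
  have m3 : (b * V + a : ℕ) % V ^ 10 = b * V + a :=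
    Nat.mod_eq_of_lt (by unfold dart at hab; omega)
  have m4 : (a * V + b : ℕ) % V ^ 10 = a * V + b :=
    Nat.mod_eq_of_lt (by unfold dart at hba; omega)
  set o : Op V D := Op.link a b with ho
  have s0 : (o.start st).reg 0 = a := by simp [ho, Op.start]
  have s1 : (o.start st).reg 1 = b := by simp [ho, Op.start]
  have s2 : (o.start st).reg 2 = V := by rw [Op.start_reg _ _ le_rfl, h.r2]
  unfold linkCode
  simp only [halts_seqs_cons, halts_instr, Instr.run, State.put, State.tick,
    Function.update_apply, s0, s1, s2, Nat.reduceEqDiff, reduceIte, m1, m2, m3, m4]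
  rw [halts_seqs_singleton]
  refine Halts.mono (splice_spec (E := V * V) (L := depth V) (H := levels V ω)
    (a := dart V a b) (b := dart V b a) hM4 (levels_bound V ω) ((hmem0 _).2 hab) ((hmem0 _).2 hba)
    h.hier h.rep (h.consts.congr fun r hr => ?_) ?_ ?_) ?_
  · simp (disch := omega) only [Function.update_apply, if_neg]
    exact Op.start_reg _ _ (by omega)
  · simp [dart]
  · simp [dart]
  rintro t ⟨sc', hd', A', hier', hr', hk, hs', hA', e3, e4, e5, e6⟩
  have keep : ∀ r, 2 ≤ r ∧ r < 10 → t.reg r = st.reg r := by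
    intro r hr
    rw [hk r (by omega)]
    simp (disch := omega) only [Function.update_apply, if_neg]
    exact Op.start_reg _ _ hr.1
  have hVE := Nat.le_mul_self V
  refine ⟨⟨sc', hd', A', hier', hr', h.consts.congr fun r hr => keep r (by omega),
    (keep 2 (by omega)).trans h.r2, fun e he => ?_, fun v => ?_, fun e he hVe => ?_, hG'⟩, ?_⟩
  · rw [hs' e ((hmem0 e).2 he), ht e he]
    unfold AugTree.exchange
    rw [h.tour _ hab, h.tour _ hba, h.tour e he]
  · rw [hA' v (node_mem ω v), h.value v]
  · rw [hA' e ((hmem0 e).2 he), h.one e he hVe]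
  · have hnear : ∀ j, nearCount (V * V) (levels V ω) (sc 0) (dart V a b) (dart V b a) j =
        nearCount (V * V) (levels V ω) (AugTree.tour F.graph) (dart V a b) (dart V b a) j := by
      intro j
      have key : ∀ c < V * V, ∀ u, Near (levels V ω) (sc 0) j c u ↔
          Near (levels V ω) (AugTree.tour F.graph) j c u := by
        intro c hc u
        have hp := h.hier.perm0
        have he : ∀ u ∈ levels V ω 0, sc 0 u = AugTree.tour F.graph u :=
          fun u hu => h.tour u ((hmem0 u).1 hu)
        refine and_congr_right fun hu => or_congr (Seg.congr hp ((hmem0 c).2 hc) he)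
          (Seg.congr hp ((hmem0 u).2 (levels_bound V ω _ u hu).1) he)
      unfold nearCount
      rw [funext fun u => propext (key _ hab u), funext fun u => propext (key _ hba u)]
    dsimp only at e5 e6
    rw [Finset.sum_congr rfl fun j _ => congrArg (fun n => 80 * n + 60) (hnear j)] at e5
    rw [Finset.sum_congr rfl fun j _ => congrArg (fun n => 4 * n) (hnear j)] at e6
    have e4' : t.modifications = 0 := e4
    have h80 : ∑ j ∈ Finset.range (depth V + 1), (80 * nearCount (V * V) (levels V ω)
        (AugTree.tour F.graph) (dart V a b) (dart V b a) j + 60) =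
        80 * nearSum ω F a b + 60 * (depth V + 1) := by
      rw [Finset.sum_add_distrib, ← Finset.mul_sum, Finset.sum_const, Finset.card_range, nearSum,
        smul_eq_mul, mul_comm 60]
    rw [h80] at e5
    rw [← Finset.mul_sum] at e6
    have z1 : (o.start st).steps = 0 := rfl
    have z2 : (o.start st).aggregations = 0 := rfl
    rw [z1] at e5
    rw [z2] at e6
    have e5' : (t.steps : ℝ) ≤ 80 * nearSum ω F a b + 60 * (depth V + 1) + 20 := by
      have : t.steps ≤ 80 * nearSum ω F a b + 60 * (depth V + 1) + 20 := by omega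
      exact_mod_cast this
    have e6' : (t.aggregations : ℝ) ≤ 4 * nearSum ω F a b := by
      have : t.aggregations ≤ 4 * nearSum ω F a b := by
        simpa [nearSum] using e6
      exact_mod_cast this
    simp only [State.time, e4', Nat.cast_zero, mul_zero, add_zero]
    push_cast
    have hpos : (0 : ℝ) ≤ 80 * nearSum ω F a b + 60 * (depth V + 1) + 20 := by positivity
    nlinarith [mul_le_mul_of_nonneg_left e6' (by linarith : (0 : ℝ) ≤ y)]

theorem Repr.link (hV : 3 ≤ V) (h : Repr (V ^ 10) (depth V) (levels V ω) F sc hd A st)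
    (hy : 1 ≤ y) {a b : Fin V} (hval : (Op.link a b : Op V D).Valid F) :
    Halts (V ^ 10) ω f linkCode ((Op.link a b : Op V D).start st) fun t =>
      (∃ sc' hd' A', Repr (V ^ 10) (depth V) (levels V ω) ((Op.link a b).apply F) sc' hd' A' t) ∧
      t.time w y ≤ (Op.link a b : Op V D).weight w y * (Op.link a b : Op V D).cost ω F := by
  have hnr : ¬ F.graph.Reachable a b := hval
  have hne : a ≠ b := fun hab => hnr (hab ▸ SimpleGraph.Reachable.refl a)
  refine h.exchange hV hy (h.acyclic.sup_edge_of_not_reachable hnr) fun e he =>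
    tour_link (fun hadj => hnr hadj.reachable) (fun x z => ?_) he
  rw [SimpleGraph.sup_adj, SimpleGraph.edge_adj]
  refine or_congr Iff.rfl ⟨fun h => h.1, fun h => ⟨h, ?_⟩⟩
  rcases h with ⟨rfl, rfl⟩ | ⟨rfl, rfl⟩
  exacts [hne, hne.symm]

theorem Repr.cut (hV : 3 ≤ V) (h : Repr (V ^ 10) (depth V) (levels V ω) F sc hd A st)
    (hy : 1 ≤ y) {a b : Fin V} (hval : (Op.cut a b : Op V D).Valid F) :
    Halts (V ^ 10) ω f linkCode ((Op.cut a b : Op V D).start st) fun t =>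
      (∃ sc' hd' A', Repr (V ^ 10) (depth V) (levels V ω) ((Op.cut a b).apply F) sc' hd' A' t) ∧
      t.time w y ≤ (Op.cut a b : Op V D).weight w y * (Op.cut a b : Op V D).cost ω F := by
  have hadj : F.graph.Adj a b := hval
  have hdel : ∀ x z, (F.graph.deleteEdges {s(a, b)}).Adj x z ↔
      F.graph.Adj x z ∧ ¬ ((x = a ∧ z = b) ∨ (x = b ∧ z = a)) := by
    intro x z
    rw [SimpleGraph.deleteEdges_adj, Set.mem_singleton_iff, Sym2.eq_iff]
  have htour : ∀ e < V * V, AugTree.tour F.graph e = AugTree.exchange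
      (AugTree.tour (F.graph.deleteEdges {s(a, b)})) (dart V a b) (dart V b a) e := by
    intro e he
    refine tour_link (fun h' => ((hdel a b).1 h').2 (Or.inl ⟨rfl, rfl⟩)) (fun x z => ?_) he
    rw [hdel]
    constructor
    · intro h'
      by_cases hc : (x = a ∧ z = b) ∨ (x = b ∧ z = a)
      · exact Or.inr hc
      · exact Or.inl ⟨h', hc⟩
    · rintro (h' | ⟨rfl, rfl⟩ | ⟨rfl, rfl⟩)
      exacts [h'.1, hadj, hadj.symm]
  refine h.exchange hV hy (h.acyclic.anti (SimpleGraph.deleteEdges_le _)) fun e he => ?_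
  -- Exchanging twice changes nothing.
  unfold AugTree.exchange
  rw [htour _ (dart_lt a b), htour _ (dart_lt b a), htour e he]
  unfold AugTree.exchange
  by_cases h1 : e = dart V a b
  · subst h1
    by_cases h2 : dart V b a = dart V a b
    · simp [h2]
    · simp [h2]
  · by_cases h2 : e = dart V b a
    · subst h2; simp [h1]
    · simp [h1, h2]

theorem Repr.step (hV : 3 ≤ V) (h : Repr (V ^ 10) (depth V) (levels V ω) F sc hd A st)
    (hw : 1 ≤ w) (hy : 1 ≤ y) {o : Op V D} (hval : o.Valid F) :
    Halts (V ^ 10) ω o.modifier (tourStructure.code o) (o.start st) fun t =>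
      (∃ sc' hd' A', Repr (V ^ 10) (depth V) (levels V ω) (o.apply F) sc' hd' A' t) ∧
      t.time w y ≤ o.weight w y * o.cost ω F := by
  cases o with
  | root v =>
    refine (h.root (w := w) (y := y) hV v).mono ?_
    rintro t ⟨h', -, ht⟩
    exact ⟨⟨sc, hd, A, h'⟩, ht⟩
  | update v f =>
    refine (h.update (y := y) hV hw hval).mono ?_
    rintro t ⟨⟨A', h'⟩, ht⟩
    exact ⟨⟨sc, hd, A', h'⟩, ht⟩
  | link a b => exact h.link hV hy hval
  | cut a b => exact h.cut hV hy hval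

/-- Root finding and value updates keep the tree structure. -/
theorem Repr.step_keepsEdges (hV : 3 ≤ V)
    (h : Repr (V ^ 10) (depth V) (levels V ω) F sc hd A st) {o : Op V D} (hval : o.Valid F)
    (ho : o.KeepsEdges) :
    Halts (V ^ 10) ω o.modifier (tourStructure.code o) (o.start st) fun t =>
      ∃ A', Repr (V ^ 10) (depth V) (levels V ω) (o.apply F) sc hd A' t := by
  cases o with
  | root v => exact (h.root (w := 1) (y := 1) hV v).mono fun t ht => ⟨A, ht.1⟩
  | update v f => exact (h.update (w := 1) (y := 1) hV le_rfl hval).mono fun t ht => ht.1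
  | link a b => exact ho.elim
  | cut a b => exact ho.elim

theorem Repr.orb_iff (h : Repr (V ^ 10) (depth V) (levels V ω) F sc hd A st) (a b : Fin V) :
    Orb (levels V ω 0) (sc 0) a b ↔ F.graph.Reachable a b := by
  rw [levels_zero]
  constructor
  · intro ho
    refine reachable_of_orb (ho.congr fun u hu => h.tour u (Finset.mem_range.1 hu))
      (Nat.mod_eq_of_lt a.2) (Nat.mod_eq_of_lt b.2)
  · intro hr
    exact ((orb_of_acyclic h.acyclic).2 a b hr).congr
      fun u hu => (h.tour u (Finset.mem_range.1 hu)).symm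

theorem Repr.aggregate (h : Repr (V ^ 10) (depth V) (levels V ω) F sc hd A st) {v : Fin V}
    {r : ℕ × ℕ} (hr : IsRoot (levels V ω) hd (0, (v : ℕ)) r) :
    (st.val (r.1 * (V * V) + r.2) : WithOne D) = F.aggregate v := by
  classical
  have hbd := Climb.bounds (levels_bound V ω) h.hier (v := v) (j := r.1) (x := r.2)
    (Finset.mem_range.1 (levels_zero V ω ▸ node_mem ω v)) hr.1
  have h1 := h.hier.agg_root (levels_eq_empty V ω) (node_mem ω v) hr
  have h2 : F.aggregate v = A r.1 r.2 := by
    rw [h1, Forest.aggregate]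
    refine Finset.prod_of_injOn (fun x : Fin V => (x : ℕ)) (fun x _ z _ hxz => Fin.ext hxz)
      (fun x hx => ?_) (fun e he hne => ?_) fun x _ => (h.value x).symm
    · have hx := (Finset.mem_filter.1 hx).2
      exact Finset.mem_filter.2 ⟨node_mem ω x, (h.orb_iff v x).2 hx⟩
    · obtain ⟨he, ho⟩ := Finset.mem_filter.1 he
      rw [levels_zero] at he
      refine h.one e (Finset.mem_range.1 he) ?_
      by_contra hlt
      refine hne ⟨⟨e, by omega⟩, ?_, rfl⟩
      exact Finset.mem_coe.2 (Finset.mem_filter.2 ⟨Finset.mem_univ _, (h.orb_iff v _).1 ho⟩)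
  -- The aggregate has a factor in `D`, so the root has a value.
  have h3 : F.aggregate v ≠ 1 := by
    rw [Forest.aggregate, ← Finset.mul_prod_erase _ _
      (Finset.mem_filter.2 ⟨Finset.mem_univ v, SimpleGraph.Reachable.refl v⟩)]
    generalize ∏ x ∈ _, (F.value x : WithOne D) = R
    induction R using WithOne.recOneCoe with
    | one => rw [mul_one]; exact WithOne.coe_ne_one
    | coe r => rw [← WithOne.coe_mul]; exact WithOne.coe_ne_one
  have h4 := h.rep.agg r.1 hbd.2 r.2 hbd.1
  rw [← h2, aggAt] at h4
  split_ifs at h4 with h5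
  · exact absurd h4 h3
  · exact h4.symm

end Operations

/-! ### Correctness for sequences of operations -/

section Runs

variable {D : Type u} [CommSemigroup D] {V : ℕ} {ω : Tape}

theorem Halts.of_exec {N : ℕ} {f : D → D} {c : Cmd} {s t : State D} {Q : State D → Prop}
    (h : Halts N ω f c s Q) (ht : Exec N ω f c s t) : Q t := by
  obtain ⟨t', h', hQ⟩ := h
  exact h'.unique ht ▸ hQ

section

variable {P : DataStructure}

theorem runs_append {l₁ l₂ : List (Op V D)} {s t : State D} :
    P.Runs ω s (l₁ ++ l₂) t ↔ ∃ u, P.Runs ω s l₁ u ∧ P.Runs ω u l₂ t := by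
  induction l₁ generalizing s with
  | nil => simp [DataStructure.Runs]
  | cons o l ih =>
    simp only [List.cons_append, DataStructure.Runs, ih]
    exact ⟨fun ⟨u, h1, v, h2, h3⟩ => ⟨v, ⟨u, h1, h2⟩, h3⟩,
      fun ⟨v, ⟨u, h1, h2⟩, h3⟩ => ⟨u, h1, v, h2, h3⟩⟩

theorem runs_unique {l : List (Op V D)} {s t t' : State D} (h : P.Runs ω s l t)
    (h' : P.Runs ω s l t') : t = t' := by
  induction l generalizing s with
  | nil => exact Eq.trans (Eq.symm h) h'
  | cons o l ih =>
    obtain ⟨u, hu, h⟩ := h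
    obtain ⟨u', hu', h'⟩ := h'
    rw [← hu.unique hu'] at h'
    exact ih h h'

theorem reaches_append {x : ℕ → D} {l₁ l₂ : List (Op V D)} {t : State D} :
    P.Reaches ω x (l₁ ++ l₂) t ↔ ∃ u, P.Reaches ω x l₁ u ∧ P.Runs ω u l₂ t := by
  simp only [DataStructure.Reaches, runs_append]
  exact ⟨fun ⟨s, h, u, h1, h2⟩ => ⟨u, ⟨s, h, h1⟩, h2⟩, fun ⟨u, ⟨s, h, h1⟩, h2⟩ => ⟨s, h, u, h1, h2⟩⟩

theorem reaches_unique {x : ℕ → D} {l : List (Op V D)} {t t' : State D} (h : P.Reaches ω x l t)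
    (h' : P.Reaches ω x l t') : t = t' := by
  obtain ⟨s, hs, h⟩ := h
  obtain ⟨s', hs', h'⟩ := h'
  rw [← hs.unique hs'] at h'
  exact runs_unique h h'

end

theorem Forest.validSeq_append {F : Forest V D} {l₁ l₂ : List (Op V D)} :
    F.ValidSeq (l₁ ++ l₂) ↔ F.ValidSeq l₁ ∧ (F.after l₁).ValidSeq l₂ := by
  induction l₁ generalizing F with
  | nil => simp [Forest.ValidSeq, Forest.after]
  | cons o l ih =>
    rw [List.cons_append, Forest.ValidSeq, Forest.ValidSeq, ih, and_assoc]
    rfl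

theorem exists_runs (hV : 3 ≤ V) {F : Forest V D} {st : State D} {l : List (Op V D)}
    (h : ∃ sc hd A, Repr (V ^ 10) (depth V) (levels V ω) F sc hd A st) (hl : F.ValidSeq l) :
    ∃ t, tourStructure.Runs ω st l t ∧
      ∃ sc hd A, Repr (V ^ 10) (depth V) (levels V ω) (F.after l) sc hd A t := by
  induction l generalizing F st with
  | nil => exact ⟨st, rfl, h⟩
  | cons o l ih =>
    obtain ⟨sc, hd, A, h⟩ := h
    obtain ⟨t, ht, h', -⟩ := h.step (w := 1) (y := 1) hV le_rfl le_rfl hl.1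
    obtain ⟨t', hr, h''⟩ := ih h' hl.2
    exact ⟨t', ⟨t, ht, hr⟩, h''⟩

theorem exists_reaches (hV : 3 ≤ V) (x : ℕ → D) {l : List (Op V D)}
    (hl : (Forest.edgeless V x).ValidSeq l) :
    ∃ t, tourStructure.Reaches ω x l t ∧ ∃ sc hd A,
      Repr (V ^ 10) (depth V) (levels V ω) ((Forest.edgeless V x).after l) sc hd A t := by
  obtain ⟨s, hs, h⟩ := setupCode_spec (ω := ω) (f := id) hV x
  obtain ⟨t, ht, h'⟩ := exists_runs hV h hl
  exact ⟨t, ⟨s, hs, ht⟩, h'⟩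

theorem Repr.runs_keepsEdges (hV : 3 ≤ V) {F : Forest V D} {sc hd : ℕ → ℕ → ℕ}
    {A : ℕ → ℕ → WithOne D} {st t : State D} {l : List (Op V D)}
    (h : Repr (V ^ 10) (depth V) (levels V ω) F sc hd A st) (hl : F.ValidSeq l)
    (hk : ∀ o ∈ l, o.KeepsEdges) (hr : tourStructure.Runs ω st l t) :
    ∃ A', Repr (V ^ 10) (depth V) (levels V ω) (F.after l) sc hd A' t := by
  induction l generalizing F A st with
  | nil => obtain rfl : st = t := hr; exact ⟨A, h⟩
  | cons o l ih =>
    obtain ⟨u, hu, hr⟩ := hr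
    obtain ⟨A', h'⟩ := (h.step_keepsEdges hV hl.1 (hk o (by simp))).of_exec hu
    exact ih h' hl.2 (fun o ho => hk o (by simp [ho])) hr

/-- Correctness holds for every random tape; only the running time depends on the samples. -/
theorem tourStructure_solves (hV : 3 ≤ V) (x : ℕ → D) (ω : Tape) :
    tourStructure.Solves V x ω where
  halts l hl := (exists_reaches hV x hl).imp fun _ h => h.1
  root_eq_iff pre mid a b s t hval hmid hs ht := by
    obtain ⟨hpre, -, hval⟩ := Forest.validSeq_append.1 hval
    obtain ⟨hval, -⟩ := Forest.validSeq_append.1 hval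
    obtain ⟨s₀, hs₀, sc, hd, A, h⟩ := exists_reaches (ω := ω) hV x hpre
    have hs' := reaches_append.1 hs
    rw [List.append_cons, reaches_append] at ht
    obtain ⟨s', hs1, ht⟩ := ht
    rw [← reaches_unique hs hs1] at ht
    obtain ⟨s₁, hs₁, s₂, hs₂, e⟩ := hs'
    obtain rfl : s₂ = s := e
    rw [← reaches_unique hs₀ hs₁] at hs₂
    obtain ⟨t', hm, t₂, hb, e⟩ := runs_append.1 ht
    obtain rfl : t₂ = t := e
    obtain ⟨h1, ⟨ra, hra, ea⟩, -⟩ := (h.root (w := 1) (y := 1) hV a).of_exec hs₂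
    obtain ⟨A', h2⟩ := h1.runs_keepsEdges hV hval hmid hm
    obtain ⟨-, ⟨rb, hrb, eb⟩, -⟩ := (h2.root (w := 1) (y := 1) hV b).of_exec hb
    have hbound : ∀ (v : Fin V) (r : ℕ × ℕ), IsRoot (levels V ω) hd (0, (v : ℕ)) r → r.2 < V * V :=
      fun v r hr => (Climb.bounds (levels_bound V ω) h.hier (v := v) (j := r.1) (x := r.2)
        (Finset.mem_range.1 (levels_zero V ω ▸ node_mem ω v)) hr.1).1
    rw [← h.orb_iff, ← h.hier.isRoot_iff_orb (levels_eq_empty V ω) (node_mem ω a) hra, ea, eb]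
    constructor
    · intro he
      obtain ⟨e1, e2⟩ := node_inj (hbound a ra hra) (hbound b rb hrb) he
      rwa [Prod.ext e1 e2]
    · intro hb
      rw [hb.unique hrb]
  root_value pre a s hval hs := by
    obtain ⟨hpre, -⟩ := Forest.validSeq_append.1 hval
    obtain ⟨s₀, hs₀, sc, hd, A, h⟩ := exists_reaches (ω := ω) hV x hpre
    obtain ⟨s₁, hs₁, s₂, hs₂, e⟩ := reaches_append.1 hs
    obtain rfl : s₂ = s := e
    rw [← reaches_unique hs₀ hs₁] at hs₂
    obtain ⟨h1, ⟨r, hr, e⟩, -⟩ := (h.root (w := 1) (y := 1) hV a).of_exec hs₂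
    rw [e]
    exact h1.aggregate hr

end Runs

/-! ### Running times -/

section Bounds

variable {V : ℕ}

theorem lt_two_pow_base (V : ℕ) : V < 2 ^ base V :=
  (Nat.lt_pow_succ_log_self one_lt_two V).trans_le (Nat.pow_le_pow_right two_pos (by unfold base; omega))

theorem one_lt_log (hV : 3 ≤ V) : 1 < Real.log V := by
  rw [Real.lt_log_iff_exp_lt (by positivity)]
  have : (3 : ℝ) ≤ V := by exact_mod_cast hV
  linarith [Real.exp_one_lt_d9]

theorem base_le (hV : 3 ≤ V) : (base V : ℝ) ≤ 4 * Real.log V := by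
  have h1 := one_lt_log hV
  have h2 : ((2 ^ Nat.log 2 V : ℕ) : ℝ) ≤ V := by exact_mod_cast Nat.pow_log_le_self 2 (by omega)
  have h3 := Real.log_le_log (by positivity) h2
  rw [Nat.cast_pow, Real.log_pow] at h3
  push_cast at h3
  have h4 := Real.log_two_gt_d9
  have h5 : (0 : ℝ) ≤ Nat.log 2 V := Nat.cast_nonneg _
  unfold base
  push_cast
  nlinarith

theorem log_le_base (hV : 3 ≤ V) : Real.log V ≤ base V := by
  have h := Real.log_le_log (by positivity) (Nat.cast_le (α := ℝ).2 (lt_two_pow_base V).le)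
  rw [Nat.cast_pow, Real.log_pow] at h
  push_cast at h
  have h4 := Real.log_two_lt_d9
  have h5 : (0 : ℝ) ≤ base V := Nat.cast_nonneg _
  nlinarith

theorem one_le_log_base (hV : 3 ≤ V) : 1 ≤ Real.log (base V) := by
  have h1 : 1 ≤ Nat.log 2 V := Nat.log_pos one_lt_two (by omega)
  exact (one_lt_log (V := base V) (by unfold base; omega)).le

theorem log_base_pos (hV : 3 ≤ V) : 0 < Real.log (Real.log V) := Real.log_pos (one_lt_log hV)

theorem one_le_ratio (hV : 3 ≤ V) : 1 ≤ Real.log V / Real.log (Real.log V) := by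
  rw [one_le_div (log_base_pos hV)]
  linarith [Real.log_le_sub_one_of_pos (zero_lt_one.trans (one_lt_log hV))]

theorem depth_mul_le (hV : 3 ≤ V) : ((depth V : ℝ) - 1) * Real.log (base V) ≤ 2 * Real.log V := by
  have hVV : 1 < V * V := by nlinarith
  have h := Nat.pow_pred_clog_lt_self (one_lt_base V) hVV
  have hd : 0 < depth V := Nat.clog_pos (one_lt_base V) hVV
  have hb := one_lt_base V
  have h' := Real.log_le_log (by positivity) (Nat.cast_le (α := ℝ).2 h.le)
  rw [Nat.cast_pow, Real.log_pow, Nat.cast_mul, Real.log_mul (by positivity) (by positivity),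
    Nat.pred_eq_sub_one] at h'
  change ((depth V - 1 : ℕ) : ℝ) * _ ≤ _ at h'
  rw [Nat.cast_sub hd, Nat.cast_one] at h'
  linarith

theorem depth_le_log (hV : 3 ≤ V) : (depth V : ℝ) ≤ 3 * Real.log V := by
  have h1 := depth_mul_le hV
  have h2 := one_le_log_base hV
  have h3 := one_lt_log hV
  by_contra! h
  nlinarith

theorem depth_le_ratio (hV : 3 ≤ V) :
    (depth V : ℝ) ≤ 3 * (Real.log V / Real.log (Real.log V)) := by
  have h1 := depth_mul_le hV
  have h2 := Real.log_le_log (zero_lt_one.trans (one_lt_log hV)) (log_le_base hV)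
  have h3 := log_base_pos hV
  have h4 := one_le_ratio hV
  by_contra! h
  set X := Real.log V / Real.log (Real.log V) with hX
  have h5 : X * Real.log (Real.log V) = Real.log V := by rw [hX]; field_simp
  nlinarith [mul_le_mul_of_nonneg_left h2 (by linarith : (0 : ℝ) ≤ depth V - 1)]

/-- A change of the tour affects few nodes: on the whole these number twice the number of levels and
the records of four sequences of samples, namely of those met when the tour is followed in either
direction from the two darts. -/
theorem tapeLaw_nearSum_le {D : Type u} (F : Forest V D) (a b : Fin V) (k : ℕ) :
    tapeLaw {ω | 4 * (depth V + 1) + 8 * base V * (depth V + 4 + k) < nearSum ω F a b} ≤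
      (2 ^ k : ENNReal)⁻¹ := by
  classical
  have hσ := tour_permOn F.graph
  set σ := tour F.graph
  obtain ⟨τ, hτ, hinv⟩ := hσ.exists_inverse
  set T := 2 * base V * (depth V + 4 + k) with hT
  set R : List ℕ → Set Tape := fun l => {ω | T ≤ records 0
    (l.map fun e => height (base V) (depth V) (ω.sample e (base V ^ depth V)))} with hR
  have hmem : ∀ a b : Fin V, dart V a b ∈ Finset.range (V * V) :=
    fun a b => Finset.mem_range.2 (dart_lt a b)
  have key : ∀ (f : ℕ → ℕ), PermOn (Finset.range (V * V)) f → ∀ c ∈ Finset.range (V * V),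
      tapeLaw (R (cycle f c)) ≤ (4 * 2 ^ k : ENNReal)⁻¹ := fun f hf c hc => by
    have hlen := cycle_length_le hf hc
    rw [Finset.card_range] at hlen
    exact tapeLaw_records_le (zero_lt_one.trans (one_lt_base V)) cycle_nodup
      (hlen.trans (sq_le_base_pow V)) k
  have hsub : {ω | 4 * (depth V + 1) + 8 * base V * (depth V + 4 + k) < nearSum ω F a b} ⊆
      (R (cycle σ (σ (dart V a b))) ∪ R (cycle τ (dart V a b))) ∪
      (R (cycle σ (σ (dart V b a))) ∪ R (cycle τ (dart V b a))) := by
    intro ω hω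
    by_contra hn
    simp only [hR, Set.mem_union, Set.mem_ofPred_eq, not_or, not_le] at hn hω
    obtain ⟨⟨h1, h2⟩, h3, h4⟩ := hn
    have e1 := sum_near_le (ht := fun e => height (base V) (depth V)
      (ω.sample e (base V ^ depth V))) hσ hτ hinv (hmem a b) (depth V + 1)
    have e2 := sum_near_le (ht := fun e => height (base V) (depth V)
      (ω.sample e (base V ^ depth V))) hσ hτ hinv (hmem b a) (depth V + 1)
    unfold nearSum nearCount levels at hω
    rw [Finset.sum_add_distrib, show tour F.graph = σ from rfl] at hω
    have : 8 * base V * (depth V + 4 + k) = 4 * T := by rw [hT]; ring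
    omega
  calc tapeLaw _ ≤ _ := measure_mono hsub
    _ ≤ (tapeLaw (R (cycle σ (σ (dart V a b)))) + tapeLaw (R (cycle τ (dart V a b)))) +
        (tapeLaw (R (cycle σ (σ (dart V b a)))) + tapeLaw (R (cycle τ (dart V b a)))) :=
      (measure_union_le _ _).trans (add_le_add (measure_union_le _ _) (measure_union_le _ _))
    _ ≤ ((4 * 2 ^ k)⁻¹ + (4 * 2 ^ k)⁻¹) + ((4 * 2 ^ k)⁻¹ + (4 * 2 ^ k)⁻¹) :=
      add_le_add (add_le_add (key σ hσ _ (hσ.maps _ (hmem a b))) (key τ hτ _ (hmem a b)))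
        (add_le_add (key σ hσ _ (hσ.maps _ (hmem b a))) (key τ hτ _ (hmem b a)))
    _ = (2 ^ k : ENNReal)⁻¹ := by
      rw [← two_mul, ← two_mul, ← mul_assoc, ENNReal.mul_inv (by simp) (by simp), ← mul_assoc,
        show (2 * 2 : ENNReal) = 4 by norm_num, ENNReal.mul_inv_cancel (by simp) (by simp), one_mul]

/-- The constant in the running times that hold with probability `1 - 1 / V ^ c`. -/
def timeConstant (c : ℕ) : ℝ := 84 * (240 + 128 * c) + 260

theorem tapeLaw_cost_le {D : Type u} (hV : 3 ≤ V) (F : Forest V D) (o : Op V D) {w y : ℝ}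
    (hw : 1 ≤ w) (hy : 1 ≤ y) (c : ℕ) :
    tapeLaw {ω | ¬ o.weight w y * o.cost ω F ≤ timeConstant c * o.bound w y} ≤
      1 / (V : ENNReal) ^ c := by
  have h1 := one_le_ratio hV
  have h2 := depth_le_ratio hV
  have h3 := depth_le_log hV
  have h4 := base_le hV
  have h5 := (one_lt_log hV).le
  have hc : (0 : ℝ) ≤ c := Nat.cast_nonneg c
  have hC : 30 ≤ timeConstant c := by unfold timeConstant; linarith
  set X := Real.log V / Real.log (Real.log V)
  have hedge : ∀ a b : Fin V, tapeLaw {ω | ¬ y *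
      (84 * nearSum ω F a b + 60 * (depth V + 1) + 20 : ℕ) ≤
        timeConstant c * (y * Real.log V ^ 2)} ≤ 1 / (V : ENNReal) ^ c := by
    intro a b
    refine (measure_mono fun ω hω => ?_).trans ((tapeLaw_nearSum_le F a b (c * base V)).trans ?_)
    · rw [Set.mem_ofPred_eq] at hω ⊢
      contrapose! hω
      have hn : (nearSum ω F a b : ℝ) ≤
          4 * (depth V + 1) + 8 * base V * (depth V + 4 + c * base V) := by exact_mod_cast hω
      have hB0 : (0 : ℝ) ≤ base V := Nat.cast_nonneg _
      have hprod : (base V : ℝ) * (depth V + 4 + c * base V) ≤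
          4 * Real.log V * (7 * Real.log V + c * (4 * Real.log V)) :=
        mul_le_mul h4 (add_le_add (by linarith) (mul_le_mul_of_nonneg_left h4 hc)) (by positivity)
          (by linarith)
      have hsq : Real.log V ≤ Real.log V ^ 2 := by nlinarith
      have hfin : (84 * nearSum ω F a b + 60 * (depth V + 1) + 20 : ℝ) ≤
          timeConstant c * Real.log V ^ 2 := by
        unfold timeConstant
        nlinarith
      push_cast
      calc y * (84 * (nearSum ω F a b : ℝ) + 60 * (depth V + 1) + 20)
          ≤ y * (timeConstant c * Real.log V ^ 2) := mul_le_mul_of_nonneg_left hfin (by linarith)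
        _ = _ := by ring
    · rw [one_div, ENNReal.inv_le_inv, mul_comm, pow_mul]
      exact pow_le_pow_left₀ (by simp) (by exact_mod_cast (lt_two_pow_base V).le) c
  -- Root finding and updates are fast for every tape.
  have hempty : ∀ p : Tape → Prop, (∀ ω, p ω) → tapeLaw {ω | ¬ p ω} ≤ 1 / (V : ENNReal) ^ c := by
    intro p hp
    simp [hp]
  cases o with
  | root v =>
    refine hempty _ fun ω => ?_
    simp only [Op.weight, Op.cost, Op.bound]
    push_cast
    nlinarith
  | update v f =>
    refine hempty _ fun ω => ?_
    simp only [Op.weight, Op.cost, Op.bound]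
    push_cast
    have h6 : (6 * ((depth V : ℝ) + 2)) ≤ timeConstant c * X := by nlinarith
    calc w * (6 * ((depth V : ℝ) + 2)) ≤ w * (timeConstant c * X) :=
          mul_le_mul_of_nonneg_left h6 (by linarith)
      _ = _ := by ring
  | link a b => exact hedge a b
  | cut a b => exact hedge a b

end Bounds

end AugTree

theorem mainTheorem3 :
    ∃ P : AugTree.DataStructure,
      (∀ (V : ℕ), 3 ≤ V → ∀ (D : Type*) [CommSemigroup D] (x : ℕ → D),
        ∀ᵐ ω ∂AugTree.tapeLaw, P.Solves V x ω) ∧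
      ∀ c : ℕ, ∃ C : ℝ, 0 < C ∧
        ∀ (V : ℕ), 3 ≤ V → ∀ (D : Type*) [CommSemigroup D] (x : ℕ → D) (w y : ℝ),
          1 ≤ w → 1 ≤ y →
          ∀ (ops : List (AugTree.Op V D)) (o : AugTree.Op V D),
            (AugTree.Forest.edgeless V x).ValidSeq (ops ++ [o]) →
            AugTree.tapeLaw {ω | ¬ ∃ s, P.Reaches ω x (ops ++ [o]) s ∧ s.time w y ≤ C * o.bound w y}
              ≤ 1 / (V : ENNReal) ^ c := by
  refine ⟨AugTree.tourStructure, fun V hV D _ x =>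
    Filter.Eventually.of_forall (AugTree.tourStructure_solves hV x), fun c =>
    ⟨AugTree.timeConstant c, by unfold AugTree.timeConstant; positivity,
      fun V hV D _ x w y hw hy ops o hval => ?_⟩⟩
  obtain ⟨hops, ho, -⟩ := AugTree.Forest.validSeq_append.1 hval
  refine (measure_mono fun ω hω => ?_).trans
    (AugTree.tapeLaw_cost_le hV ((AugTree.Forest.edgeless V x).after ops) o hw hy c)
  rw [Set.mem_ofPred_eq] at hω ⊢
  contrapose! hω
  obtain ⟨s, hs, sc, hd, A, h⟩ := AugTree.exists_reaches (ω := ω) hV x hops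
  obtain ⟨t, ht, -, htime⟩ := h.step hV hw hy ho
  exact ⟨t, AugTree.reaches_append.2 ⟨s, hs, t, ht, rfl⟩, htime.trans hω⟩
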